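/- **Setting.** All homology has coefficients in $\mathbb{Z}_2$; chains are finite sets of simplices, and "$\sigma\in c$" means that $\sigma$ occurs in the chain $c$. Let $\mathcal F:\emptyset=K_0\leftrightarrow K_1\leftrightarrow\cdots\leftrightarrow K_m=\emptyset$ be a simplex-wise zigzag filtration: each arrow is a forward inclusion $K_j\hookrightarrow K_{j+1}$ or a backward inclusion $K_j\hookleftarrow K_{j+1}$ that adds or deletes one simplex $\sigma_j$. $\mathsf{Pers}_q(\mathcal F)$ denotes the multiset of intervals in the interval decomposition of the zigzag module $\mathsf H_q(\mathcal F)$, and $\mathsf{Pers}_*(\mathcal F)=\bigsqcup_q\mathsf{Pers}_q(\mathcal F)$. A $q$-th *representative* of $[b,d]\subseteq\{1,\dots,m-1\}$ consists of cycles $z_j\in\mathsf Z_q(K_j)$ $(b\le j\le d)$ and $(q+1)$-chains $c_j$ with $z_j+z_{j+1}=\partial c_j$ $(b\le j<d)$, where $c_j$ lies in the larger of $K_j,K_{j+1}$, such that: if $K_{b-1}\hookleftarrow K_b$, there is also a chain $c_{b-1}$ in $K_{b-1}$ with $z_b=\partial c_{b-1}$ and $\sigma_{b-1}\in c_{b-1}$;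 if $K_{b-1}\hookrightarrow K_b$, then $\sigma_{b-1}\in z_b$ (birth condition); if $K_d\hookrightarrow K_{d+1}$, there is also a chain $c_d$ in $K_{d+1}$ with $z_d=\partial c_d$ and $\sigma_d\in c_d$; if $K_d\hookleftarrow K_{d+1}$, then $\sigma_d\in z_d$ (death condition). Without the death (birth) condition it is a post-birth (pre-death) representative. For $b_1\ne b_2$ write $b_1\prec_{\mathsf b}b_2$ if $b_1<b_2$ and $K_{b_2-1}\hookrightarrow K_{b_2}$, or $b_1>b_2$ and $K_{b_1-1}\hookleftarrow K_{b_1}$; for $d_1\neq d_2$ write $d_1\prec_{\mathsf d}d_2$ if $d_1>d_2$ and $K_{d_2}\hookleftarrow K_{d_2+1}$, or $d_1<d_2$ and $K_{d_1}\hookrightarrow K_{d_1+1}$. Operations: $\zeta|^t$ and $\zeta|_t$ are the restrictions of a sequence to indices $\le t$ and $\ge t$. For post-birth representatives of $[b_1,t],[b_2,t]$, $\zeta_1\oplus_{\mathsf b}\zeta_2$ is the sequence on $[\max_{\prec_{\mathsf b}}\{b_1,b_2\},t]$ obtained by adding cycles and chains index by index (a summand contributes nothing where it is not defined); $\oplus_{\mathsf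 d}$ is defined symmetrically for pre-death representatives. If $\zeta_1$ ends at $t$ with $z_t$, $\zeta_2$ begins at $t$ with $z'_t$ and $z_t+z_t'=\partial A$, the concatenation $\zeta_1\Vert_A\zeta_2$ uses $\zeta_1$ before $t$, $\zeta_2$ from $t$ on, and the chain $c_{t-1}+A$ between $t-1$ and $t$. Finally $\zeta_1\oplus\zeta_2=(\zeta_1|^t\oplus_{\mathsf b}\zeta_2|^t)\Vert_0(\zeta_1|_t\oplus_{\mathsf d}\zeta_2|_t)$ for a common index $t$. **The operation.** Suppose that $K_{i-1}\hookleftarrow K_i\hookrightarrow K_{i+1}$ delete and then add the same $p$-simplex $\sigma$, so $K_{i-1}=K_{i+1}$. The outward contraction $\mathcal F'$ of $\mathcal F$ replaces $K_{i-1},K_i,K_{i+1}$ by the single complex $K'=K_{i-1}=K_{i+1}$. Number the complexes of $\mathcal F'$ consecutively, so that $K'$ has index $i-1$, and let $\kappa(j)=j$ for $j\le i-1$, $\kappa(i)=i-1$, $\kappa(j)=j-2$ for $j\ge i+1$. Parts of sequences at indices $\ge i+1$ are renumbered by $j\mapsto j-2$ when used in $\mathcal F'$. Let $\mathsf{Pers}_*(\mathcal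 F)$ be given with a representative for each of its intervals. The *carried-over* sequence of a representative for $[b,d]$ is the same sequence, renumbered, if $i\notin[b,d]$; if $i\in[b,d]$ it has the cycle $z_i$ at $K'$, the chains $c_{i-2}+c_{i-1}$ and $c_i+c_{i+1}$ on the arrows before and after $K'$, and is otherwise the same, renumbered. **Theorem.** The map $\mathsf H_*(K_{i-1})\leftarrow\mathsf H_*(K_i)$ is surjective or injective. It is surjective iff some interval of $\mathsf{Pers}_*(\mathcal F)$ begins at $i$, and injective iff some interval ends at $i-1$. *Surjective case.* $[i,i]$ occurs exactly once in $\mathsf{Pers}_*(\mathcal F)$. Removing it and replacing every other $[b,d]$ by $[\kappa(b),\kappa(d)]$ gives $\mathsf{Pers}_*(\mathcal F')$, with the same homological dimensions, and the carried-over sequences are representatives. *Injective case.* Exactly one interval $[b_*,i-1]$ ends at $i-1$ and exactly one interval $[i+1,d_\circ]$ begins at $i+1$; both are in $\mathsf{Pers}_p(\mathcal F)$. Let $\zeta_*$ (with cycles $z^*$) and $\zeta_\circ$ (with cycles $z^\circ$) be their representatives, and let $[\beta_j,\delta_j]$, $j\in\mathcal B$, be the intervals in $\mathsf{Pers}_p(\mathcal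 F)$ containing $i+1$ other than $[i+1,d_\circ]$, with representatives $\tilde\zeta_j$ (cycles $\tilde z^j$, chains $\tilde c^j$). There are a unique $\Lambda\subseteq\mathcal B$ and some $A\in\mathsf C_{p+1}(K_{i+1})$ with $$z^*_{i-1}=z^\circ_{i+1}+\sum_{j\in\Lambda}\tilde z^j_{i+1}+\partial A.\qquad(1)$$ Start with any such $A$. As long as possible, and in any order, choose $j\in\Lambda$ with $\beta_j\prec_{\mathsf b}b_*$, replace $\zeta_*$ by $\zeta_*\oplus\tilde\zeta_j$ and $A$ by $A+\tilde c^j_{i-1}+\tilde c^j_i$, and delete $j$ from $\Lambda$; or choose $j\in\Lambda$ with $\delta_j\prec_{\mathsf d}d_\circ$, replace $\zeta_\circ$ by $\zeta_\circ\oplus\tilde\zeta_j$, and delete $j$ from $\Lambda$. This can be completed. However it is done, at the end $\zeta_*$ and $\zeta_\circ$ are representatives in $\mathcal F$ for $[b_*,i-1]$ and $[i+1,d_\circ]$, (1) holds for the new data, and $b_*\prec_{\mathsf b}\beta_j$, $d_\circ\prec_{\mathsf d}\delta_j$ for all $j\in\Lambda$. List the remaining intervals as $[b_1,d_1],\dots,[b_\ell,d_\ell]$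 with $b_1\prec_{\mathsf b}\cdots\prec_{\mathsf b}b_\ell$, with representatives $\zeta_1,\dots,\zeta_\ell$ (chains $c^1,\dots,c^\ell$), and for $0\le r\le\ell$ put $$\Theta_r=\big(\zeta_*\oplus_{\mathsf b}\zeta_1|^{i-1}\oplus_{\mathsf b}\cdots\oplus_{\mathsf b}\zeta_r|^{i-1}\big)\,\Vert_{A_r}\,\big(\zeta_\circ\oplus_{\mathsf d}\zeta_{r+1}|_{i+1}\oplus_{\mathsf d}\cdots\oplus_{\mathsf d}\zeta_\ell|_{i+1}\big),\qquad A_r=A+\sum_{j\le r}(c^j_{i-1}+c^j_i),$$ joined at $K'$. Pair births with deaths as follows. If $\ell=0$, pair $b_*$ with $d_\circ$. If $\ell\ge1$, pair $b_*$ with $\max_{\prec_{\mathsf d}}\{d_1,\dots,d_\ell\}$, then $b_\ell$ with $d_\circ$; then for $r=1,\dots,\ell-1$ in this order pair $b_r$ with $d_r$ if $d_r$ is still unpaired, and otherwise with $\max_{\prec_{\mathsf d}}\{d_{r+1},\dots,d_\ell\}$. All other intervals of $\mathsf{Pers}_*(\mathcal F)$ keep their ends. Then $\mathsf{Pers}_*(\mathcal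 F')$ consists of the intervals $[\kappa(b),\kappa(d)]$ for the resulting pairs $(b,d)$, with the homological dimension of the interval of $\mathcal F$ born at $b$. Representatives in $\mathcal F'$ are: $\Theta_0$ for the pair of $b_*$; $\Theta_\ell$ for the pair of $b_\ell$ if $\ell\ge1$; $\Theta_r$ for the pair of $b_r$, $1\le r\le\ell-1$, if $b_r$ is not paired with $d_r$; and the carried-over sequence for every pair that was an interval of $\mathcal F$. -/

import Mathlib

set_option maxSynthPendingDepth 3

noncomputable section

namespace Zigzag

/-! ### Simplicial homology with coefficients in the field with two elements -/

/-- Chains with coefficients in `ZMod 2`; a chain is thought of as the finite set of simplices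
on which it is non-zero. -/
abbrev Chain (V : Type*) := Finset V →₀ ZMod 2

/-- The boundary operator: a simplex with at least two vertices goes to the sum of its facets,
a vertex goes to zero. -/
def boundary {V : Type*} [DecidableEq V] : Chain V →ₗ[ZMod 2] Chain V :=
  Finsupp.linearCombination (ZMod 2) fun s : Finset V =>
    if s.card ≤ 1 then 0 else ∑ v ∈ s, Finsupp.single (s.erase v) (1 : ZMod 2)

/-- `C_p(K)`: the chains made of `p`-simplices of `K`. -/
def chains {V : Type*} (K : PreAbstractSimplicialComplex V) (p : ℕ) :
    Submodule (ZMod 2) (Chain V) :=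
  Finsupp.supported (ZMod 2) (ZMod 2) {s | s ∈ K ∧ s.card = p + 1}

/-- `Z_p(K)`: the `p`-cycles of `K`. -/
def cycles {V : Type*} [DecidableEq V] (K : PreAbstractSimplicialComplex V) (p : ℕ) :
    Submodule (ZMod 2) (Chain V) :=
  chains K p ⊓ LinearMap.ker boundary

/-- The `p`-boundaries of `K`. -/
def boundaries {V : Type*} [DecidableEq V] (K : PreAbstractSimplicialComplex V) (p : ℕ) :
    Submodule (ZMod 2) (Chain V) :=
  (chains K (p + 1)).map boundary

/-- `H_p(K)`: cycles modulo boundaries. -/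
abbrev Homology {V : Type*} [DecidableEq V] (K : PreAbstractSimplicialComplex V) (p : ℕ) :=
  cycles K p ⧸ (boundaries K p).submoduleOf (cycles K p)

theorem chains_mono {V : Type*} {K L : PreAbstractSimplicialComplex V} (h : K ≤ L) (p : ℕ) :
    chains K p ≤ chains L p :=
  Finsupp.supported_mono fun _ hs => ⟨h hs.1, hs.2⟩

theorem cycles_mono {V : Type*} [DecidableEq V] {K L : PreAbstractSimplicialComplex V}
    (h : K ≤ L) (p : ℕ) : cycles K p ≤ cycles L p :=
  inf_le_inf_right _ (chains_mono h p)

/-- The map `H_p(K) → H_p(L)` induced by an inclusion of `K` in `L`. -/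
def homologyMap {V : Type*} [DecidableEq V] {K L : PreAbstractSimplicialComplex V}
    (h : K ≤ L) (p : ℕ) : Homology K p →ₗ[ZMod 2] Homology L p :=
  Submodule.mapQ _ _ (Submodule.inclusion (cycles_mono h p)) fun _ hx =>
    Submodule.map_mono (chains_mono h (p + 1)) hx

/-! ### Zigzag filtrations and barcodes -/

/-- A simplex-wise zigzag filtration `∅ = K_0 ↔ K_1 ↔ ⋯ ↔ K_m = ∅`. The arrow between
`K_j` and `K_{j+1}` adds or deletes the simplex `cell j`. Past the end, `K` is continued by empty
complexes. -/
structure Filtration (V : Type*) where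
  m : ℕ
  K : ℕ → PreAbstractSimplicialComplex V
  cell : ℕ → Finset V
  step : ∀ j < m,
    (cell j ∉ K j ∧ (K (j + 1)).faces = insert (cell j) (K j).faces) ∨
    (cell j ∉ K (j + 1) ∧ (K j).faces = insert (cell j) (K (j + 1)).faces)
  K_zero : K 0 = ⊥
  K_end : ∀ j, m ≤ j → K j = ⊥

/-- The arrow between `K_j` and `K_{j+1}` is a forward inclusion. -/
def Filtration.Fwd {V : Type*} (F : Filtration V) (j : ℕ) : Prop := F.K j ≤ F.K (j + 1)

/-- The arrow between `K_j` and `K_{j+1}` is a backward inclusion. -/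
def Filtration.Bwd {V : Type*} (F : Filtration V) (j : ℕ) : Prop := F.K (j + 1) ≤ F.K j

/-- The space at index `j` of the direct sum, over `k : ι`, of the interval modules on the
intervals `[(I k).1, (I k).2]`: one copy of `ZMod 2` for every interval that contains `j`. -/
abbrev IntervalSum {ι : Type*} (I : ι → ℕ × ℕ) (j : ℕ) :=
  {k : ι // (I k).1 ≤ j ∧ j ≤ (I k).2} →₀ ZMod 2

open Classical in
/-- The structure map from index `j` to an adjacent index `j'` of a direct sum of interval
modules: the identity on every interval that contains both, zero on the others. -/
def intervalSumMap {ι : Type*} (I : ι → ℕ × ℕ) (j j' : ℕ) :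
    IntervalSum I j →ₗ[ZMod 2] IntervalSum I j' :=
  Finsupp.linearCombination (ZMod 2)
    fun k : {k : ι // (I k).1 ≤ j ∧ j ≤ (I k).2} =>
      if h : (I k.1).1 ≤ j' ∧ j' ≤ (I k.1).2 then
        Finsupp.single (⟨k.1, h⟩ : {k : ι // (I k).1 ≤ j' ∧ j' ≤ (I k).2}) (1 : ZMod 2)
      else 0

/-- The intervals `I k`, `k : ι`, form the barcode `Pers_q(F)`: the zigzag module `H_q(F)` is
isomorphic to the direct sum of the interval modules on them. -/
def Filtration.IsBarcode {V : Type*} [DecidableEq V] (F : Filtration V) (q : ℕ)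
    {ι : Type*} (I : ι → ℕ × ℕ) : Prop :=
  (∀ k, (I k).1 ≤ (I k).2 ∧ (I k).2 ≤ F.m) ∧
  ∃ e : ∀ j, Homology (F.K j) q ≃ₗ[ZMod 2] IntervalSum I j,
    ∀ j < F.m,
      (∀ (h : F.K j ≤ F.K (j + 1)) (x : Homology (F.K j) q),
        e (j + 1) (homologyMap h q x) = intervalSumMap I j (j + 1) (e j x)) ∧
      (∀ (h : F.K (j + 1) ≤ F.K j) (x : Homology (F.K (j + 1)) q),
        e j (homologyMap h q x) = intervalSumMap I (j + 1) j (e (j + 1) x))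

/-! ### Representative sequences -/

/-- The data of a (full, post-birth or pre-death) representative sequence for `[b, d]`: a cycle
`z j` for `b ≤ j ≤ d` and chains `c j` for `b - 1 ≤ j ≤ d`. The values at all other indices, and
those of the chains at the two ends that are undefined, carry no meaning. -/
structure RepSeq (V : Type*) where
  b : ℕ
  d : ℕ
  z : ℕ → Chain V
  c : ℕ → Chain V

/-- `ζ` is a `q`-th representative sequence for the interval `[ζ.b, ζ.d]` in `F`. -/
structure Filtration.IsRep {V : Type*} [DecidableEq V] (F : Filtration V) (q : ℕ)
    (ζ : RepSeq V) : Prop where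
  one_le : 1 ≤ ζ.b
  le : ζ.b ≤ ζ.d
  lt : ζ.d < F.m
  cycle : ∀ j, ζ.b ≤ j → j ≤ ζ.d → ζ.z j ∈ cycles (F.K j) q
  fwd : ∀ j, ζ.b ≤ j → j < ζ.d → F.Fwd j →
    ζ.c j ∈ chains (F.K (j + 1)) (q + 1) ∧ ζ.z j + ζ.z (j + 1) = boundary (ζ.c j)
  bwd : ∀ j, ζ.b ≤ j → j < ζ.d → F.Bwd j →
    ζ.c j ∈ chains (F.K j) (q + 1) ∧ ζ.z j + ζ.z (j + 1) = boundary (ζ.c j)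
  birth_bwd : F.Bwd (ζ.b - 1) →
    ζ.c (ζ.b - 1) ∈ chains (F.K (ζ.b - 1)) (q + 1) ∧
    ζ.z ζ.b = boundary (ζ.c (ζ.b - 1)) ∧ ζ.c (ζ.b - 1) (F.cell (ζ.b - 1)) ≠ 0
  birth_fwd : F.Fwd (ζ.b - 1) → ζ.z ζ.b (F.cell (ζ.b - 1)) ≠ 0
  death_fwd : F.Fwd ζ.d →
    ζ.c ζ.d ∈ chains (F.K (ζ.d + 1)) (q + 1) ∧
    ζ.z ζ.d = boundary (ζ.c ζ.d) ∧ ζ.c ζ.d (F.cell ζ.d) ≠ 0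
  death_bwd : F.Bwd ζ.d → ζ.z ζ.d (F.cell ζ.d) ≠ 0

/-- The barcode of `F` in all dimensions, with representatives: every `ζ k` is a representative
sequence of dimension `dim k`, and for every `q` the intervals of those of dimension `q` form
`Pers_q(F)`. -/
def Filtration.IsBarcodeWithReps {V : Type*} [DecidableEq V] (F : Filtration V) {ι : Type*}
    (dim : ι → ℕ) (ζ : ι → RepSeq V) : Prop :=
  (∀ k, F.IsRep (dim k) (ζ k)) ∧
  ∀ q, F.IsBarcode q fun k : {k : ι // dim k = q} => ((ζ k.1).b, (ζ k.1).d)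

/-- The birth order `b₁ ≺_b b₂`. -/
def Filtration.BirthLT {V : Type*} (F : Filtration V) (b₁ b₂ : ℕ) : Prop :=
  (b₁ < b₂ ∧ F.Fwd (b₂ - 1)) ∨ (b₂ < b₁ ∧ F.Bwd (b₁ - 1))

/-- The death order `d₁ ≺_d d₂`. -/
def Filtration.DeathLT {V : Type*} (F : Filtration V) (d₁ d₂ : ℕ) : Prop :=
  (d₂ < d₁ ∧ F.Bwd d₂) ∨ (d₁ < d₂ ∧ F.Fwd d₁)

namespace RepSeq

/-- The prefix of a sequence up to index `t`. -/
def pre {V : Type*} (t : ℕ) (ζ : RepSeq V) : RepSeq V := { ζ with d := t }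

/-- The suffix of a sequence from index `t`. -/
def suf {V : Type*} (t : ℕ) (ζ : RepSeq V) : RepSeq V := { ζ with b := t }

open Classical in
/-- The sum of two post-birth representatives for `[b₁, t]` and `[b₂, t]`, one for
`[max b₁ b₂, t]` where the maximum is that of the birth order. Both sequences are added index by
index; at indices before its birth a summand contributes nothing. -/
def sumB {V : Type*} (F : Filtration V) (ζ₁ ζ₂ : RepSeq V) : RepSeq V where
  b := if F.BirthLT ζ₁.b ζ₂.b then ζ₂.b else ζ₁.b
  d := ζ₁.d
  z x := (if ζ₁.b ≤ x then ζ₁.z x else 0) + (if ζ₂.b ≤ x then ζ₂.z x else 0)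
  c x := (if ζ₁.b ≤ x + 1 then ζ₁.c x else 0) + (if ζ₂.b ≤ x + 1 then ζ₂.c x else 0)

open Classical in
/-- The sum of two pre-death representatives for `[t, d₁]` and `[t, d₂]`, one for
`[t, max d₁ d₂]` where the maximum is that of the death order. -/
def sumD {V : Type*} (F : Filtration V) (ζ₁ ζ₂ : RepSeq V) : RepSeq V where
  b := ζ₁.b
  d := if F.DeathLT ζ₁.d ζ₂.d then ζ₂.d else ζ₁.d
  z x := (if x ≤ ζ₁.d then ζ₁.z x else 0) + (if x ≤ ζ₂.d then ζ₂.z x else 0)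
  c x := (if x ≤ ζ₁.d then ζ₁.c x else 0) + (if x ≤ ζ₂.d then ζ₂.c x else 0)

/-- The concatenation of a post-birth representative `ζ₁` for `[b, t]` and a pre-death
representative `ζ₂` for `[t, d]` along a chain `A` whose boundary is the sum of their cycles
at `t = ζ₂.b`. -/
def concat {V : Type*} (ζ₁ ζ₂ : RepSeq V) (A : Chain V) : RepSeq V where
  b := ζ₁.b
  d := ζ₂.d
  z x := if x < ζ₂.b then ζ₁.z x else ζ₂.z x
  c x := if x + 1 < ζ₂.b then ζ₁.c x else if x + 1 = ζ₂.b then ζ₁.c x + A else ζ₂.c x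

/-- The sum of two representatives whose intervals contain the common index `t`. -/
def sum {V : Type*} (F : Filtration V) (t : ℕ) (ζ₁ ζ₂ : RepSeq V) : RepSeq V :=
  concat (sumB F (ζ₁.pre t) (ζ₂.pre t)) (sumD F (ζ₁.suf t) (ζ₂.suf t)) 0

end RepSeq

/-! ### Outward contraction -/

/-- `F'` is obtained from `F` by the outward contraction at `i`: the two arrows
`K_{i-1} ← K_i → K_{i+1}` of `F`, which delete and then add `σ`, are replaced by the single complex
`K_{i-1} = K_{i+1}`. The complexes of `F'` are numbered consecutively, so that this complex has
index `i - 1` in `F'`, and `K_{j+2}` has index `j` in `F'` for `j ≥ i`. -/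
structure IsOutwardContraction {V : Type*} (F F' : Filtration V) (i : ℕ) (σ : Finset V) :
    Prop where
  one_le : 1 ≤ i
  lt : i < F.m
  cell_left : F.cell (i - 1) = σ
  cell_right : F.cell i = σ
  left : F.K i ≤ F.K (i - 1)
  right : F.K i ≤ F.K (i + 1)
  length : F'.m + 2 = F.m
  K_eq : ∀ j, F'.K j = F.K (if j < i then j else j + 2)

/-- The index in `F'` of the complex at index `j` of `F`, where `i - 1`, `i` and `i + 1` all
become the index `i - 1` of the contracted complex. -/
def collapse (i j : ℕ) : ℕ := if j < i then j else if j = i then i - 1 else j - 2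

/-- A sequence that lives on indices `≥ i + 1` of `F`, renumbered for `F'`. -/
def RepSeq.shift {V : Type*} (ζ : RepSeq V) : RepSeq V where
  b := ζ.b - 2
  d := ζ.d - 2
  z x := ζ.z (x + 2)
  c x := ζ.c (x + 2)

/-- The sequence for `F'` obtained from a representative in `F` for an interval that is carried
over. If the interval contains `i`, the cycle at the contracted complex is `z_i`, and the
chains on the two sides of it are `c_{i-2} + c_{i-1}` and `c_i + c_{i+1}`; otherwise the sequence is
unchanged, up to numbering. -/
def RepSeq.carry {V : Type*} (i : ℕ) (ζ : RepSeq V) : RepSeq V :=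
  if ζ.d < i then ζ
  else if i < ζ.b then ζ.shift
  else
    { b := ζ.b
      d := ζ.d - 2
      z := fun x => if x + 1 < i then ζ.z x else if x + 1 = i then ζ.z i else ζ.z (x + 2)
      c := fun x =>
        if x + 2 < i then ζ.c x
        else if x + 2 = i then ζ.c x + ζ.c (x + 1)
        else if x + 1 = i then ζ.c (x + 1) + ζ.c (x + 2)
        else ζ.c (x + 2) }

/-- The state of the reduction phase: the set `Λ` of intervals still in the sum, the current
representatives `ζs` for `[b_*, i-1]` and `ζo` for `[i+1, d_∘]`, and the current chain `A`. -/
structure State (V ι : Type*) where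
  Λ : Finset ι
  ζs : RepSeq V
  ζo : RepSeq V
  A : Chain V

/-- The relation `z^*_{i-1} = z^∘_{i+1} + ∑_{j ∈ Λ} z^j_{i+1} + ∂A` with `A` a `(p+1)`-chain in
`K_{i+1}`. -/
def State.Relation {V : Type*} [DecidableEq V] {ι : Type*} (F : Filtration V) (i p : ℕ)
    (ζ : ι → RepSeq V) (S : State V ι) : Prop :=
  S.A ∈ chains (F.K (i + 1)) (p + 1) ∧
  S.ζs.z (i - 1) = S.ζo.z (i + 1) + ∑ j ∈ S.Λ, (ζ j).z (i + 1) + boundary S.A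

/-- `S` is an initial state: its representatives are the given ones `ζ s` and `ζ o` for
`[b_*, i-1]` and `[i+1, d_∘]`, `Λ` is a set of `p`-th intervals containing `i + 1`, other than
`[i+1, d_∘]`, and the relation holds. -/
def State.IsInitial {V : Type*} [DecidableEq V] {ι : Type*} (F : Filtration V) (i p : ℕ)
    (dim : ι → ℕ) (ζ : ι → RepSeq V) (s o : ι) (S : State V ι) : Prop :=
  S.ζs = ζ s ∧ S.ζo = ζ o ∧
  (∀ j ∈ S.Λ, j ≠ o ∧ dim j = p ∧ (ζ j).b ≤ i + 1 ∧ i + 1 ≤ (ζ j).d) ∧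
  S.Relation F i p ζ

/-- One reduction step. An interval `j ∈ Λ` with `b_j ≺_b b_*` is removed from `Λ` and its
representative is added to the one for `[b_*, i-1]`; or one with `d_j ≺_d d_∘` is removed and its
representative is added to the one for `[i+1, d_∘]`. -/
inductive State.Step {V : Type*} {ι : Type*} [DecidableEq ι] (F : Filtration V) (i : ℕ)
    (ζ : ι → RepSeq V) (s o : ι) : State V ι → State V ι → Prop
  | left (S : State V ι) (j : ι) (hj : j ∈ S.Λ) (h : F.BirthLT (ζ j).b (ζ s).b) :
      State.Step F i ζ s o S
        { Λ := S.Λ.erase j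
          ζs := S.ζs.sum F (i - 1) (ζ j)
          ζo := S.ζo
          A := S.A + ((ζ j).c (i - 1) + (ζ j).c i) }
  | right (S : State V ι) (j : ι) (hj : j ∈ S.Λ) (h : F.DeathLT (ζ j).d (ζ o).d) :
      State.Step F i ζ s o S
        { Λ := S.Λ.erase j
          ζs := S.ζs
          ζo := S.ζo.sum F (i + 1) (ζ j)
          A := S.A }

/-- The reduction phase run from `S₀` can end in `S`, with the intervals that remain in `Λ` listed
by increasing birth as `js`. -/
def State.Run {V : Type*} {ι : Type*} [DecidableEq ι] (F : Filtration V) (i : ℕ)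
    (ζ : ι → RepSeq V) (s o : ι) (S₀ S : State V ι) (js : List ι) : Prop :=
  Relation.ReflTransGen (State.Step F i ζ s o) S₀ S ∧
  (∀ S', ¬ State.Step F i ζ s o S S') ∧
  js.Nodup ∧ js.toFinset = S.Λ ∧ js.Pairwise fun j k => F.BirthLT (ζ j).b (ζ k).b

open Classical in
/-- The member of the list `k :: t` whose death index is the largest in the death order. -/
def maxDeath {V : Type*} (F : Filtration V) {ι : Type*} (ζ : ι → RepSeq V) (k : ι)
    (t : List ι) : ι :=
  t.foldl (fun j l => if F.DeathLT (ζ j).d (ζ l).d then l else j) k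

/-- The greedy phase, over the list `[1, …, ℓ]` without its last entry. Here `P` is the set of
those `j` for which the death index `d_j` is already paired: if `d_r` is unpaired, `b_r` is paired with
`d_r`, and otherwise with the largest of `d_{r+1}, …, d_ℓ`. The value of the resulting function at
`r` is the `j` such that `b_r` is paired with `d_j`. -/
def greedy {V : Type*} (F : Filtration V) {ι : Type*} [DecidableEq ι] (ζ : ι → RepSeq V) :
    Finset ι → List ι → ι → ι
  | _, [] => id
  | _, [_] => id
  | P, r :: k :: t =>
      let δ := if r ∈ P then maxDeath F ζ k t else r
      Function.update (greedy F ζ (insert δ P) (k :: t)) r δ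

/-- The new pairing: `b_k` is paired with `d_{partner k}`. First `b_*` is paired with the largest of
`d_1, …, d_ℓ`, then `b_ℓ` with `d_∘`, then the others greedily; all other intervals keep their
ends. If `ℓ = 0`, then `b_*` is paired with `d_∘`. -/
def partner {V : Type*} (F : Filtration V) {ι : Type*} [DecidableEq ι] (ζ : ι → RepSeq V)
    (s o : ι) : List ι → ι → ι
  | [] => Function.update id s o
  | k :: t =>
      let δ := maxDeath F ζ k t
      Function.update
        (Function.update (greedy F ζ {δ} (k :: t)) ((k :: t).getLast (List.cons_ne_nil k t)) o) s δ

/-- The sequence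
`(ζ_* ⊕_b ζ_1 ⊕_b ⋯ ⊕_b ζ_r) ‖ (ζ_∘ ⊕_d ζ_{r+1} ⊕_d ⋯ ⊕_d ζ_ℓ)` for `F'`, where the summands on the
left are restricted to indices `≤ i - 1` and those on the right to indices `≥ i + 1`. -/
def joined {V : Type*} (F : Filtration V) {ι : Type*} (i : ℕ) (ζ : ι → RepSeq V)
    (S : State V ι) (js : List ι) (r : ℕ) : RepSeq V :=
  RepSeq.concat
    (((js.take r).map fun j => (ζ j).pre (i - 1)).foldl (RepSeq.sumB F) S.ζs)
    (((js.drop r).map fun j => (ζ j).suf (i + 1)).foldl (RepSeq.sumD F) S.ζo).shift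
    (S.A + ((js.take r).map fun j => (ζ j).c (i - 1) + (ζ j).c i).sum)

/-- The new representatives, indexed by birth: for `b_*` the joined sequence with `r = 0`; for
`b_r` the joined sequence with that `r` if `b_r` has got a new partner; and the carried-over
sequence for all intervals that keep both ends. -/
def newRep {V : Type*} (F : Filtration V) {ι : Type*} [DecidableEq ι] (i : ℕ)
    (ζ : ι → RepSeq V) (s o : ι) (S : State V ι) (js : List ι) (k : ι) : RepSeq V :=
  if k = s then joined F i ζ S js 0
  else if k ∈ js ∧ partner F ζ s o js k ≠ k then joined F i ζ S js (js.idxOf k + 1)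
  else (ζ k).carry i

end Zigzag

end

/-! The proof rests on a local criterion: a family of representatives is a barcode exactly when on
every arrow precisely one interval of the family begins or ends (`Filtration.Events`). In one
direction, adding a simplex either creates one homology class or destroys one, so the maps of a
barcode along an arrow have kernel and cokernel of total dimension one (`IsBarcodeWithReps.events`).
Conversely, the birth and death conditions carry a homology basis made of the active cycles across
each arrow, starting from the empty complex (`isHBasis_of_events`), and these bases are the required
isomorphisms with the sum of interval modules (`isBarcodeWithReps_of_events`).

The contraction removes two arrows and keeps all others. It is therefore enough to find
representatives in `F'` whose births and deaths are those of `F`, apart from the one event on each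
removed arrow (`IsOutwardContraction.isBarcodeWithReps`).

If `σ` lies in no cycle of `K_{i-1}`, its deletion uncovers a class and its return kills it again;
by independence of the active cycles at `i` both events belong to one interval `[i, i]`. Every other
sequence can be carried over.

If `σ` lies in a cycle, the deletion ends `[b_*, i-1]` and the return begins `[i+1, d_∘]`. The cycle
of `ζ_*` at `i-1` contains `σ`, and of the basis cycles at `i+1` only that of `ζ_∘` does, so
expanding the former in the basis gives the relation with `z^∘` present. A reduction step absorbs an
interval into `ζ_*` or `ζ_∘` without moving `b_*` or `d_∘`, because the absorbed end is smaller in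
the birth or death order. At the end `b_* ≺ b_1 ≺ ⋯ ≺ b_ℓ` and `d_∘` precedes every remaining death,
so `Θ_r` is born at `b_r` (at `b_*` if `r = 0`) and dies at the largest of `d_{r+1}, …, d_ℓ` (at
`d_∘` if `r = ℓ`). Its two halves meet at `K'` by the relation (`isRep_joined`).

The pairing uses only these ends and those of unchanged intervals. It is bijective because, once
`b_*` has taken the largest death, exactly one of the deaths still listed is taken, namely the
largest; the greedy phase preserves this (`greedy_spec`, `partner_spec`). -/

namespace Zigzag

/-! ### Chains modulo a submodule, over the field with two elements -/

section Mod2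

variable {M : Type*} [AddCommGroup M] [Module (ZMod 2) M]

theorem add_self_zero (x : M) : x + x = 0 := ZModModule.add_self x

theorem eq_add_of_add_eq {x y z : M} (h : x + y = z) : x = y + z := by
  rw [← h, add_comm x y, ← add_assoc, add_self_zero, zero_add]

/-- Over `ZMod 2`, `x + y ∈ B` expresses congruence modulo `B`; this is its transitivity. -/
theorem add_mem_trans {B : Submodule (ZMod 2) M} {x y z : M} (h : x + y ∈ B) (h' : y + z ∈ B) :
    x + z ∈ B := by
  have : x + z = (x + y) + (y + z) := by
    rw [show (x + y) + (y + z) = x + z + (y + y) by abel, add_self_zero, add_zero]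
  exact this ▸ B.add_mem h h'

theorem add_mem_comm {B : Submodule (ZMod 2) M} {x y : M} (h : x + y ∈ B) : y + x ∈ B := by
  rwa [add_comm]

theorem sum_add_sum_mem {ι : Type*} {B : Submodule (ZMod 2) M} {u v : ι → M} {a : Finset ι}
    (h : ∀ k ∈ a, u k + v k ∈ B) : (∑ k ∈ a, u k) + ∑ k ∈ a, v k ∈ B := by
  rw [← Finset.sum_add_distrib]
  exact B.sum_mem h

theorem sum_symmDiff {ι : Type*} [DecidableEq ι] (u : ι → M) (a b : Finset ι) :
    ∑ k ∈ symmDiff a b, u k = ∑ k ∈ a, u k + ∑ k ∈ b, u k := by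
  rw [symmDiff_def, Finset.sup_eq_union, Finset.sum_union disjoint_sdiff_sdiff,
    ← Finset.sum_sdiff (Finset.inter_subset_left : a ∩ b ⊆ a),
    ← Finset.sum_sdiff (Finset.inter_subset_right : a ∩ b ⊆ b)]
  have h1 : a \ (a ∩ b) = a \ b := by ext; simp
  have h2 : b \ (a ∩ b) = b \ a := by ext; simp
  rw [h1, h2, add_add_add_comm, add_self_zero, add_zero]

theorem ZMod2.eq_one {x : ZMod 2} (h : x ≠ 0) : x = 1 := by
  revert x; decide

theorem ZMod2.add_eq_zero {x y : ZMod 2} (hx : x ≠ 0) (hy : y ≠ 0) : x + y = 0 := by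
  revert x y; decide

end Mod2

/-! ### The boundary operator and elementary extensions of complexes -/

variable {V : Type*}

theorem mem_chains {K : PreAbstractSimplicialComplex V} {q : ℕ} {c : Chain V} :
    c ∈ chains K q ↔ ∀ s, c s ≠ 0 → s ∈ K ∧ s.card = q + 1 := by
  simp only [chains, Finsupp.mem_supported, Set.subset_def, Finset.mem_coe,
    Finsupp.mem_support_iff, Set.mem_ofPred_eq]

/-- `L` is obtained from `K` by adding the simplex `σ`. -/
structure Adds (K L : PreAbstractSimplicialComplex V) (σ : Finset V) : Prop where
  notMem : σ ∉ K
  faces : L.faces = insert σ K.faces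

namespace Adds

variable {K L : PreAbstractSimplicialComplex V} {σ : Finset V}

theorem mem_iff (h : Adds K L σ) {s : Finset V} : s ∈ L ↔ s = σ ∨ s ∈ K := by
  change s ∈ L.faces ↔ _
  rw [h.faces]
  rfl

theorem le (h : Adds K L σ) : K ≤ L := fun _ hs => h.mem_iff.2 (Or.inr hs)

theorem not_le (h : Adds K L σ) : ¬ L ≤ K := fun hle => h.notMem (hle (h.mem_iff.2 (Or.inl rfl)))

theorem nonempty (h : Adds K L σ) : σ.Nonempty :=
  (L.isRelLowerSet_faces (h.mem_iff.2 (Or.inl rfl))).1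

theorem unique {τ : Finset V} (h : Adds K L σ) (h' : Adds K L τ) : σ = τ := by
  have : σ ∈ L := h.mem_iff.2 (Or.inl rfl)
  exact (h'.mem_iff.1 this).resolve_right h.notMem

theorem coeff_zero (h : Adds K L σ) {q : ℕ} {c : Chain V} (hc : c ∈ chains K q) : c σ = 0 := by
  by_contra hne
  exact h.notMem (mem_chains.1 hc σ hne).1

theorem mem_chains_of_coeff (h : Adds K L σ) {q : ℕ} {c : Chain V} (hc : c ∈ chains L q)
    (h0 : c σ = 0) : c ∈ chains K q := by
  refine mem_chains.2 fun s hs => ?_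
  obtain ⟨h1, h2⟩ := mem_chains.1 hc s hs
  refine ⟨(h.mem_iff.1 h1).resolve_left ?_, h2⟩
  rintro rfl
  exact hs h0

/-- The two occurrences of `σ` cancel modulo 2. This exchange does the work of a dimension count
throughout. -/
theorem add_mem_chains (h : Adds K L σ) {q : ℕ} {c c' : Chain V} (hc : c ∈ chains L q)
    (hc' : c' ∈ chains L q) (h1 : c σ ≠ 0) (h2 : c' σ ≠ 0) : c + c' ∈ chains K q := by
  refine h.mem_chains_of_coeff (add_mem hc hc') ?_
  rw [Finsupp.add_apply, ZMod2.add_eq_zero h1 h2]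

end Adds

/-- A simplex determines its dimension, so chains sharing one have the same degree. -/
theorem coeff_dim_eq {K L : PreAbstractSimplicialComplex V} {q r : ℕ} {c c' : Chain V}
    {σ : Finset V} (hc : c ∈ chains K q) (hc' : c' ∈ chains L r) (h : c σ ≠ 0) (h' : c' σ ≠ 0) :
    q = r := by
  have h1 := (mem_chains.1 hc σ h).2
  have h2 := (mem_chains.1 hc' σ h').2
  omega

theorem coeff_sum_zero {ι : Type*} {v : ι → Chain V} {σ : Finset V} {a : Finset ι}
    (h : ∀ k ∈ a, v k σ = 0) : (∑ k ∈ a, v k) σ = 0 := by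
  rw [Finsupp.finsetSum_apply]
  exact Finset.sum_eq_zero h

theorem coeff_sum_eq {ι : Type*} [DecidableEq ι] {v : ι → Chain V} {σ : Finset V}
    {a : Finset ι} {k₀ : ι} (hk : k₀ ∈ a) (h : ∀ k ∈ a, k ≠ k₀ → v k σ = 0) : (∑ k ∈ a, v k) σ = v k₀ σ := by
  rw [Finsupp.finsetSum_apply]
  exact Finset.sum_eq_single_of_mem k₀ hk h

variable [DecidableEq V]

theorem boundary_single (s : Finset V) :
    boundary (Finsupp.single s (1 : ZMod 2)) =
      if s.card ≤ 1 then 0 else ∑ v ∈ s, Finsupp.single (s.erase v) (1 : ZMod 2) := by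
  simp [boundary]

theorem boundary_boundary (c : Chain V) : boundary (boundary c) = 0 := by
  suffices h : (boundary (V := V)) ∘ₗ boundary = 0 from LinearMap.congr_fun h c
  refine Finsupp.lhom_ext' fun s => LinearMap.ext_ring ?_
  simp only [LinearMap.comp_apply, Finsupp.lsingle_apply, LinearMap.zero_apply]
  rw [boundary_single]
  split_ifs with h1
  · simp
  rw [map_sum]
  -- Edges are separate: their facets are vertices, whose boundary is zero by definition rather than
  -- the empty simplex.
  by_cases h2 : s.card = 2
  · refine Finset.sum_eq_zero fun v hv => ?_
    rw [boundary_single, if_pos]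
    rw [Finset.card_erase_of_mem hv]
    omega
  have key : ∀ v ∈ s, boundary (Finsupp.single (s.erase v) (1 : ZMod 2)) =
      ∑ w ∈ s.erase v, Finsupp.single ((s.erase v).erase w) (1 : ZMod 2) := fun v hv => by
    rw [boundary_single, if_neg]
    rw [Finset.card_erase_of_mem hv]
    omega
  rw [Finset.sum_congr rfl key, Finset.sum_sigma']
  -- Removing `v` and `w` in either order leaves the same face, so the terms cancel in pairs.
  refine Finset.sum_involution (fun x _ => ⟨x.2, x.1⟩) ?_ ?_ ?_ ?_
  · rintro ⟨v, w⟩ _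
    rw [Finset.erase_right_comm]
    exact add_self_zero _
  · rintro ⟨v, w⟩ hx _ heq
    simp only [Finset.mem_sigma, Finset.mem_erase] at hx
    simp only [Sigma.mk.injEq, heq_eq_eq] at heq
    exact hx.2.1 heq.1
  · rintro ⟨v, w⟩ hx
    simp only [Finset.mem_sigma, Finset.mem_erase] at hx ⊢
    exact ⟨hx.2.2, fun h => hx.2.1 h.symm, hx.1⟩
  · rintro ⟨v, w⟩ _
    rfl

theorem boundary_mem_chains {K : PreAbstractSimplicialComplex V} {q : ℕ} {c : Chain V}
    (hc : c ∈ chains K (q + 1)) : boundary c ∈ chains K q := by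
  have hc' := hc
  rw [boundary, Finsupp.linearCombination_apply]
  refine Submodule.sum_mem _ fun s hs => Submodule.smul_mem _ _ ?_
  obtain ⟨hK, hcard⟩ := mem_chains.1 hc s (Finsupp.mem_support_iff.1 hs)
  rw [if_neg (by omega)]
  refine Submodule.sum_mem _ fun v hv => Finsupp.single_mem_supported _ _ ?_
  have he : (s.erase v).card = q + 1 := by rw [Finset.card_erase_of_mem hv]; omega
  refine ⟨K.isRelLowerSet_faces.mem_of_le hK (Finset.erase_subset v s) ?_, he⟩
  exact Finset.card_pos.1 (by omega)

/-- `σ` is maximal in `L`: a proper coface would lie in `K`, and then so would `σ`. Hence `σ` is a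
facet of no simplex of `L`. -/
theorem Adds.boundary_coeff {K L : PreAbstractSimplicialComplex V} {σ : Finset V} (h : Adds K L σ)
    {q : ℕ} {c : Chain V} (hc : c ∈ chains L q) : boundary c σ = 0 := by
  rw [boundary, Finsupp.linearCombination_apply, Finsupp.sum, Finsupp.finsetSum_apply]
  refine Finset.sum_eq_zero fun s hs => ?_
  obtain ⟨hL, -⟩ := mem_chains.1 hc s (Finsupp.mem_support_iff.1 hs)
  rw [Finsupp.smul_apply]
  split_ifs
  · simp
  rw [Finsupp.finsetSum_apply, Finset.sum_eq_zero, smul_zero]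
  intro v hv
  refine Finsupp.single_eq_of_ne ?_
  rintro rfl
  have hs : s ∈ K := (h.mem_iff.1 hL).resolve_left fun heq => by
    have := congrArg Finset.card heq
    have h1 := Finset.card_erase_of_mem hv
    have h2 := Finset.card_pos.2 ⟨v, hv⟩
    omega
  exact h.notMem (K.isRelLowerSet_faces.mem_of_le hs (Finset.erase_subset v s) h.nonempty)

theorem mem_boundaries {K : PreAbstractSimplicialComplex V} {q : ℕ} {z : Chain V} :
    z ∈ boundaries K q ↔ ∃ c ∈ chains K (q + 1), boundary c = z := Submodule.mem_map

theorem boundaries_mono {K L : PreAbstractSimplicialComplex V} (h : K ≤ L) (q : ℕ) :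
    boundaries K q ≤ boundaries L q :=
  Submodule.map_mono (chains_mono h (q + 1))

theorem boundaries_le_cycles (K : PreAbstractSimplicialComplex V) (q : ℕ) :
    boundaries K q ≤ cycles K q := by
  rintro _ ⟨c, hc, rfl⟩
  exact ⟨boundary_mem_chains hc, boundary_boundary c⟩

namespace Adds

variable {K L : PreAbstractSimplicialComplex V} {σ : Finset V}

theorem boundaries_coeff (h : Adds K L σ) {q : ℕ} {z : Chain V} (hz : z ∈ boundaries L q) :
    z σ = 0 := by
  obtain ⟨c, hc, rfl⟩ := mem_boundaries.1 hz
  exact h.boundary_coeff hc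

/-- Boundaries of `L` avoid `σ`, so the coefficient of `σ` depends only on the homology class in
`L`. -/
theorem coeff_eq_of_add_mem (h : Adds K L σ) {q : ℕ} {x y : Chain V}
    (hz : x + y ∈ boundaries L q) : x σ = y σ := by
  have := h.boundaries_coeff hz
  rw [Finsupp.add_apply] at this
  generalize x σ = a at *
  generalize y σ = b at *
  revert a b
  decide

theorem mem_cycles_of_coeff (h : Adds K L σ) {q : ℕ} {c : Chain V} (hc : c ∈ cycles L q)
    (h0 : c σ = 0) : c ∈ cycles K q :=
  ⟨h.mem_chains_of_coeff hc.1 h0, hc.2⟩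

theorem add_mem_cycles (h : Adds K L σ) {q : ℕ} {c c' : Chain V} (hc : c ∈ cycles L q)
    (hc' : c' ∈ cycles L q) (h1 : c σ ≠ 0) (h2 : c' σ ≠ 0) : c + c' ∈ cycles K q :=
  ⟨h.add_mem_chains hc.1 hc'.1 h1 h2, add_mem hc.2 hc'.2⟩

/-- If `σ` creates a cycle, no cycle of the smaller complex becomes a boundary. -/
theorem boundaries_of_creator (h : Adds K L σ) {q r : ℕ} {w : Chain V} (hw : w ∈ cycles L r)
    (hwσ : w σ ≠ 0) {z : Chain V} (hz : z ∈ boundaries L q) : z ∈ boundaries K q := by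
  obtain ⟨c, hc, rfl⟩ := mem_boundaries.1 hz
  by_cases h0 : c σ = 0
  · exact mem_boundaries.2 ⟨c, h.mem_chains_of_coeff hc h0, rfl⟩
  -- Adding the cycle `w` removes `σ` from `c` and leaves the boundary of `c` unchanged.
  · obtain rfl : q + 1 = r := coeff_dim_eq hc hw.1 h0 hwσ
    refine mem_boundaries.2 ⟨c + w, h.add_mem_chains hc hw.1 h0 hwσ, ?_⟩
    rw [map_add, LinearMap.mem_ker.1 hw.2, add_zero]

/-- A boundary of the larger complex is one of the smaller complex up to the boundary of
any chain that contains `σ`. -/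
theorem boundaries_of_destroyer (h : Adds K L σ) {q r : ℕ} {w : Chain V} (hw : w ∈ chains L (r + 1))
    (hwσ : w σ ≠ 0) {z : Chain V} (hz : z ∈ boundaries L q) :
    z ∈ boundaries K q ∨ (q = r ∧ z + boundary w ∈ boundaries K q) := by
  obtain ⟨c, hc, rfl⟩ := mem_boundaries.1 hz
  by_cases h0 : c σ = 0
  · exact Or.inl (mem_boundaries.2 ⟨c, h.mem_chains_of_coeff hc h0, rfl⟩)
  · have : q + 1 = r + 1 := coeff_dim_eq hc hw h0 hwσ
    obtain rfl : q = r := by omega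
    exact Or.inr ⟨rfl, mem_boundaries.2 ⟨c + w, h.add_mem_chains hc hw h0 hwσ, map_add _ _ _⟩⟩

end Adds

/-! ### Families of cycles whose classes form a basis -/

variable {V : Type*} [DecidableEq V] {ι : Type*}

/-- The classes of the cycles `v k`, `k ∈ act`, of dimension `dim k`, form a basis of the homology
of `K` in every dimension. -/
structure IsHBasis (K : PreAbstractSimplicialComplex V) (act : Set ι) (dim : ι → ℕ)
    (v : ι → Chain V) : Prop where
  mem : ∀ k ∈ act, v k ∈ cycles K (dim k)
  indep : ∀ (q : ℕ) (a : Finset ι), (∀ k ∈ a, k ∈ act ∧ dim k = q) →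
    ∑ k ∈ a, v k ∈ boundaries K q → a = ∅
  span : ∀ (q : ℕ), ∀ z ∈ cycles K q, ∃ a : Finset ι, (∀ k ∈ a, k ∈ act ∧ dim k = q) ∧
    z + ∑ k ∈ a, v k ∈ boundaries K q

namespace IsHBasis

variable {K L : PreAbstractSimplicialComplex V} {σ : Finset V} {actK actL : Set ι} {dim : ι → ℕ}
  {u v : ι → Chain V}

theorem sum_mem {act : Set ι} (h : IsHBasis K act dim v) {q : ℕ} {a : Finset ι}
    (ha : ∀ k ∈ a, k ∈ act ∧ dim k = q) : ∑ k ∈ a, v k ∈ cycles K q :=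
  Submodule.sum_mem _ fun k hk => (ha k hk).2 ▸ h.mem k (ha k hk).1

/-- Adding a simplex that creates a cycle, from the smaller complex to the larger one. -/
theorem creator_up (h : Adds K L σ) (hu : IsHBasis K actK dim u) {k₀ : ι} (hk₀ : k₀ ∉ actK)
    (hact : actL = insert k₀ actK) (hv : ∀ k ∈ actL, v k ∈ cycles L (dim k))
    (hσ : v k₀ σ ≠ 0) (huv : ∀ k ∈ actK, u k + v k ∈ boundaries L (dim k)) :
    IsHBasis L actL dim v := by
  classical
  subst hact
  have hw := hv k₀ (Set.mem_insert _ _)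
  have hvσ : ∀ k ∈ actK, v k σ = 0 := fun k hk => by
    rw [← h.coeff_eq_of_add_mem (huv k hk), h.coeff_zero (hu.mem k hk).1]
  have span' : ∀ (q : ℕ), ∀ z ∈ cycles K q, ∃ a : Finset ι, (∀ k ∈ a, k ∈ actK ∧ dim k = q) ∧
      z + ∑ k ∈ a, v k ∈ boundaries L q := fun q z hz => by
    obtain ⟨a, ha, hza⟩ := hu.span q z hz
    exact ⟨a, ha, add_mem_trans (boundaries_mono h.le q hza)
      (sum_add_sum_mem fun k hk => (ha k hk).2 ▸ huv k (ha k hk).1)⟩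
  refine ⟨hv, fun q a ha hsum => ?_, fun q z hz => ?_⟩
  -- Among the `v k` only `v k₀` contains `σ`, whereas a boundary of `L` does not.
  · have hk₀a : k₀ ∉ a := fun hmem => hσ <| by
      rw [← h.boundaries_coeff hsum]
      exact (coeff_sum_eq hmem fun k hk hne => hvσ k ((ha k hk).1.resolve_left hne)).symm
    have ha' : ∀ k ∈ a, k ∈ actK ∧ dim k = q := fun k hk =>
      ⟨(ha k hk).1.resolve_left fun e => hk₀a (e ▸ hk), (ha k hk).2⟩
    refine hu.indep q a ha' (h.boundaries_of_creator hw hσ ?_)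
    have := sum_add_sum_mem (B := boundaries L q) (a := a) fun k hk =>
      (ha' k hk).2 ▸ huv k (ha' k hk).1
    simpa [add_assoc, add_self_zero] using add_mem this hsum
  · by_cases hzσ : z σ = 0
    · obtain ⟨a, ha, hza⟩ := span' q z (h.mem_cycles_of_coeff hz hzσ)
      exact ⟨a, fun k hk => ⟨Or.inr (ha k hk).1, (ha k hk).2⟩, hza⟩
    · obtain rfl := coeff_dim_eq hz.1 hw.1 hzσ hσ
      obtain ⟨a, ha, hza⟩ := span' _ _ (h.add_mem_cycles hz hw hzσ hσ)
      refine ⟨insert k₀ a, fun k hk => ?_, ?_⟩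
      · rcases Finset.mem_insert.1 hk with rfl | hk
        · exact ⟨Or.inl rfl, rfl⟩
        · exact ⟨Or.inr (ha k hk).1, (ha k hk).2⟩
      · rw [Finset.sum_insert fun hk => hk₀ (ha k₀ hk).1, ← add_assoc]
        exact hza

/-- Deleting a simplex that creates a cycle, from the larger complex to the smaller one. -/
theorem creator_down (h : Adds K L σ) (hv : IsHBasis L actL dim v) {k₀ : ι}
    (hact : actL = insert k₀ actK) (hu : ∀ k ∈ actK, u k ∈ cycles K (dim k))
    (hσ : v k₀ σ ≠ 0) (huv : ∀ k ∈ actK, u k + v k ∈ boundaries L (dim k)) :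
    IsHBasis K actK dim u := by
  classical
  subst hact
  have hw := hv.mem k₀ (Set.mem_insert _ _)
  have hvσ : ∀ k ∈ actK, v k σ = 0 := fun k hk => by
    rw [← h.coeff_eq_of_add_mem (huv k hk), h.coeff_zero (hu k hk).1]
  refine ⟨hu, fun q a ha hsum => ?_, fun q z hz => ?_⟩
  · refine hv.indep q a (fun k hk => ⟨Or.inr (ha k hk).1, (ha k hk).2⟩) ?_
    have := sum_add_sum_mem (B := boundaries L q) (a := a) fun k hk =>
      (ha k hk).2 ▸ huv k (ha k hk).1
    simpa [← add_assoc, add_self_zero] using add_mem (boundaries_mono h.le q hsum) this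
  · obtain ⟨a, ha, hza⟩ := hv.span q z (cycles_mono h.le q hz)
    have hk₀a : k₀ ∉ a := fun hmem => hσ <| by
      have h1 := h.coeff_eq_of_add_mem hza
      rw [h.coeff_zero hz.1] at h1
      rw [h1]
      exact (coeff_sum_eq hmem fun k hk hne => hvσ k ((ha k hk).1.resolve_left hne)).symm
    have ha' : ∀ k ∈ a, k ∈ actK ∧ dim k = q := fun k hk =>
      ⟨(ha k hk).1.resolve_left fun e => hk₀a (e ▸ hk), (ha k hk).2⟩
    refine ⟨a, ha', h.boundaries_of_creator hw hσ (add_mem_trans hza ?_)⟩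
    exact sum_add_sum_mem fun k hk => (ha' k hk).2 ▸ add_mem_comm (huv k (ha' k hk).1)

/-- Adding a simplex that destroys a cycle, from the smaller complex to the larger one. -/
theorem destroyer_up (h : Adds K L σ) (hu : IsHBasis K actK dim u) {k₁ : ι} (hk₁ : k₁ ∉ actL)
    (hact : actK = insert k₁ actL) (hv : ∀ k ∈ actL, v k ∈ cycles L (dim k)) {c : Chain V}
    (hc : c ∈ chains L (dim k₁ + 1)) (hσ : c σ ≠ 0) (hbc : u k₁ = boundary c)
    (huv : ∀ k ∈ actL, u k + v k ∈ boundaries L (dim k)) : IsHBasis L actL dim v := by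
  classical
  subst hact
  have not_mem : u k₁ ∉ boundaries K (dim k₁) := fun hmem => by
    have := hu.indep (dim k₁) {k₁} (by simp) (by simpa using hmem)
    simp at this
  -- A cycle `z` of `L` through `σ` would make `c + z` a chain of `K` bounded by `u k₁`, against
  -- independence in `K`.
  have hzσ : ∀ q, ∀ z ∈ cycles L q, z σ = 0 := fun q z hz => by
    by_contra hne
    obtain rfl : q = dim k₁ + 1 := coeff_dim_eq hz.1 hc hne hσ
    refine not_mem (mem_boundaries.2 ⟨c + z, h.add_mem_chains hc hz.1 hσ hne, ?_⟩)
    rw [map_add, LinearMap.mem_ker.1 hz.2, add_zero, hbc]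
  refine ⟨hv, fun q a ha hsum => ?_, fun q z hz => ?_⟩
  · have := sum_add_sum_mem (B := boundaries L q) (a := a) fun k hk =>
      (ha k hk).2 ▸ huv k (ha k hk).1
    have hua : ∑ k ∈ a, u k ∈ boundaries L q := by
      simpa [add_assoc, add_self_zero] using add_mem this hsum
    rcases h.boundaries_of_destroyer hc hσ hua with hK | ⟨rfl, hK⟩
    · exact hu.indep q a (fun k hk => ⟨Or.inr (ha k hk).1, (ha k hk).2⟩) hK
    · have hk₁a : k₁ ∉ a := fun hmem => hk₁ (ha k₁ hmem).1
      rw [← hbc, add_comm, ← Finset.sum_insert hk₁a] at hK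
      have := hu.indep (dim k₁) (insert k₁ a) (fun k hk => ?_) hK
      · exact absurd this (Finset.insert_ne_empty _ _)
      · rcases Finset.mem_insert.1 hk with rfl | hk
        · exact ⟨Or.inl rfl, rfl⟩
        · exact ⟨Or.inr (ha k hk).1, (ha k hk).2⟩
  · obtain ⟨a, ha, hza⟩ := hu.span q z (h.mem_cycles_of_coeff hz (hzσ q z hz))
    have ha' : ∀ k ∈ a.erase k₁, k ∈ actL ∧ dim k = q := fun k hk =>
      ⟨(ha k (Finset.mem_of_mem_erase hk)).1.resolve_left (Finset.ne_of_mem_erase hk),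
        (ha k (Finset.mem_of_mem_erase hk)).2⟩
    -- `u k₁` bounds in `L`, so its term can be dropped.
    refine ⟨a.erase k₁, ha', add_mem_trans (y := ∑ k ∈ a.erase k₁, u k) ?_
      (sum_add_sum_mem fun k hk => (ha' k hk).2 ▸ huv k (ha' k hk).1)⟩
    have hza' := boundaries_mono h.le q hza
    by_cases hk₁a : k₁ ∈ a
    · rw [← Finset.sum_erase_add _ _ hk₁a, ← add_assoc] at hza'
      refine (Submodule.add_mem_iff_left _ ?_).1 hza'
      exact mem_boundaries.2 ⟨c, (ha k₁ hk₁a).2 ▸ hc, hbc.symm⟩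
    · rwa [Finset.erase_eq_of_notMem hk₁a]

/-- Deleting a simplex that destroys a cycle, from the larger complex to the smaller one. -/
theorem destroyer_down (h : Adds K L σ) (hv : IsHBasis L actL dim v) {k₁ : ι} (hk₁ : k₁ ∉ actL)
    (hact : actK = insert k₁ actL) (hu : ∀ k ∈ actK, u k ∈ cycles K (dim k)) {c : Chain V}
    (hc : c ∈ chains L (dim k₁ + 1)) (hσ : c σ ≠ 0) (hbc : u k₁ = boundary c)
    (huv : ∀ k ∈ actL, u k + v k ∈ boundaries L (dim k)) : IsHBasis K actK dim u := by
  classical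
  subst hact
  have huσ : ∀ k ∈ actL, v k σ = 0 := fun k hk => by
    rw [← h.coeff_eq_of_add_mem (huv k hk), h.coeff_zero (hu k (Or.inr hk)).1]
  -- Every cycle of `L` is homologous to a combination of the `v k`, none of which contains `σ`.
  have hzσ : ∀ q, ∀ z ∈ cycles L q, z σ = 0 := fun q z hz => by
    obtain ⟨a, ha, hza⟩ := hv.span q z hz
    rw [h.coeff_eq_of_add_mem hza]
    exact coeff_sum_zero fun k hk => huσ k (ha k hk).1
  have hbL : u k₁ ∈ boundaries L (dim k₁) := mem_boundaries.2 ⟨c, hc, hbc.symm⟩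
  refine ⟨hu, fun q a ha hsum => ?_, fun q z hz => ?_⟩
  · have ha' : ∀ k ∈ a.erase k₁, k ∈ actL ∧ dim k = q := fun k hk =>
      ⟨(ha k (Finset.mem_of_mem_erase hk)).1.resolve_left (Finset.ne_of_mem_erase hk),
        (ha k (Finset.mem_of_mem_erase hk)).2⟩
    have hua : ∑ k ∈ a.erase k₁, u k ∈ boundaries L q := by
      have hsum' := boundaries_mono h.le q hsum
      by_cases hk₁a : k₁ ∈ a
      · rw [← Finset.sum_erase_add _ _ hk₁a] at hsum'
        exact (Submodule.add_mem_iff_left _ ((ha k₁ hk₁a).2 ▸ hbL)).1 hsum'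
      · rwa [Finset.erase_eq_of_notMem hk₁a]
    have h1 := sum_add_sum_mem (B := boundaries L q) (a := a.erase k₁) fun k hk =>
      (ha' k hk).2 ▸ huv k (ha' k hk).1
    have h2 := hv.indep q (a.erase k₁) ha' (by
      simpa [← add_assoc, add_self_zero] using add_mem hua h1)
    rcases (Finset.erase_eq_empty_iff a k₁).1 h2 with h3 | rfl
    · exact h3
    -- What remains is `a = {k₁}`. If `u k₁` were the boundary of `c'` in `K`, then `c + c'` would
    -- be a cycle of `L` through `σ`.
    exfalso
    obtain rfl := (ha k₁ (by simp)).2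
    rw [Finset.sum_singleton, hbc] at hsum
    obtain ⟨c', hc', hcc⟩ := mem_boundaries.1 hsum
    have hcyc : c + c' ∈ cycles L (dim k₁ + 1) :=
      ⟨add_mem hc (chains_mono h.le _ hc'), LinearMap.mem_ker.2 (by
        rw [map_add, hcc, add_self_zero])⟩
    have := hzσ _ _ hcyc
    rw [Finsupp.add_apply, h.coeff_zero hc', add_zero] at this
    exact hσ this
  · obtain ⟨a, ha, hza⟩ := hv.span q z (cycles_mono h.le q hz)
    have hk₁a : k₁ ∉ a := fun hmem => hk₁ (ha k₁ hmem).1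
    have hzu : z + ∑ k ∈ a, u k ∈ boundaries L q := add_mem_trans hza
      (sum_add_sum_mem fun k hk => (ha k hk).2 ▸ add_mem_comm (huv k (ha k hk).1))
    rcases h.boundaries_of_destroyer hc hσ hzu with hK | ⟨rfl, hK⟩
    · exact ⟨a, fun k hk => ⟨Or.inr (ha k hk).1, (ha k hk).2⟩, hK⟩
    · refine ⟨insert k₁ a, fun k hk => ?_, ?_⟩
      · rcases Finset.mem_insert.1 hk with rfl | hk
        · exact ⟨Or.inl rfl, rfl⟩
        · exact ⟨Or.inr (ha k hk).1, (ha k hk).2⟩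
      · rw [Finset.sum_insert hk₁a, hbc, add_comm (boundary c), ← add_assoc]
        exact hK

end IsHBasis

/-! ### The arrows of a filtration -/

section Arrows

variable {V : Type*} {F : Filtration V} {j : ℕ}

theorem Filtration.adds_or (F : Filtration V) (hj : j < F.m) :
    Adds (F.K j) (F.K (j + 1)) (F.cell j) ∨ Adds (F.K (j + 1)) (F.K j) (F.cell j) :=
  (F.step j hj).imp (fun h => ⟨h.1, h.2⟩) fun h => ⟨h.1, h.2⟩

theorem Filtration.Fwd.adds (h : F.Fwd j) (hj : j < F.m) :
    Adds (F.K j) (F.K (j + 1)) (F.cell j) :=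
  (F.adds_or hj).resolve_right fun h' => h'.not_le h

theorem Filtration.Bwd.adds (h : F.Bwd j) (hj : j < F.m) :
    Adds (F.K (j + 1)) (F.K j) (F.cell j) :=
  (F.adds_or hj).resolve_left fun h' => h'.not_le h

theorem Filtration.fwd_or_bwd (F : Filtration V) (hj : j < F.m) : F.Fwd j ∨ F.Bwd j :=
  (F.adds_or hj).imp Adds.le Adds.le

theorem Filtration.Fwd.not_bwd (h : F.Fwd j) (hj : j < F.m) : ¬ F.Bwd j := (h.adds hj).not_le

theorem Filtration.Bwd.not_fwd (h : F.Bwd j) (hj : j < F.m) : ¬ F.Fwd j := (h.adds hj).not_le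

theorem Filtration.bwd_of_not_fwd (hj : j < F.m) (h : ¬ F.Fwd j) : F.Bwd j :=
  (F.fwd_or_bwd hj).resolve_left h

theorem notMem_bot (s : Finset V) : s ∉ (⊥ : PreAbstractSimplicialComplex V) := fun h => h.elim

theorem chains_bot {q : ℕ} {c : Chain V} (hc : c ∈ chains ⊥ q) : c = 0 := by
  ext s
  by_contra h
  exact notMem_bot s (mem_chains.1 hc s h).1

end Arrows

/-! ### Linked cycles, and representatives with only one of the two end conditions. -/

variable {V : Type*} [DecidableEq V]

/-- The chain `c` lies in the larger of `K_j` and `K_{j+1}`, and its boundary is `x + y`. -/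
structure Filtration.Linked (F : Filtration V) (q j : ℕ) (x y c : Chain V) : Prop where
  mem : c ∈ chains (F.K j) (q + 1) ⊔ chains (F.K (j + 1)) (q + 1)
  eq : x + y = boundary c

namespace Filtration

variable {F : Filtration V} {q j : ℕ} {x y c x' y' c' : Chain V}

theorem Linked.add (h : F.Linked q j x y c) (h' : F.Linked q j x' y' c') :
    F.Linked q j (x + x') (y + y') (c + c') :=
  ⟨add_mem h.mem h'.mem, by rw [map_add, ← h.eq, ← h'.eq]; abel⟩

theorem linked_zero : F.Linked q j 0 0 0 := ⟨zero_mem _, by simp⟩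

theorem Linked.mem_fwd (h : F.Linked q j x y c) (hf : F.Fwd j) :
    c ∈ chains (F.K (j + 1)) (q + 1) := by
  have := h.mem
  rwa [sup_eq_right.2 (chains_mono hf _)] at this

theorem Linked.mem_bwd (h : F.Linked q j x y c) (hf : F.Bwd j) :
    c ∈ chains (F.K j) (q + 1) := by
  have := h.mem
  rwa [sup_eq_left.2 (chains_mono hf _)] at this

theorem Linked.fwd (h : F.Linked q j x y c) (hf : F.Fwd j) :
    x + y ∈ boundaries (F.K (j + 1)) q :=
  mem_boundaries.2 ⟨c, h.mem_fwd hf, h.eq.symm⟩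

theorem Linked.bwd (h : F.Linked q j x y c) (hf : F.Bwd j) :
    x + y ∈ boundaries (F.K j) q :=
  mem_boundaries.2 ⟨c, h.mem_bwd hf, h.eq.symm⟩

/-- `ζ` is a `q`-th post-birth representative for `[ζ.b, ζ.d]`. -/
structure PostBirth (F : Filtration V) (q : ℕ) (ζ : RepSeq V) : Prop where
  one_le : 1 ≤ ζ.b
  le : ζ.b ≤ ζ.d
  lt : ζ.d < F.m
  cycle : ∀ j, ζ.b ≤ j → j ≤ ζ.d → ζ.z j ∈ cycles (F.K j) q
  link : ∀ j, ζ.b ≤ j → j < ζ.d → F.Linked q j (ζ.z j) (ζ.z (j + 1)) (ζ.c j)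
  birth_bwd : F.Bwd (ζ.b - 1) →
    ζ.c (ζ.b - 1) ∈ chains (F.K (ζ.b - 1)) (q + 1) ∧
    ζ.z ζ.b = boundary (ζ.c (ζ.b - 1)) ∧ ζ.c (ζ.b - 1) (F.cell (ζ.b - 1)) ≠ 0
  birth_fwd : F.Fwd (ζ.b - 1) → ζ.z ζ.b (F.cell (ζ.b - 1)) ≠ 0

/-- `ζ` is a `q`-th pre-death representative for `[ζ.b, ζ.d]`. -/
structure PreDeath (F : Filtration V) (q : ℕ) (ζ : RepSeq V) : Prop where
  one_le : 1 ≤ ζ.b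
  le : ζ.b ≤ ζ.d
  lt : ζ.d < F.m
  cycle : ∀ j, ζ.b ≤ j → j ≤ ζ.d → ζ.z j ∈ cycles (F.K j) q
  link : ∀ j, ζ.b ≤ j → j < ζ.d → F.Linked q j (ζ.z j) (ζ.z (j + 1)) (ζ.c j)
  death_fwd : F.Fwd ζ.d →
    ζ.c ζ.d ∈ chains (F.K (ζ.d + 1)) (q + 1) ∧
    ζ.z ζ.d = boundary (ζ.c ζ.d) ∧ ζ.c ζ.d (F.cell ζ.d) ≠ 0
  death_bwd : F.Bwd ζ.d → ζ.z ζ.d (F.cell ζ.d) ≠ 0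

variable {ζ : RepSeq V}

theorem IsRep.link (h : F.IsRep q ζ) (hb : ζ.b ≤ j) (hd : j < ζ.d) :
    F.Linked q j (ζ.z j) (ζ.z (j + 1)) (ζ.c j) := by
  rcases F.fwd_or_bwd (hd.trans h.lt) with hf | hf
  · obtain ⟨h1, h2⟩ := h.fwd j hb hd hf
    exact ⟨Submodule.mem_sup_right h1, h2⟩
  · obtain ⟨h1, h2⟩ := h.bwd j hb hd hf
    exact ⟨Submodule.mem_sup_left h1, h2⟩

theorem IsRep.postBirth (h : F.IsRep q ζ) : F.PostBirth q ζ :=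
  ⟨h.one_le, h.le, h.lt, h.cycle, fun _ => h.link, h.birth_bwd, h.birth_fwd⟩

theorem IsRep.preDeath (h : F.IsRep q ζ) : F.PreDeath q ζ :=
  ⟨h.one_le, h.le, h.lt, h.cycle, fun _ => h.link, h.death_fwd, h.death_bwd⟩

theorem isRep_of_halves (h : F.PostBirth q ζ) (h' : F.PreDeath q ζ) : F.IsRep q ζ where
  one_le := h.one_le
  le := h.le
  lt := h.lt
  cycle := h.cycle
  fwd j hb hd hf := ⟨(h.link j hb hd).mem_fwd hf, (h.link j hb hd).eq⟩
  bwd j hb hd hf := ⟨(h.link j hb hd).mem_bwd hf, (h.link j hb hd).eq⟩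
  birth_bwd := h.birth_bwd
  birth_fwd := h.birth_fwd
  death_fwd := h'.death_fwd
  death_bwd := h'.death_bwd

/-! ### Births and deaths on the arrows, and the bases they give -/

variable {ι : Type*}

/-- On every arrow exactly one interval of the family begins or ends. -/
def Events (F : Filtration V) (ζ : ι → RepSeq V) : Prop :=
  ∀ j < F.m,
    ((∃ k₀, (ζ k₀).b = j + 1 ∧ ∀ k, (ζ k).b = j + 1 → k = k₀) ∧ ∀ k, (ζ k).d ≠ j) ∨
    ((∃ k₁, (ζ k₁).d = j ∧ ∀ k, (ζ k).d = j → k = k₁) ∧ ∀ k, (ζ k).b ≠ j + 1)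

theorem isHBasis_bot {act : Set ι} (hact : act = ∅) (dim : ι → ℕ) (v : ι → Chain V) :
    IsHBasis ⊥ act dim v := by
  subst hact
  refine ⟨fun k hk => hk.elim, fun q a ha _ => ?_, fun q z hz => ⟨∅, by simp, ?_⟩⟩
  · exact Finset.eq_empty_of_forall_notMem fun k hk => (ha k hk).1
  · rw [chains_bot hz.1]
    simp

/-- Representatives whose births and deaths use up the arrows give a basis at every index. -/
theorem isHBasis_of_events {dim : ι → ℕ} {ζ : ι → RepSeq V}
    (hrep : ∀ k, F.IsRep (dim k) (ζ k)) (hev : F.Events ζ) (j : ℕ) :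
    IsHBasis (F.K j) {k | (ζ k).b ≤ j ∧ j ≤ (ζ k).d} dim fun k => (ζ k).z j := by
  rcases le_or_gt F.m j with hm | hm
  · rw [F.K_end j hm]
    refine isHBasis_bot ?_ _ _
    ext k
    have := (hrep k).lt
    simp
    omega
  induction j with
  | zero =>
    rw [F.K_zero]
    refine isHBasis_bot ?_ _ _
    ext k
    have := (hrep k).one_le
    simp
    omega
  | succ j ih =>
    have hj : j < F.m := by omega
    specialize ih hj
    have hcyc : ∀ k, k ∈ {k | (ζ k).b ≤ j + 1 ∧ j + 1 ≤ (ζ k).d} →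
        (ζ k).z (j + 1) ∈ cycles (F.K (j + 1)) (dim k) := fun k hk =>
      (hrep k).cycle _ hk.1 hk.2
    have hlink : ∀ k, (ζ k).b ≤ j → j + 1 ≤ (ζ k).d →
        F.Linked (dim k) j ((ζ k).z j) ((ζ k).z (j + 1)) ((ζ k).c j) := fun k h1 h2 =>
      (hrep k).link h1 h2
    rcases hev j hj with ⟨⟨k₀, hk₀, huniq⟩, hd⟩ | ⟨⟨k₁, hk₁, huniq⟩, hb⟩
    · have hle := (hrep k₀).le
      have hmem : k₀ ∉ {k | (ζ k).b ≤ j ∧ j ≤ (ζ k).d} := fun h => by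
        have := h.1
        omega
      have hact : {k | (ζ k).b ≤ j + 1 ∧ j + 1 ≤ (ζ k).d} =
          insert k₀ {k | (ζ k).b ≤ j ∧ j ≤ (ζ k).d} := by
        ext k
        have h1 := hd k
        have h2 := huniq k
        have h3 := (hrep k).le
        simp only [Set.mem_ofPred_eq, Set.mem_insert_iff]
        constructor
        · intro h
          by_cases hk : (ζ k).b = j + 1
          · exact Or.inl (h2 hk)
          · right; omega
        · rintro (rfl | h) <;> omega
      have hcont : ∀ k, k ∈ {k | (ζ k).b ≤ j ∧ j ≤ (ζ k).d} →
          F.Linked (dim k) j ((ζ k).z j) ((ζ k).z (j + 1)) ((ζ k).c j) := fun k hk =>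
        hlink k hk.1 (lt_of_le_of_ne hk.2 (hd k).symm)
      -- A birth on a forward arrow means that the added simplex creates a cycle; on a backward
      -- arrow, that deleting it undoes the destruction of one.
      rcases F.fwd_or_bwd hj with hf | hf
      · refine IsHBasis.creator_up (hf.adds hj) ih hmem hact hcyc ?_ fun k hk =>
          (hcont k hk).fwd hf
        have := (hrep k₀).birth_fwd
        rw [hk₀] at this
        exact this hf
      · obtain ⟨h1, h2, h3⟩ := (hrep k₀).birth_bwd (by rw [hk₀]; exact hf)
        simp only [hk₀, Nat.add_sub_cancel] at h1 h2 h3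
        exact IsHBasis.destroyer_down (hf.adds hj) ih hmem hact hcyc h1 h3 h2 fun k hk =>
          add_mem_comm ((hcont k hk).bwd hf)
    · have hle := (hrep k₁).le
      have hmem : k₁ ∉ {k | (ζ k).b ≤ j + 1 ∧ j + 1 ≤ (ζ k).d} := fun h => by
        have := h.2
        omega
      have hact : {k | (ζ k).b ≤ j ∧ j ≤ (ζ k).d} =
          insert k₁ {k | (ζ k).b ≤ j + 1 ∧ j + 1 ≤ (ζ k).d} := by
        ext k
        have h1 := hb k
        have h2 := huniq k
        have h3 := (hrep k).le
        simp only [Set.mem_ofPred_eq, Set.mem_insert_iff]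
        constructor
        · intro h
          by_cases hk : (ζ k).d = j
          · exact Or.inl (h2 hk)
          · right; omega
        · rintro (rfl | h) <;> omega
      have hcont : ∀ k, k ∈ {k | (ζ k).b ≤ j + 1 ∧ j + 1 ≤ (ζ k).d} →
          F.Linked (dim k) j ((ζ k).z j) ((ζ k).z (j + 1)) ((ζ k).c j) := fun k hk =>
        hlink k (Nat.le_of_lt_succ (lt_of_le_of_ne hk.1 (hb k))) hk.2
      -- Dually, a death on a forward arrow is the destruction of a cycle; on a backward arrow the
      -- deleted simplex takes its cycle away.
      rcases F.fwd_or_bwd hj with hf | hf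
      · obtain ⟨h1, h2, h3⟩ := (hrep k₁).death_fwd (by rw [hk₁]; exact hf)
        rw [hk₁] at h1 h2 h3
        exact IsHBasis.destroyer_up (hf.adds hj) ih hmem hact hcyc h1 h3 h2 fun k hk =>
          (hcont k hk).fwd hf
      · refine IsHBasis.creator_down (hf.adds hj) ih hact hcyc ?_ fun k hk =>
          add_mem_comm ((hcont k hk).bwd hf)
        have := (hrep k₁).death_bwd
        rw [hk₁] at this
        exact this hf

end Filtration

/-! ### From bases to barcodes -/

section ToBarcode

variable {V : Type*} [DecidableEq V]

theorem Homology.mk_eq_iff {K : PreAbstractSimplicialComplex V} {q : ℕ} {x y : cycles K q} :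
    ((boundaries K q).submoduleOf (cycles K q)).mkQ x =
      ((boundaries K q).submoduleOf (cycles K q)).mkQ y ↔
      (x : Chain V) + y ∈ boundaries K q := by
  rw [Submodule.mkQ_apply, Submodule.mkQ_apply, Submodule.Quotient.eq, ZModModule.sub_eq_add]
  exact Iff.rfl

theorem Homology.mk_eq_zero_iff {K : PreAbstractSimplicialComplex V} {q : ℕ} {x : cycles K q} :
    ((boundaries K q).submoduleOf (cycles K q)).mkQ x = 0 ↔ (x : Chain V) ∈ boundaries K q := by
  rw [Submodule.mkQ_apply, Submodule.Quotient.mk_eq_zero]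
  exact Iff.rfl

theorem homologyMap_mk {K L : PreAbstractSimplicialComplex V} (h : K ≤ L) {q : ℕ}
    (x : cycles K q) :
    homologyMap h q (((boundaries K q).submoduleOf (cycles K q)).mkQ x) =
      ((boundaries L q).submoduleOf (cycles L q)).mkQ ⟨x, cycles_mono h q x.2⟩ := rfl

variable {ι : Type*} {K : PreAbstractSimplicialComplex V}

/-- The linear combinations of the classes of a family of cycles. -/
noncomputable def classSum (K : PreAbstractSimplicialComplex V) (q : ℕ) {κ : Type*} (v : κ → cycles K q) :
    (κ →₀ ZMod 2) →ₗ[ZMod 2] Homology K q :=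
  Finsupp.linearCombination (ZMod 2) fun k =>
    ((boundaries K q).submoduleOf (cycles K q)).mkQ (v k)

theorem classSum_single {q : ℕ} {κ : Type*} (v : κ → cycles K q) (k : κ) :
    classSum K q v (Finsupp.single k 1) =
      ((boundaries K q).submoduleOf (cycles K q)).mkQ (v k) := by
  simp [classSum]

theorem classSum_eq {q : ℕ} {κ : Type*} (v : κ → cycles K q) (y : κ →₀ ZMod 2) :
    classSum K q v y =
      ((boundaries K q).submoduleOf (cycles K q)).mkQ (∑ k ∈ y.support, v k) := by
  rw [classSum, Finsupp.linearCombination_apply, Finsupp.sum, map_sum]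
  refine Finset.sum_congr rfl fun k hk => ?_
  rw [ZMod2.eq_one (Finsupp.mem_support_iff.1 hk), one_smul]

/-- The embedding `e` enumerates the active indices of dimension `q`. In use `κ` is the nested
subtype that indexes `IntervalSum`. -/
theorem IsHBasis.bijective {act : Set ι} {dim : ι → ℕ} {v : ι → Chain V}
    (h : IsHBasis K act dim v) (q : ℕ) {κ : Type*} (e : κ ↪ ι)
    (he : ∀ k, (∃ x, e x = k) ↔ k ∈ act ∧ dim k = q) (w : κ → cycles K q)
    (hw : ∀ x, (w x : Chain V) = v (e x)) : Function.Bijective (classSum K q w) := by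
  have hsum : ∀ s : Finset κ, ((∑ x ∈ s, w x : cycles K q) : Chain V) = ∑ k ∈ s.map e, v k :=
    fun s => by
      rw [Finset.sum_map, AddSubmonoidClass.coe_finsetSum]
      exact Finset.sum_congr rfl fun x _ => hw x
  constructor
  · rw [← LinearMap.ker_eq_bot, LinearMap.ker_eq_bot']
    intro y hy
    rw [classSum_eq, Homology.mk_eq_zero_iff, hsum] at hy
    have := h.indep q _ (fun k hk => ?_) hy
    · rwa [Finset.map_eq_empty, Finsupp.support_eq_empty] at this
    · obtain ⟨x, -, rfl⟩ := Finset.mem_map.1 hk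
      exact (he _).1 ⟨x, rfl⟩
  · intro x
    obtain ⟨⟨z, hz⟩, rfl⟩ := Submodule.mkQ_surjective _ x
    obtain ⟨a, ha, hza⟩ := h.span q z hz
    have hs : ∃ s : Finset κ, s.map e = a := by
      classical
      refine ⟨a.preimage e e.injective.injOn, ?_⟩
      ext k
      simp only [Finset.mem_map, Finset.mem_preimage]
      constructor
      · rintro ⟨x, hx, rfl⟩
        exact hx
      · intro hk
        obtain ⟨x, rfl⟩ := (he k).2 (ha k hk)
        exact ⟨x, hk, rfl⟩
    obtain ⟨s, rfl⟩ := hs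
    refine ⟨∑ x ∈ s, Finsupp.single x 1, ?_⟩
    simp only [map_sum, classSum_single]
    rw [← map_sum, Homology.mk_eq_iff, hsum, add_comm]
    exact hza

variable {F : Filtration V} {dim : ι → ℕ} {ζ : ι → RepSeq V}

/-- The square is checked on single intervals: one that continues must have homologous cycles on the
two sides, and one that stops must have a cycle that bounds in the target. -/
theorem homologyMap_classSum {q j j' : ℕ} (I : ι → ℕ × ℕ) {L : PreAbstractSimplicialComplex V}
    (h : K ≤ L) (w : {k : ι // (I k).1 ≤ j ∧ j ≤ (I k).2} → cycles K q)
    (w' : {k : ι // (I k).1 ≤ j' ∧ j' ≤ (I k).2} → cycles L q)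
    (hcont : ∀ k h₁ h₂, (w ⟨k, h₁⟩ : Chain V) + w' ⟨k, h₂⟩ ∈ boundaries L q)
    (hend : ∀ k h₁, ¬ ((I k).1 ≤ j' ∧ j' ≤ (I k).2) →
      (w ⟨k, h₁⟩ : Chain V) ∈ boundaries L q) (y : IntervalSum I j) :
    homologyMap h q (classSum K q w y) = classSum L q w' (intervalSumMap I j j' y) := by
  suffices hlin : homologyMap h q ∘ₗ classSum K q w = classSum L q w' ∘ₗ intervalSumMap I j j' from
    LinearMap.congr_fun hlin y
  refine Finsupp.lhom_ext' fun k => LinearMap.ext_ring ?_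
  simp only [LinearMap.comp_apply, Finsupp.lsingle_apply]
  rw [classSum_single, homologyMap_mk]
  simp only [intervalSumMap, Finsupp.linearCombination_single, one_smul]
  split_ifs with hk
  · rw [classSum_single, Homology.mk_eq_iff]
    exact hcont k.1 k.2 hk
  · rw [map_zero, Homology.mk_eq_zero_iff]
    exact hend k.1 k.2 hk

/-- The isomorphism at `j` is the inverse of the map sending each active interval to the class of
its cycle at `j`. -/
theorem Filtration.isBarcodeWithReps_of_events (hrep : ∀ k, F.IsRep (dim k) (ζ k))
    (hev : F.Events ζ) : F.IsBarcodeWithReps dim ζ := by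
  refine ⟨hrep, fun q => ⟨fun k => ⟨(hrep k.1).le, (hrep k.1).lt.le⟩, ?_⟩⟩
  set I : {k : ι // dim k = q} → ℕ × ℕ := fun k => ((ζ k.1).b, (ζ k.1).d) with hI
  let w : ∀ j, {k : {k : ι // dim k = q} // (I k).1 ≤ j ∧ j ≤ (I k).2} → cycles (F.K j) q :=
    fun j k => ⟨(ζ k.1.1).z j, by
      have := (hrep k.1.1).cycle j k.2.1 k.2.2
      rwa [k.1.2] at this⟩
  have hbij : ∀ j, Function.Bijective (classSum (F.K j) q (w j)) := fun j =>
    (isHBasis_of_events hrep hev j).bijective q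
      ⟨fun k => k.1.1, fun x y hxy => Subtype.ext (Subtype.ext hxy)⟩
      (fun k => ⟨by rintro ⟨x, rfl⟩; exact ⟨x.2, x.1.2⟩, fun hk => ⟨⟨⟨k, hk.2⟩, hk.1⟩, rfl⟩⟩)
      (w j) fun x => rfl
  refine ⟨fun j => (LinearEquiv.ofBijective _ (hbij j)).symm, fun j hj => ⟨fun h x => ?_,
    fun h x => ?_⟩⟩
  · obtain ⟨y, rfl⟩ := (hbij j).2 x
    rw [LinearEquiv.symm_apply_eq, LinearEquiv.ofBijective_symm_apply_apply,
      LinearEquiv.ofBijective_apply]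
    refine homologyMap_classSum I h _ _ ?_ ?_ y
    · rintro ⟨k, rfl⟩ h₁ h₂
      exact ((hrep k).link h₁.1 h₂.2).fwd h
    · rintro ⟨k, rfl⟩ h₁ h₂
      have hd : (ζ k).d = j := by
        simp only [hI] at h₁ h₂
        omega
      obtain ⟨h3, h4, -⟩ := (hrep k).death_fwd (by rw [hd]; exact h)
      rw [hd] at h3 h4
      exact mem_boundaries.2 ⟨_, h3, h4.symm⟩
  · obtain ⟨y, rfl⟩ := (hbij (j + 1)).2 x
    rw [LinearEquiv.symm_apply_eq, LinearEquiv.ofBijective_symm_apply_apply,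
      LinearEquiv.ofBijective_apply]
    refine homologyMap_classSum I h _ _ ?_ ?_ y
    · rintro ⟨k, rfl⟩ h₁ h₂
      exact add_mem_comm (((hrep k).link h₂.1 h₁.2).bwd h)
    · rintro ⟨k, rfl⟩ h₁ h₂
      have hb : (ζ k).b = j + 1 := by
        simp only [hI] at h₁ h₂
        omega
      obtain ⟨h3, h4, -⟩ := (hrep k).birth_bwd (by rw [hb]; exact h)
      simp only [hb, Nat.add_sub_cancel] at h3 h4
      exact mem_boundaries.2 ⟨_, h3, h4.symm⟩

end ToBarcode

/-! ### From barcodes to births and deaths on the arrows -/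

section IntervalSums

variable {ι : Type*} {I : ι → ℕ × ℕ} {j j' : ℕ}

theorem intervalSumMap_single_of_mem (k : ι) (h : (I k).1 ≤ j ∧ j ≤ (I k).2)
    (h' : (I k).1 ≤ j' ∧ j' ≤ (I k).2) :
    intervalSumMap I j j' (Finsupp.single ⟨k, h⟩ 1) = Finsupp.single ⟨k, h'⟩ 1 := by
  simp [intervalSumMap, h']

theorem intervalSumMap_single_of_notMem (k : ι) (h : (I k).1 ≤ j ∧ j ≤ (I k).2)
    (h' : ¬ ((I k).1 ≤ j' ∧ j' ≤ (I k).2)) :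
    intervalSumMap I j j' (Finsupp.single ⟨k, h⟩ 1) = 0 := by
  simp [intervalSumMap, h']

theorem intervalSumMap_apply_of_mem (y : IntervalSum I j) (k : ι)
    (h : (I k).1 ≤ j ∧ j ≤ (I k).2) (h' : (I k).1 ≤ j' ∧ j' ≤ (I k).2) :
    intervalSumMap I j j' y ⟨k, h'⟩ = y ⟨k, h⟩ := by
  induction y using Finsupp.induction_linear with
  | zero => simp
  | add f g hf hg => simp [hf, hg]
  | single l a =>
    obtain ⟨l, hl⟩ := l
    obtain rfl | ha := eq_or_ne a 0
    · simp
    obtain rfl := ZMod2.eq_one ha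
    by_cases hl' : (I l).1 ≤ j' ∧ j' ≤ (I l).2
    · rw [intervalSumMap_single_of_mem l hl hl']
      by_cases hkl : l = k
      · subst hkl
        simp
      · rw [Finsupp.single_eq_of_ne, Finsupp.single_eq_of_ne] <;>
          simpa using fun e => hkl e.symm
    · rw [intervalSumMap_single_of_notMem l hl hl', Finsupp.single_eq_of_ne]
      · rfl
      · intro e
        rw [Subtype.mk.injEq] at e
        exact hl' (e ▸ h')

theorem intervalSumMap_apply_of_notMem (y : IntervalSum I j) (k : ι)
    (h : ¬ ((I k).1 ≤ j ∧ j ≤ (I k).2)) (h' : (I k).1 ≤ j' ∧ j' ≤ (I k).2) :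
    intervalSumMap I j j' y ⟨k, h'⟩ = 0 := by
  induction y using Finsupp.induction_linear with
  | zero => simp
  | add f g hf hg => simp [hf, hg]
  | single l a =>
    obtain ⟨l, hl⟩ := l
    obtain rfl | ha := eq_or_ne a 0
    · simp
    obtain rfl := ZMod2.eq_one ha
    by_cases hl' : (I l).1 ≤ j' ∧ j' ≤ (I l).2
    · rw [intervalSumMap_single_of_mem l hl hl', Finsupp.single_eq_of_ne]
      intro e
      rw [Subtype.mk.injEq] at e
      exact h (e ▸ hl)
    · rw [intervalSumMap_single_of_notMem l hl hl']
      rfl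

variable {A B : Type*} [AddCommGroup A] [Module (ZMod 2) A] [AddCommGroup B] [Module (ZMod 2) B]
  {f : A →ₗ[ZMod 2] B} {eA : A ≃ₗ[ZMod 2] IntervalSum I j} {eB : B ≃ₗ[ZMod 2] IntervalSum I j'}

/-- The generator of an interval that stopped would be a non-zero element of the kernel. -/
theorem mem_target_of_injective (hf : ∀ x, eB (f x) = intervalSumMap I j j' (eA x))
    (hinj : Function.Injective f) (k : ι) (h : (I k).1 ≤ j ∧ j ≤ (I k).2) :
    (I k).1 ≤ j' ∧ j' ≤ (I k).2 := by
  by_contra h'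
  have h1 := hf (eA.symm (Finsupp.single ⟨k, h⟩ 1))
  rw [LinearEquiv.apply_symm_apply, intervalSumMap_single_of_notMem k h h',
    LinearEquiv.map_eq_zero_iff, map_eq_zero_iff f hinj, LinearEquiv.map_eq_zero_iff] at h1
  simp at h1

/-- The image has coefficient zero on an interval absent from the source, so it misses the generator
of that interval. -/
theorem mem_source_of_surjective (hf : ∀ x, eB (f x) = intervalSumMap I j j' (eA x))
    (hsurj : Function.Surjective f) (k : ι) (h : (I k).1 ≤ j' ∧ j' ≤ (I k).2) :
    (I k).1 ≤ j ∧ j ≤ (I k).2 := by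
  by_contra h'
  obtain ⟨x, hx⟩ := hsurj (eB.symm (Finsupp.single ⟨k, h⟩ 1))
  have h1 := hf x
  rw [hx, LinearEquiv.apply_symm_apply] at h1
  have h2 := DFunLike.congr_fun h1 ⟨k, h⟩
  rw [intervalSumMap_apply_of_notMem _ k h' h] at h2
  simp at h2

theorem injective_of_mem_target (hf : ∀ x, eB (f x) = intervalSumMap I j j' (eA x))
    (hmem : ∀ k, (I k).1 ≤ j ∧ j ≤ (I k).2 → (I k).1 ≤ j' ∧ j' ≤ (I k).2) :
    Function.Injective f := by
  rw [← LinearMap.ker_eq_bot, LinearMap.ker_eq_bot']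
  intro x hx
  have h1 := hf x
  rw [hx, map_zero] at h1
  rw [← LinearEquiv.map_eq_zero_iff eA]
  ext ⟨k, h⟩
  rw [← intervalSumMap_apply_of_mem (eA x) k h (hmem k h), ← h1]
  rfl

theorem surjective_of_mem_source (hf : ∀ x, eB (f x) = intervalSumMap I j j' (eA x))
    (hmem : ∀ k, (I k).1 ≤ j' ∧ j' ≤ (I k).2 → (I k).1 ≤ j ∧ j ≤ (I k).2) :
    Function.Surjective f := by
  have key : ∀ y : IntervalSum I j', ∃ x, f x = eB.symm y := fun y => by
    induction y using Finsupp.induction_linear with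
    | zero => exact ⟨0, by simp⟩
    | add g g' hg hg' =>
      obtain ⟨x, hx⟩ := hg
      obtain ⟨x', hx'⟩ := hg'
      exact ⟨x + x', by rw [map_add, map_add, hx, hx']⟩
    | single l a =>
      obtain ⟨l, hl⟩ := l
      obtain rfl | ha := eq_or_ne a 0
      · exact ⟨0, by simp⟩
      obtain rfl := ZMod2.eq_one ha
      refine ⟨eA.symm (Finsupp.single ⟨l, hmem l hl⟩ 1), ?_⟩
      rw [LinearEquiv.eq_symm_apply, hf, LinearEquiv.apply_symm_apply,
        intervalSumMap_single_of_mem l (hmem l hl) hl]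
  intro y
  obtain ⟨x, hx⟩ := key (eB y)
  exact ⟨x, by rw [hx, LinearEquiv.symm_apply_apply]⟩

/-- `hker` says that the kernel has at most one non-zero element, and each interval that stops
supplies one. -/
theorem end_unique (hf : ∀ x, eB (f x) = intervalSumMap I j j' (eA x))
    (hker : ∀ x y, f x = 0 → f y = 0 → x ≠ 0 → y ≠ 0 → x = y) {k l : ι}
    (hk : (I k).1 ≤ j ∧ j ≤ (I k).2) (hk' : ¬ ((I k).1 ≤ j' ∧ j' ≤ (I k).2))
    (hl : (I l).1 ≤ j ∧ j ≤ (I l).2) (hl' : ¬ ((I l).1 ≤ j' ∧ j' ≤ (I l).2)) : k = l := by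
  have key : ∀ k h, ¬ ((I k).1 ≤ j' ∧ j' ≤ (I k).2) →
      f (eA.symm (Finsupp.single ⟨k, h⟩ 1)) = 0 := fun k h h' => by
    rw [← LinearEquiv.map_eq_zero_iff eB, hf, LinearEquiv.apply_symm_apply,
      intervalSumMap_single_of_notMem k h h']
  have := hker _ _ (key k hk hk') (key l hl hl') (by simp) (by simp)
  rw [EmbeddingLike.apply_eq_iff_eq, Finsupp.single_left_inj one_ne_zero, Subtype.mk.injEq] at this
  exact this

/-- `hcoker` says that the cokernel has at most one non-zero element, and each interval that starts
supplies one. -/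
theorem start_unique (hf : ∀ x, eB (f x) = intervalSumMap I j j' (eA x))
    (hcoker : ∀ x y, (∀ z, f z ≠ x) → (∀ z, f z ≠ y) → ∃ z, f z = x + y) {k l : ι}
    (hk : (I k).1 ≤ j' ∧ j' ≤ (I k).2) (hk' : ¬ ((I k).1 ≤ j ∧ j ≤ (I k).2))
    (hl : (I l).1 ≤ j' ∧ j' ≤ (I l).2) (hl' : ¬ ((I l).1 ≤ j ∧ j ≤ (I l).2)) : k = l := by
  have key : ∀ k h, ¬ ((I k).1 ≤ j ∧ j ≤ (I k).2) → ∀ z,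
      f z ≠ eB.symm (Finsupp.single ⟨k, h⟩ 1) := fun k h h' z hz => by
    rw [LinearEquiv.eq_symm_apply, hf] at hz
    have h2 := DFunLike.congr_fun hz ⟨k, h⟩
    rw [intervalSumMap_apply_of_notMem _ k h' h] at h2
    simp at h2
  obtain ⟨z, hz⟩ := hcoker _ _ (key k hk hk') (key l hl hl')
  rw [← map_add, LinearEquiv.eq_symm_apply, hf] at hz
  have h2 := DFunLike.congr_fun hz ⟨k, hk⟩
  rw [intervalSumMap_apply_of_notMem _ k hk' hk, Finsupp.add_apply, Finsupp.single_eq_same] at h2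
  by_contra hne
  rw [Finsupp.single_eq_of_ne] at h2
  · simp at h2
  · simpa using hne

end IntervalSums

/-! ### The effect of one simplex on homology, and the event on each arrow. -/

section Arrow

variable {V : Type*} [DecidableEq V] {K L : PreAbstractSimplicialComplex V} {σ : Finset V}

/-- Some cycle of `L` contains `σ`. -/
def InCycle (L : PreAbstractSimplicialComplex V) (σ : Finset V) : Prop :=
  ∃ q, ∃ w ∈ cycles L q, w σ ≠ 0

namespace Adds

theorem injective_of_inCycle (h : Adds K L σ) (hc : InCycle L σ) (q : ℕ) :
    Function.Injective (homologyMap h.le q) := by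
  obtain ⟨r, w, hw, hwσ⟩ := hc
  rw [← LinearMap.ker_eq_bot, LinearMap.ker_eq_bot']
  intro x hx
  obtain ⟨x, rfl⟩ := Submodule.mkQ_surjective _ x
  rw [homologyMap_mk, Homology.mk_eq_zero_iff] at hx
  exact Homology.mk_eq_zero_iff.2 (h.boundaries_of_creator hw hwσ hx)

theorem exists_preimage (h : Adds K L σ) {q : ℕ} (x : cycles L q) (hx : (x : Chain V) σ = 0) :
    ∃ y, homologyMap h.le q y = ((boundaries L q).submoduleOf (cycles L q)).mkQ x :=
  ⟨((boundaries K q).submoduleOf (cycles K q)).mkQ ⟨x, h.mem_cycles_of_coeff x.2 hx⟩, rfl⟩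

theorem surjective_of_not_inCycle (h : Adds K L σ) (hc : ¬ InCycle L σ) (q : ℕ) :
    Function.Surjective (homologyMap h.le q) := by
  intro x
  obtain ⟨x, rfl⟩ := Submodule.mkQ_surjective _ x
  refine h.exists_preimage x ?_
  by_contra hne
  exact hc ⟨q, x, x.2, hne⟩

/-- A class can be gained only in the dimension of `σ`, and by `injective_of_card_ne` one can be
lost only in the dimension below. This makes the event on an arrow unique across all dimensions, not
just within each. -/
theorem surjective_of_card_ne (h : Adds K L σ) {q : ℕ} (hq : σ.card ≠ q + 1) :
    Function.Surjective (homologyMap h.le q) := by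
  intro x
  obtain ⟨x, rfl⟩ := Submodule.mkQ_surjective _ x
  refine h.exists_preimage x ?_
  by_contra hne
  exact hq (mem_chains.1 x.2.1 σ hne).2

theorem injective_of_card_ne (h : Adds K L σ) {q : ℕ} (hq : σ.card ≠ q + 2) :
    Function.Injective (homologyMap h.le q) := by
  rw [← LinearMap.ker_eq_bot, LinearMap.ker_eq_bot']
  intro x hx
  obtain ⟨x, rfl⟩ := Submodule.mkQ_surjective _ x
  rw [homologyMap_mk, Homology.mk_eq_zero_iff] at hx
  obtain ⟨c, hc, hcx⟩ := mem_boundaries.1 hx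
  refine Homology.mk_eq_zero_iff.2 (mem_boundaries.2 ⟨c, h.mem_chains_of_coeff hc ?_, hcx⟩)
  by_contra hne
  exact hq (mem_chains.1 hc σ hne).2

theorem not_surjective_of_inCycle (h : Adds K L σ) (hc : InCycle L σ) :
    ∃ q, ¬ Function.Surjective (homologyMap h.le q) := by
  obtain ⟨q, w, hw, hwσ⟩ := hc
  refine ⟨q, fun hsurj => ?_⟩
  obtain ⟨x, hx⟩ := hsurj (((boundaries L q).submoduleOf (cycles L q)).mkQ ⟨w, hw⟩)
  obtain ⟨x, rfl⟩ := Submodule.mkQ_surjective _ x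
  rw [homologyMap_mk, Homology.mk_eq_iff] at hx
  have := h.coeff_eq_of_add_mem hx
  rw [h.coeff_zero x.2.1] at this
  exact hwσ this.symm

/-- The class of `∂σ` dies in `L`. It is non-zero in `K`: if `∂σ = ∂c` with `c` in `K`, then `σ + c`
would be a cycle through `σ`. -/
theorem not_injective_of_not_inCycle (h : Adds K L σ) (hc : ¬ InCycle L σ) :
    ∃ q, ¬ Function.Injective (homologyMap h.le q) := by
  have hσL : ∀ q, σ.card = q + 1 → Finsupp.single σ 1 ∈ chains L q := fun q hq =>
    Finsupp.single_mem_supported _ _ ⟨h.mem_iff.2 (Or.inl rfl), hq⟩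
  have hpos := Finset.card_pos.2 h.nonempty
  obtain ⟨q, hq⟩ : ∃ q, σ.card = q + 2 := by
    -- A vertex is itself a 0-cycle, so `σ` has at least two vertices.
    by_contra! hne
    have h1 : σ.card = 1 := by
      have := hne (σ.card - 2)
      omega
    refine hc ⟨0, Finsupp.single σ 1, ⟨hσL 0 h1, LinearMap.mem_ker.2 ?_⟩, by simp⟩
    rw [boundary_single, if_pos h1.le]
  refine ⟨q, fun hinj => hc ?_⟩
  have hb := hσL (q + 1) hq
  have hcyc : boundary (Finsupp.single σ 1) ∈ cycles K q :=
    ⟨h.mem_chains_of_coeff (boundary_mem_chains hb) (h.boundary_coeff hb), boundary_boundary _⟩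
  have h0 : ((boundaries K q).submoduleOf (cycles K q)).mkQ ⟨_, hcyc⟩ = 0 := by
    apply hinj
    rw [map_zero, homologyMap_mk, Homology.mk_eq_zero_iff]
    exact mem_boundaries.2 ⟨_, hb, rfl⟩
  obtain ⟨c, hcK, hcb⟩ := mem_boundaries.1 (Homology.mk_eq_zero_iff.1 h0)
  refine ⟨q + 1, Finsupp.single σ 1 + c, ⟨add_mem hb (chains_mono h.le _ hcK),
    LinearMap.mem_ker.2 ?_⟩, ?_⟩
  · rw [map_add, hcb, add_self_zero]
  · rw [Finsupp.add_apply, h.coeff_zero hcK]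
    simp

/-- Chains of `L` bounding cycles that do not bound in `K` all contain `σ`, so two of them add up to
a chain of `K`. -/
theorem ker_unique (h : Adds K L σ) {q : ℕ} (x y : Homology K q) (hx : homologyMap h.le q x = 0)
    (hy : homologyMap h.le q y = 0) (hx0 : x ≠ 0) (hy0 : y ≠ 0) : x = y := by
  obtain ⟨x, rfl⟩ := Submodule.mkQ_surjective _ x
  obtain ⟨y, rfl⟩ := Submodule.mkQ_surjective _ y
  rw [homologyMap_mk, Homology.mk_eq_zero_iff] at hx hy
  rw [Ne, Homology.mk_eq_zero_iff] at hx0 hy0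
  obtain ⟨c, hc, hcx⟩ := mem_boundaries.1 hx
  obtain ⟨c', hc', hcy⟩ := mem_boundaries.1 hy
  have key : ∀ {c z}, c ∈ chains L (q + 1) → boundary c = z → z ∉ boundaries K q → c σ ≠ 0 :=
    fun hc hcz hz h0 => hz (mem_boundaries.2 ⟨_, h.mem_chains_of_coeff hc h0, hcz⟩)
  rw [Homology.mk_eq_iff]
  exact mem_boundaries.2 ⟨c + c', h.add_mem_chains hc hc' (key hc hcx hx0) (key hc' hcy hy0),
    by rw [map_add, hcx, hcy]⟩

theorem coker_unique (h : Adds K L σ) {q : ℕ} (x y : Homology L q)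
    (hx : ∀ z, homologyMap h.le q z ≠ x) (hy : ∀ z, homologyMap h.le q z ≠ y) :
    ∃ z, homologyMap h.le q z = x + y := by
  obtain ⟨x, rfl⟩ := Submodule.mkQ_surjective _ x
  obtain ⟨y, rfl⟩ := Submodule.mkQ_surjective _ y
  have key : ∀ x : cycles L q, (∀ z, homologyMap h.le q z ≠
      ((boundaries L q).submoduleOf (cycles L q)).mkQ x) → (x : Chain V) σ ≠ 0 := fun x hx h0 =>
    let ⟨z, hz⟩ := h.exists_preimage x h0
    hx z hz
  rw [← map_add]
  refine h.exists_preimage (x + y) ?_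
  rw [Submodule.coe_add, Finsupp.add_apply, ZMod2.add_eq_zero (key x hx) (key y hy)]

variable {ι : Type*} {dim : ι → ℕ} {I : ι → ℕ × ℕ} {j j' : ℕ}

/-- How the intervals of a barcode behave along an elementary inclusion. -/
theorem events (h : Adds K L σ)
    (e : ∀ q, ∃ (eK : Homology K q ≃ₗ[ZMod 2] IntervalSum (fun k : {k // dim k = q} => I k.1) j)
      (eL : Homology L q ≃ₗ[ZMod 2] IntervalSum (fun k : {k // dim k = q} => I k.1) j'),
      ∀ x, eL (homologyMap h.le q x) = intervalSumMap _ j j' (eK x)) :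
    (InCycle L σ ∧ (∀ k, (I k).1 ≤ j ∧ j ≤ (I k).2 → (I k).1 ≤ j' ∧ j' ≤ (I k).2) ∧
      ∃ k, ((I k).1 ≤ j' ∧ j' ≤ (I k).2 ∧ ¬ ((I k).1 ≤ j ∧ j ≤ (I k).2)) ∧ ∀ l,
        ((I l).1 ≤ j' ∧ j' ≤ (I l).2 ∧ ¬ ((I l).1 ≤ j ∧ j ≤ (I l).2)) → l = k) ∨
    (¬ InCycle L σ ∧ (∀ k, (I k).1 ≤ j' ∧ j' ≤ (I k).2 → (I k).1 ≤ j ∧ j ≤ (I k).2) ∧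
      ∃ k, ((I k).1 ≤ j ∧ j ≤ (I k).2 ∧ ¬ ((I k).1 ≤ j' ∧ j' ≤ (I k).2)) ∧ ∀ l,
        ((I l).1 ≤ j ∧ j ≤ (I l).2 ∧ ¬ ((I l).1 ≤ j' ∧ j' ≤ (I l).2)) → l = k) := by
  by_cases hc : InCycle L σ
  · refine Or.inl ⟨hc, fun k hk => ?_, ?_⟩
    · obtain ⟨eK, eL, hf⟩ := e (dim k)
      exact mem_target_of_injective hf (h.injective_of_inCycle hc _) ⟨k, rfl⟩ hk
    · obtain ⟨q, hq⟩ := h.not_surjective_of_inCycle hc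
      obtain ⟨eK, eL, hf⟩ := e q
      have hne : ∃ k, ((I k).1 ≤ j' ∧ j' ≤ (I k).2 ∧ ¬ ((I k).1 ≤ j ∧ j ≤ (I k).2)) := by
        by_contra! hne
        exact hq (surjective_of_mem_source hf fun k hk => hne k.1 hk.1 hk.2)
      obtain ⟨k, hk⟩ := hne
      -- Every new interval lives in the dimension of `σ`, so two of them can be compared in one
      -- homology group.
      have hcard : ∀ l, ((I l).1 ≤ j' ∧ j' ≤ (I l).2 ∧ ¬ ((I l).1 ≤ j ∧ j ≤ (I l).2)) →
          σ.card = dim l + 1 := fun l hl => by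
        by_contra hne
        obtain ⟨eK, eL, hf⟩ := e (dim l)
        exact hl.2.2 (mem_source_of_surjective hf (h.surjective_of_card_ne hne) ⟨l, rfl⟩
          ⟨hl.1, hl.2.1⟩)
      refine ⟨k, hk, fun l hl => ?_⟩
      have hd : dim k = dim l := by
        have h1 := hcard k hk
        have h2 := hcard l hl
        omega
      obtain ⟨eK, eL, hf⟩ := e (dim l)
      exact congrArg Subtype.val (start_unique hf (h.coker_unique (q := dim l)) (k := ⟨l, rfl⟩)
        (l := ⟨k, hd⟩) ⟨hl.1, hl.2.1⟩ hl.2.2 ⟨hk.1, hk.2.1⟩ hk.2.2)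
  · refine Or.inr ⟨hc, fun k hk => ?_, ?_⟩
    · obtain ⟨eK, eL, hf⟩ := e (dim k)
      exact mem_source_of_surjective hf (h.surjective_of_not_inCycle hc _) ⟨k, rfl⟩ hk
    · obtain ⟨q, hq⟩ := h.not_injective_of_not_inCycle hc
      obtain ⟨eK, eL, hf⟩ := e q
      have hne : ∃ k, ((I k).1 ≤ j ∧ j ≤ (I k).2 ∧ ¬ ((I k).1 ≤ j' ∧ j' ≤ (I k).2)) := by
        by_contra! hne
        exact hq (injective_of_mem_target hf fun k hk => hne k.1 hk.1 hk.2)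
      obtain ⟨k, hk⟩ := hne
      have hcard : ∀ l, ((I l).1 ≤ j ∧ j ≤ (I l).2 ∧ ¬ ((I l).1 ≤ j' ∧ j' ≤ (I l).2)) →
          σ.card = dim l + 2 := fun l hl => by
        by_contra hne
        obtain ⟨eK, eL, hf⟩ := e (dim l)
        exact hl.2.2 (mem_target_of_injective hf (h.injective_of_card_ne hne) ⟨l, rfl⟩
          ⟨hl.1, hl.2.1⟩)
      refine ⟨k, hk, fun l hl => ?_⟩
      have hd : dim k = dim l := by
        have h1 := hcard k hk
        have h2 := hcard l hl
        omega
      obtain ⟨eK, eL, hf⟩ := e (dim l)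
      exact congrArg Subtype.val (end_unique hf (h.ker_unique (q := dim l)) (k := ⟨l, rfl⟩)
        (l := ⟨k, hd⟩) ⟨hl.1, hl.2.1⟩ hl.2.2 ⟨hk.1, hk.2.1⟩ hk.2.2)

end Adds

namespace Filtration

variable {F : Filtration V} {ι : Type*} {dim : ι → ℕ} {ζ : ι → RepSeq V} {j : ℕ}

/-- The intervals that begin or end on the arrow from `K_j` to `K_{j+1}`, according to whether
the simplex of the arrow lies in a cycle. -/
theorem IsBarcodeWithReps.arrow (h : F.IsBarcodeWithReps dim ζ) (hj : j < F.m) :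
    (F.Fwd j → InCycle (F.K (j + 1)) (F.cell j) →
      (∃ k₀, (ζ k₀).b = j + 1 ∧ ∀ k, (ζ k).b = j + 1 → k = k₀) ∧ ∀ k, (ζ k).d ≠ j) ∧
    (F.Fwd j → ¬ InCycle (F.K (j + 1)) (F.cell j) →
      (∃ k₁, (ζ k₁).d = j ∧ ∀ k, (ζ k).d = j → k = k₁) ∧ ∀ k, (ζ k).b ≠ j + 1) ∧
    (F.Bwd j → InCycle (F.K j) (F.cell j) →
      (∃ k₁, (ζ k₁).d = j ∧ ∀ k, (ζ k).d = j → k = k₁) ∧ ∀ k, (ζ k).b ≠ j + 1) ∧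
    (F.Bwd j → ¬ InCycle (F.K j) (F.cell j) →
      (∃ k₀, (ζ k₀).b = j + 1 ∧ ∀ k, (ζ k).b = j + 1 → k = k₀) ∧ ∀ k, (ζ k).d ≠ j) := by
  obtain ⟨hrep, hbar⟩ := h
  have start_iff : ∀ k, (ζ k).b = j + 1 ↔
      ((ζ k).b ≤ j + 1 ∧ j + 1 ≤ (ζ k).d ∧ ¬ ((ζ k).b ≤ j ∧ j ≤ (ζ k).d)) := fun k => by
    have := (hrep k).le
    omega
  have end_iff : ∀ k, (ζ k).d = j ↔
      ((ζ k).b ≤ j ∧ j ≤ (ζ k).d ∧ ¬ ((ζ k).b ≤ j + 1 ∧ j + 1 ≤ (ζ k).d)) := fun k => by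
    have := (hrep k).le
    omega
  have none_end : (∀ k, (ζ k).b ≤ j ∧ j ≤ (ζ k).d → (ζ k).b ≤ j + 1 ∧ j + 1 ≤ (ζ k).d) →
      ∀ k, (ζ k).d ≠ j := fun h k hk => by
    have h1 := (end_iff k).1 hk
    exact h1.2.2 (h k ⟨h1.1, h1.2.1⟩)
  have none_start : (∀ k, (ζ k).b ≤ j + 1 ∧ j + 1 ≤ (ζ k).d → (ζ k).b ≤ j ∧ j ≤ (ζ k).d) →
      ∀ k, (ζ k).b ≠ j + 1 := fun h k hk => by
    have h1 := (start_iff k).1 hk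
    exact h1.2.2 (h k ⟨h1.1, h1.2.1⟩)
  simp only [start_iff, end_iff] at none_start none_end ⊢
  have hfwd : ∀ hf : F.Fwd j, _ := fun hf => Adds.events (I := fun k => ((ζ k).b, (ζ k).d))
    (dim := dim) (j := j) (j' := j + 1) (hf.adds hj) fun q => by
      obtain ⟨e, he⟩ := (hbar q).2
      exact ⟨e j, e (j + 1), (he j hj).1 hf⟩
  have hbwd : ∀ hf : F.Bwd j, _ := fun hf => Adds.events (I := fun k => ((ζ k).b, (ζ k).d))
    (dim := dim) (j := j + 1) (j' := j) (hf.adds hj) fun q => by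
      obtain ⟨e, he⟩ := (hbar q).2
      exact ⟨e (j + 1), e j, (he j hj).2 hf⟩
  refine ⟨fun hf hc => ?_, fun hf hc => ?_, fun hf hc => ?_, fun hf hc => ?_⟩
  · rcases hfwd hf with ⟨-, h1, h2⟩ | ⟨h0, -⟩
    · exact ⟨h2, none_end h1⟩
    · exact absurd hc h0
  · rcases hfwd hf with ⟨h0, -⟩ | ⟨-, h1, h2⟩
    · exact absurd h0 hc
    · exact ⟨h2, none_start h1⟩
  · rcases hbwd hf with ⟨-, h1, h2⟩ | ⟨h0, -⟩
    · exact ⟨h2, none_start h1⟩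
    · exact absurd hc h0
  · rcases hbwd hf with ⟨h0, -⟩ | ⟨-, h1, h2⟩
    · exact absurd h0 hc
    · exact ⟨h2, none_end h1⟩

theorem IsBarcodeWithReps.events (h : F.IsBarcodeWithReps dim ζ) : F.Events ζ := fun j hj => by
  obtain ⟨h1, h2, h3, h4⟩ := h.arrow hj
  rcases F.fwd_or_bwd hj with hf | hf
  · by_cases hc : InCycle (F.K (j + 1)) (F.cell j)
    · exact Or.inl (h1 hf hc)
    · exact Or.inr (h2 hf hc)
  · by_cases hc : InCycle (F.K j) (F.cell j)
    · exact Or.inr (h3 hf hc)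
    · exact Or.inl (h4 hf hc)

end Filtration

end Arrow

/-! ### The birth order and the death order -/

namespace Filtration

section Orders

variable {V : Type*} {F : Filtration V} {b₁ b₂ b₃ d₁ d₂ d₃ : ℕ}

open Classical in
/-- An integer key that sorts birth indices by the birth order. -/
noncomputable def birthKey (F : Filtration V) (b : ℕ) : ℤ := if F.Fwd (b - 1) then b else -b

open Classical in
/-- An integer key that sorts death indices by the death order. -/
noncomputable def deathKey (F : Filtration V) (d : ℕ) : ℤ := if F.Fwd d then d - F.m else F.m - d

/-- Backward births precede forward ones; backward births are ordered by decreasing index, forward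
ones by increasing index. The bounds on the indices make the two directions exclude each other. -/
theorem birthLT_iff (h₁ : 1 ≤ b₁) (h₁' : b₁ ≤ F.m) (h₂ : 1 ≤ b₂) (h₂' : b₂ ≤ F.m) :
    F.BirthLT b₁ b₂ ↔ F.birthKey b₁ < F.birthKey b₂ := by
  rcases eq_or_ne b₁ b₂ with rfl | hne
  · simp [BirthLT]
  have e1 : F.Bwd (b₁ - 1) ↔ ¬ F.Fwd (b₁ - 1) :=
    ⟨fun h => h.not_fwd (by omega), bwd_of_not_fwd (by omega)⟩
  rw [BirthLT, e1, birthKey, birthKey]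
  split_ifs with h h' h' <;> simp only [h, h', and_true, and_false, or_false, false_or, false_iff,
    not_true_eq_false, not_false_eq_true] <;> omega

/-- Forward deaths come first, by increasing index, and then backward deaths, by decreasing index.
The shift by `F.m` makes the former keys negative and the latter positive. -/
theorem deathLT_iff (h₁ : d₁ < F.m) (h₂ : d₂ < F.m) :
    F.DeathLT d₁ d₂ ↔ F.deathKey d₁ < F.deathKey d₂ := by
  rcases eq_or_ne d₁ d₂ with rfl | hne
  · simp [DeathLT]
  have e2 : F.Bwd d₂ ↔ ¬ F.Fwd d₂ := ⟨fun h => h.not_fwd h₂, bwd_of_not_fwd h₂⟩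
  rw [DeathLT, e2, deathKey, deathKey]
  split_ifs with h h' h' <;> simp only [h, h', and_true, and_false, or_false, false_or, false_iff,
    not_true_eq_false, not_false_eq_true] <;> omega

theorem birthKey_inj (h₁ : 1 ≤ b₁) (h₂ : 1 ≤ b₂) (h : F.birthKey b₁ = F.birthKey b₂) :
    b₁ = b₂ := by
  rw [birthKey, birthKey] at h
  split_ifs at h <;> omega

theorem deathKey_inj (h₁ : d₁ < F.m) (h₂ : d₂ < F.m) (h : F.deathKey d₁ = F.deathKey d₂) :
    d₁ = d₂ := by
  rw [deathKey, deathKey] at h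
  split_ifs at h <;> omega

end Orders

/-! ### Sums of representatives -/

theorem chains_le_sup {V : Type*} (F : Filtration V) (j n : ℕ) :
    chains (F.K (j + 1)) n ≤ chains (F.K j) n ⊔ chains (F.K (j + 1)) n := le_sup_right

variable {V : Type*} [DecidableEq V] {F : Filtration V} {q t : ℕ} {ζ ξ : RepSeq V}

theorem IsRep.pre (h : F.IsRep q ζ) (hb : ζ.b ≤ t) (hd : t ≤ ζ.d) :
    F.PostBirth q (ζ.pre t) where
  one_le := h.one_le
  le := hb
  lt := lt_of_le_of_lt hd h.lt
  cycle _ hj hj' := h.cycle _ hj (hj'.trans hd)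
  link _ hj hj' := h.link hj (lt_of_lt_of_le hj' hd)
  birth_bwd := h.birth_bwd
  birth_fwd := h.birth_fwd

theorem IsRep.suf (h : F.IsRep q ζ) (hb : ζ.b ≤ t) (hd : t ≤ ζ.d) :
    F.PreDeath q (ζ.suf t) where
  one_le := h.one_le.trans hb
  le := hd
  lt := h.lt
  cycle _ hj hj' := h.cycle _ (hb.trans hj) hj'
  link _ hj hj' := h.link (hb.trans hj) hj'
  death_fwd := h.death_fwd
  death_bwd := h.death_bwd

/-- A cycle that continues backwards over a forward arrow does not contain the added simplex. -/
theorem Linked.coeff_fwd {j : ℕ} {x y c : Chain V} (h : F.Linked q j x y c) (hj : j < F.m)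
    (hf : F.Fwd j) (hx : x ∈ cycles (F.K j) q) : y (F.cell j) = 0 := by
  rw [← (hf.adds hj).coeff_eq_of_add_mem (h.fwd hf), (hf.adds hj).coeff_zero hx.1]

/-- A cycle that continues over a backward arrow does not contain the deleted simplex. -/
theorem Linked.coeff_bwd {j : ℕ} {x y c : Chain V} (h : F.Linked q j x y c) (hj : j < F.m)
    (hf : F.Bwd j) (hy : y ∈ cycles (F.K (j + 1)) q) : x (F.cell j) = 0 := by
  rw [(hf.adds hj).coeff_eq_of_add_mem (h.bwd hf), (hf.adds hj).coeff_zero hy.1]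

theorem PostBirth.trunc_cycle (h : F.PostBirth q ζ) {j : ℕ} (hj : j ≤ ζ.d) :
    (if ζ.b ≤ j then ζ.z j else 0) ∈ cycles (F.K j) q := by
  split_ifs with hb
  · exact h.cycle j hb hj
  · exact zero_mem _

/-- A sequence born on a backward arrow extends by zero to earlier indices, since `c_{b-1}` bounds
its first cycle. The birth order ensures this for any summand that starts later than the sum it
enters. -/
theorem PostBirth.trunc_link (h : F.PostBirth q ζ) {j : ℕ} (hj : j < ζ.d)
    (hb : ζ.b = j + 1 → F.Bwd j) :
    F.Linked q j (if ζ.b ≤ j then ζ.z j else 0) (if ζ.b ≤ j + 1 then ζ.z (j + 1) else 0)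
      (if ζ.b ≤ j + 1 then ζ.c j else 0) := by
  rcases lt_trichotomy ζ.b (j + 1) with hlt | heq | hgt
  · rw [if_pos (by omega), if_pos hlt.le, if_pos hlt.le]
    exact h.link j (by omega) hj
  · rw [if_neg (by omega), if_pos heq.le, if_pos heq.le]
    have := h.birth_bwd
    simp only [heq, Nat.add_sub_cancel] at this
    obtain ⟨h1, h2, -⟩ := this (hb heq)
    exact ⟨Submodule.mem_sup_left h1, by rw [zero_add, h2]⟩
  · rw [if_neg (by omega), if_neg (by omega), if_neg (by omega)]
    exact linked_zero

theorem PreDeath.trunc_cycle (h : F.PreDeath q ζ) {j : ℕ} (hj : ζ.b ≤ j) :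
    (if j ≤ ζ.d then ζ.z j else 0) ∈ cycles (F.K j) q := by
  split_ifs with hd
  · exact h.cycle j hj hd
  · exact zero_mem _

/-- A sequence dying on a forward arrow extends by zero to later indices, since its death chain
bounds the last cycle. -/
theorem PreDeath.trunc_link (h : F.PreDeath q ζ) {j : ℕ} (hj : ζ.b ≤ j)
    (hd : ζ.d = j → F.Fwd j) :
    F.Linked q j (if j ≤ ζ.d then ζ.z j else 0) (if j + 1 ≤ ζ.d then ζ.z (j + 1) else 0)
      (if j ≤ ζ.d then ζ.c j else 0) := by
  rcases lt_trichotomy ζ.d j with hlt | heq | hgt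
  · rw [if_neg (by omega), if_neg (by omega), if_neg (by omega)]
    exact linked_zero
  · rw [if_pos heq.ge, if_neg (by omega), if_pos heq.ge]
    have := h.death_fwd
    rw [heq] at this
    obtain ⟨h1, h2, -⟩ := this (hd heq)
    exact ⟨Submodule.mem_sup_right h1, by rw [add_zero, h2]⟩
  · rw [if_pos hgt.le, if_pos (by omega), if_pos hgt.le]
    exact h.link j hj hgt

theorem PostBirth.birth_le_m (h : F.PostBirth q ζ) : ζ.b ≤ F.m := h.le.trans h.lt.le

/-- A post-birth representative whose birth is smaller does not affect the birth condition. -/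
theorem PostBirth.trunc_birth_fwd (h : F.PostBirth q ζ) {b : ℕ} (hb1 : 1 ≤ b) (hb : b ≤ ζ.d)
    (hlt : F.BirthLT ζ.b b) (hf : F.Fwd (b - 1)) :
    (if ζ.b ≤ b then ζ.z b else 0) (F.cell (b - 1)) = 0 := by
  have hlt' := h.lt
  split_ifs with hle
  · obtain ⟨b, rfl⟩ := Nat.exists_eq_add_of_le' hb1
    simp only [Nat.add_sub_cancel] at hf ⊢
    have hne : ζ.b ≠ b + 1 := by
      rcases hlt with h' | h' <;> omega
    exact (h.link b (by omega) (by omega)).coeff_fwd (by omega) hf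
      (h.cycle b (by omega) (by omega))
  · rfl

/-- Only births at larger indices precede a backward birth, so such a summand is still absent at `b`
and cannot disturb the birth chain. -/
theorem PostBirth.not_le_of_bwd (h : F.PostBirth q ζ) {b : ℕ} (hb1 : 1 ≤ b) (hb : b ≤ ζ.d)
    (hlt : F.BirthLT ζ.b b) (hf : F.Bwd (b - 1)) : ¬ ζ.b ≤ b := by
  have hlt' := h.lt
  rcases hlt with ⟨-, h'⟩ | h'
  · exact absurd h' (hf.not_fwd (by omega))
  · omega

/-- The sum of two post-birth representatives ending at the same index. -/
theorem PostBirth.sumB (h : F.PostBirth q ζ) (h' : F.PostBirth q ξ) (hd : ξ.d = ζ.d)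
    (hne : ξ.b ≠ ζ.b) : F.PostBirth q (ζ.sumB F ξ) := by
  have key := birthLT_iff h.one_le h.birth_le_m h'.one_le h'.birth_le_m
  have key' := birthLT_iff h'.one_le h'.birth_le_m h.one_le h.birth_le_m
  have hle := h.le
  have hle' := h'.le
  have h1 := h.one_le
  have h1' := h'.one_le
  have hlt' := h.lt
  have cyc : ∀ j ≤ ζ.d, (ζ.sumB F ξ).z j ∈ cycles (F.K j) q := fun j hj =>
    add_mem (h.trunc_cycle hj) (h'.trunc_cycle (hd ▸ hj))
  by_cases hlt : F.BirthLT ζ.b ξ.b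
  · have hb : (ζ.sumB F ξ).b = ξ.b := if_pos hlt
    refine ⟨by rw [hb]; exact h'.one_le, by rw [hb]; exact hd ▸ h'.le, h.lt, fun j _ hj => cyc j hj,
      fun j hj hj' => ?_, ?_, ?_⟩
    · rw [hb] at hj
      refine (h.trunc_link hj' fun e => ?_).add (h'.trunc_link (hd ▸ hj') fun e => by omega)
      rcases hlt with h2 | h2
      · omega
      · simpa [e] using h2.2
    · rw [hb]
      intro hf
      have hno := h.not_le_of_bwd h'.one_le (by omega) hlt hf
      simp only [RepSeq.sumB, if_neg hno, if_pos le_rfl, zero_add,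
        Nat.sub_add_cancel h'.one_le]
      exact h'.birth_bwd hf
    · rw [hb]
      intro hf
      have h2 := h.trunc_birth_fwd h'.one_le (by omega) hlt hf
      rw [RepSeq.sumB]
      simp only [if_pos (le_refl ξ.b)]
      rw [Finsupp.add_apply, h2, zero_add]
      exact h'.birth_fwd hf
  · have hb : (ζ.sumB F ξ).b = ζ.b := if_neg hlt
    have hlt : F.BirthLT ξ.b ζ.b := by
      rw [key']
      rw [key] at hlt
      exact lt_of_le_of_ne (not_lt.1 hlt) fun e => hne (birthKey_inj h'.one_le h.one_le e)
    refine ⟨by rw [hb]; exact h.one_le, by rw [hb]; exact h.le, h.lt, fun j _ hj => cyc j hj,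
      fun j hj hj' => ?_, ?_, ?_⟩
    · rw [hb] at hj
      refine (h.trunc_link hj' fun e => by omega).add (h'.trunc_link (hd ▸ hj') fun e => ?_)
      rcases hlt with h2 | h2
      · omega
      · simpa [e] using h2.2
    · rw [hb]
      intro hf
      have hno := h'.not_le_of_bwd h.one_le (by omega) hlt hf
      simp only [RepSeq.sumB, if_neg hno, if_pos le_rfl, add_zero,
        Nat.sub_add_cancel h.one_le]
      exact h.birth_bwd hf
    · rw [hb]
      intro hf
      have h2 := h'.trunc_birth_fwd h.one_le (by omega) hlt hf
      rw [RepSeq.sumB]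
      simp only [if_pos (le_refl ζ.b)]
      rw [Finsupp.add_apply, h2, add_zero]
      exact h.birth_fwd hf

theorem PreDeath.trunc_death_bwd (h : F.PreDeath q ζ) {d : ℕ} (hb : ζ.b ≤ d) (hd : d < F.m)
    (hlt : F.DeathLT ζ.d d) (hf : F.Bwd d) :
    (if d ≤ ζ.d then ζ.z d else 0) (F.cell d) = 0 := by
  split_ifs with hle
  · have hne : ζ.d ≠ d := by
      rcases hlt with h' | h' <;> omega
    exact (h.link d hb (by omega)).coeff_bwd hd hf (h.cycle (d + 1) (by omega) (by omega))
  · rfl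

omit [DecidableEq V] in
theorem PreDeath.not_le_of_fwd {d : ℕ} (hd : d < F.m) (hlt : F.DeathLT ζ.d d)
    (hf : F.Fwd d) : ¬ d ≤ ζ.d := by
  rcases hlt with ⟨-, h'⟩ | h'
  · exact absurd h' (hf.not_bwd hd)
  · omega

/-- The sum of two pre-death representatives starting at the same index. -/
theorem PreDeath.sumD (h : F.PreDeath q ζ) (h' : F.PreDeath q ξ) (hb : ξ.b = ζ.b)
    (hne : ξ.d ≠ ζ.d) : F.PreDeath q (ζ.sumD F ξ) := by
  have key := deathLT_iff h.lt h'.lt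
  have key' := deathLT_iff h'.lt h.lt
  have hle := h.le
  have hle' := h'.le
  have cyc : ∀ j, ζ.b ≤ j → (ζ.sumD F ξ).z j ∈ cycles (F.K j) q := fun j hj =>
    add_mem (h.trunc_cycle hj) (h'.trunc_cycle (hb ▸ hj))
  by_cases hlt : F.DeathLT ζ.d ξ.d
  · have hd : (ζ.sumD F ξ).d = ξ.d := if_pos hlt
    refine ⟨h.one_le, by rw [hd]; exact hb ▸ h'.le, by rw [hd]; exact h'.lt,
      fun j hj _ => cyc j hj, fun j hj hj' => ?_, ?_, ?_⟩
    · rw [hd] at hj'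
      refine (h.trunc_link hj fun e => ?_).add (h'.trunc_link (hb ▸ hj) fun e => by omega)
      rcases hlt with h2 | h2
      · omega
      · exact e ▸ h2.2
    · rw [hd]
      intro hf
      have hno := PreDeath.not_le_of_fwd h'.lt hlt hf
      simp only [RepSeq.sumD, if_neg hno, if_pos le_rfl, zero_add]
      exact h'.death_fwd hf
    · rw [hd]
      intro hf
      have h2 := h.trunc_death_bwd (by omega) h'.lt hlt hf
      rw [RepSeq.sumD]
      simp only [if_pos (le_refl ξ.d)]
      rw [Finsupp.add_apply, h2, zero_add]
      exact h'.death_bwd hf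
  · have hd : (ζ.sumD F ξ).d = ζ.d := if_neg hlt
    have hlt : F.DeathLT ξ.d ζ.d := by
      rw [key']
      rw [key] at hlt
      exact lt_of_le_of_ne (not_lt.1 hlt) fun e => hne (deathKey_inj h'.lt h.lt e)
    refine ⟨h.one_le, by rw [hd]; exact h.le, by rw [hd]; exact h.lt,
      fun j hj _ => cyc j hj, fun j hj hj' => ?_, ?_, ?_⟩
    · rw [hd] at hj'
      refine (h.trunc_link hj fun e => by omega).add (h'.trunc_link (hb ▸ hj) fun e => ?_)
      rcases hlt with h2 | h2
      · omega
      · exact e ▸ h2.2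
    · rw [hd]
      intro hf
      have hno := PreDeath.not_le_of_fwd h.lt hlt hf
      simp only [RepSeq.sumD, if_neg hno, if_pos le_rfl, add_zero]
      exact h.death_fwd hf
    · rw [hd]
      intro hf
      have h2 := h'.trunc_death_bwd (by omega) h.lt hlt hf
      rw [RepSeq.sumD]
      simp only [if_pos (le_refl ζ.d)]
      rw [Finsupp.add_apply, h2, add_zero]
      exact h.death_bwd hf

/-- The concatenation of a post-birth and a pre-death representative with homologous cycles. -/
theorem PostBirth.concat (h : F.PostBirth q ζ) (h' : F.PreDeath q ξ) (ht : ζ.d = ξ.b)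
    {A : Chain V} (hA : A ∈ chains (F.K ξ.b) (q + 1))
    (hz : ζ.z ξ.b = ξ.z ξ.b + boundary A) : F.IsRep q (ζ.concat ξ A) := by
  have hb1 := h.one_le
  have hle := h.le
  have hle' := h'.le
  have hlt := h.lt
  have hlt' := h'.lt
  have hz' : ξ.z ξ.b = ζ.z ξ.b + boundary A := by
    rw [hz, add_assoc, add_self_zero, add_zero]
  have cyc : ∀ j, ζ.b ≤ j → j ≤ ξ.d → (ζ.concat ξ A).z j ∈ cycles (F.K j) q := fun j hj hj' => by
    simp only [RepSeq.concat]
    split_ifs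
    · exact h.cycle j hj (by omega)
    · exact h'.cycle j (by omega) hj'
  have lnk : ∀ j, ζ.b ≤ j → j < ξ.d →
      F.Linked q j ((ζ.concat ξ A).z j) ((ζ.concat ξ A).z (j + 1)) ((ζ.concat ξ A).c j) :=
    fun j hj hj' => by
    simp only [RepSeq.concat]
    rcases lt_trichotomy (j + 1) ξ.b with h1 | h1 | h1
    · rw [if_pos (by omega), if_pos h1, if_pos h1]
      exact h.link j hj (by omega)
    · rw [if_pos (by omega), if_neg (by omega), if_neg (by omega), if_pos h1]
      obtain ⟨h2, h3⟩ := h.link j hj (by omega)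
      refine ⟨add_mem h2 (F.chains_le_sup _ _ (h1 ▸ hA)), ?_⟩
      rw [map_add, ← h3, h1, hz', add_assoc]
    · rw [if_neg (by omega), if_neg (by omega), if_neg (by omega), if_neg (by omega)]
      exact h'.link j (by omega) hj'
  refine isRep_of_halves ⟨h.one_le, by simp only [RepSeq.concat]; omega, h'.lt, cyc, lnk, ?_, ?_⟩
    ⟨h.one_le, by simp only [RepSeq.concat]; omega, h'.lt, cyc, lnk, ?_, ?_⟩
  · intro hf
    change F.Bwd (ζ.b - 1) at hf
    obtain ⟨h1, h2, h3⟩ := h.birth_bwd hf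
    simp only [RepSeq.concat, Nat.sub_add_cancel hb1]
    rcases lt_or_eq_of_le (ht ▸ hle) with h4 | h4
    · rw [if_pos h4, if_pos h4]
      exact ⟨h1, h2, h3⟩
    -- The left part is a single index, so `A` joins the birth chain. It lies in the smaller complex
    -- `K_b` and hence avoids the deleted simplex.
    · simp only [if_neg (show ¬ ζ.b < ξ.b by omega), if_pos h4]
      have hf' := hf
      rw [Filtration.Bwd, Nat.sub_add_cancel hb1] at hf'
      rw [← h4] at hA hz'
      refine ⟨add_mem h1 (chains_mono hf' _ hA), by rw [hz', map_add, h2], ?_⟩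
      have hadds := hf.adds (by omega)
      rw [Nat.sub_add_cancel hb1] at hadds
      rw [Finsupp.add_apply, hadds.coeff_zero hA, add_zero]
      exact h3
  · intro hf
    change F.Fwd (ζ.b - 1) at hf
    have h1 := h.birth_fwd hf
    simp only [RepSeq.concat]
    rcases lt_or_eq_of_le (ht ▸ hle) with h4 | h4
    · rw [if_pos h4]
      exact h1
    -- Here the first cycle changes by `∂A`, which cannot contain the simplex added at birth.
    · rw [if_neg (by omega)]
      rw [← h4] at hA hz'
      have hadds := hf.adds (by omega)
      rw [Nat.sub_add_cancel hb1] at hadds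
      rw [hz', Finsupp.add_apply, hadds.boundary_coeff hA, add_zero]
      exact h1
  · intro hf
    change F.Fwd ξ.d at hf
    simp only [RepSeq.concat]
    rw [if_neg (by omega), if_neg (by omega), if_neg (by omega)]
    exact h'.death_fwd hf
  · intro hf
    change F.Bwd ξ.d at hf
    simp only [RepSeq.concat]
    rw [if_neg (by omega)]
    exact h'.death_bwd hf

/-- The sum of two representatives whose intervals contain a common index. -/
theorem IsRep.sum (h : F.IsRep q ζ) (h' : F.IsRep q ξ) (hb : ζ.b ≤ t) (hd : t ≤ ζ.d)
    (hb' : ξ.b ≤ t) (hd' : t ≤ ξ.d) (hne : ξ.b ≠ ζ.b) (hne' : ξ.d ≠ ζ.d) :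
    F.IsRep q (ζ.sum F t ξ) := by
  refine PostBirth.concat ((h.pre hb hd).sumB (h'.pre hb' hd') rfl hne)
    ((h.suf hb hd).sumD (h'.suf hb' hd') rfl hne') rfl (zero_mem _) ?_
  change (if ζ.b ≤ t then ζ.z t else 0) + (if ξ.b ≤ t then ξ.z t else 0) =
    (if t ≤ ζ.d then ζ.z t else 0) + (if t ≤ ξ.d then ξ.z t else 0) + boundary 0
  rw [if_pos hb, if_pos hb', if_pos hd, if_pos hd', map_zero, add_zero]

end Filtration

/-! ### Outward contraction -/

/-- The contraction prescribes only the complexes; consecutive complexes determine the simplex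
between them. -/
theorem Filtration.cell_eq {V : Type*} {F F' : Filtration V} {j j' : ℕ} (hj' : j' < F'.m)
    (hj : j < F.m) (h1 : F'.K j' = F.K j) (h2 : F'.K (j' + 1) = F.K (j + 1)) :
    F'.cell j' = F.cell j := by
  have h := F'.adds_or hj'
  rw [h1, h2] at h
  rcases h with h | h
  · exact h.unique (Filtration.Fwd.adds h.le hj)
  · exact h.unique (Filtration.Bwd.adds h.le hj)

namespace IsOutwardContraction

section Basic

variable {V : Type*} {F F' : Filtration V} {i : ℕ} {σ : Finset V}
  (hF : IsOutwardContraction F F' i σ)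

include hF

theorem pred_add_one : i - 1 + 1 = i := Nat.sub_add_cancel hF.one_le

theorem bwd : F.Bwd (i - 1) := by
  rw [Filtration.Bwd, hF.pred_add_one]
  exact hF.left

theorem fwd : F.Fwd i := hF.right

theorem adds_left : Adds (F.K i) (F.K (i - 1)) σ := by
  have h := hF.bwd.adds (by have := hF.one_le; have := hF.lt; omega)
  rwa [hF.pred_add_one, hF.cell_left] at h

theorem adds_right : Adds (F.K i) (F.K (i + 1)) σ := by
  have h := hF.fwd.adds hF.lt
  rwa [hF.cell_right] at h

theorem K_eq_K : F.K (i - 1) = F.K (i + 1) :=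
  PreAbstractSimplicialComplex.ext (hF.adds_left.faces.trans hF.adds_right.faces.symm)

/-- `K_{i-1}` contains `σ`, so it is not `K_0`. -/
theorem two_le : 2 ≤ i := by
  have h1 := hF.one_le
  by_contra hlt
  have h2 : i - 1 = 0 := by omega
  have h3 := hF.adds_left
  rw [h2, F.K_zero] at h3
  exact notMem_bot _ (h3.mem_iff.2 (Or.inl rfl))

theorem succ_lt : i + 1 < F.m := by
  by_contra hlt
  have h3 := hF.adds_right
  rw [F.K_end _ (not_lt.1 hlt)] at h3
  exact notMem_bot _ (h3.mem_iff.2 (Or.inl rfl))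

theorem K_left {j : ℕ} (hj : j < i) : F'.K j = F.K j := by rw [hF.K_eq, if_pos hj]

/-- The case `j = i - 1` is `K_{i-1} = K_{i+1}`: the contracted complex can be read from either
side. -/
theorem K_right {j : ℕ} (hj : i ≤ j + 1) : F'.K j = F.K (j + 2) := by
  rw [hF.K_eq]
  split_ifs with h
  · obtain rfl : j = i - 1 := by omega
    rw [hF.K_eq_K]
    congr 1
    omega
  · rfl

theorem cell_of_lt {j : ℕ} (hj : j + 1 < i) : F'.cell j = F.cell j := by
  have h1 := hF.length
  have h2 := hF.succ_lt
  exact Filtration.cell_eq (by omega) (by omega) (hF.K_left (by omega)) (hF.K_left hj)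

theorem cell_of_ge {j : ℕ} (hj : i ≤ j + 1) (hm : j < F'.m) : F'.cell j = F.cell (j + 2) := by
  have h1 := hF.length
  exact Filtration.cell_eq hm (by omega) (hF.K_right hj) (hF.K_right (by omega))

end Basic

variable {V : Type*} [DecidableEq V] {F F' : Filtration V} {i : ℕ} {σ : Finset V}
  (hF : IsOutwardContraction F F' i σ) {q : ℕ} {ζ : RepSeq V}

include hF

theorem linked_left {j : ℕ} (hj : j + 1 < i) {x y c : Chain V} (h : F.Linked q j x y c) :
    F'.Linked q j x y c := by
  refine ⟨?_, h.eq⟩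
  rw [hF.K_left hj, hF.K_left (by omega)]
  exact h.mem

theorem linked_right {j : ℕ} (hj : i ≤ j + 1) {x y c : Chain V} (h : F.Linked q (j + 2) x y c) :
    F'.Linked q j x y c := by
  refine ⟨?_, h.eq⟩
  rw [hF.K_right hj, hF.K_right (by omega)]
  exact h.mem

/-- A post-birth sequence may end at `K'` itself, as no condition involves the next arrow;
`preDeath_left` must stop one index earlier. On the right it is `preDeath_shift` that may start at
`K'`. -/
theorem postBirth_left (h : F.PostBirth q ζ) (hd : ζ.d < i) : F'.PostBirth q ζ := by
  have h1 := hF.length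
  have h2 := hF.succ_lt
  have h3 := h.one_le
  have h4 := h.le
  refine ⟨h3, h4, by omega, fun j hj hj' => ?_, fun j hj hj' => ?_, ?_, ?_⟩
  · rw [hF.K_left (by omega)]
    exact h.cycle j hj hj'
  · exact hF.linked_left (by omega) (h.link j hj hj')
  · rw [Filtration.Bwd, hF.K_left (by omega), hF.K_left (by omega), hF.cell_of_lt (by omega)]
    exact h.birth_bwd
  · rw [Filtration.Fwd, hF.K_left (by omega), hF.K_left (by omega), hF.cell_of_lt (by omega)]
    exact h.birth_fwd

theorem preDeath_left (h : F.PreDeath q ζ) (hd : ζ.d + 1 < i) : F'.PreDeath q ζ := by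
  have h1 := hF.length
  have h2 := hF.succ_lt
  refine ⟨h.one_le, h.le, by omega, fun j hj hj' => ?_, fun j hj hj' => ?_, ?_, ?_⟩
  · rw [hF.K_left (by omega)]
    exact h.cycle j hj hj'
  · exact hF.linked_left (by omega) (h.link j hj hj')
  · rw [Filtration.Fwd, hF.K_left (by omega), hF.K_left (by omega), hF.cell_of_lt (by omega)]
    exact h.death_fwd
  · rw [Filtration.Bwd, hF.K_left (by omega), hF.K_left (by omega), hF.cell_of_lt (by omega)]
    exact h.death_bwd

theorem preDeath_shift (h : F.PreDeath q ζ) (hb : i < ζ.b) : F'.PreDeath q ζ.shift := by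
  have h1 := hF.length
  have h2 := hF.two_le
  have h3 := h.le
  have h4 := h.lt
  have e1 : ζ.d - 2 + 2 = ζ.d := by omega
  have e2 : ζ.d - 2 + 1 + 2 = ζ.d + 1 := by omega
  refine ⟨?_, ?_, ?_, fun j hj hj' => ?_, fun j hj hj' => ?_, ?_, ?_⟩ <;>
    simp only [RepSeq.shift] at *
  · omega
  · omega
  · omega
  · rw [hF.K_right (by omega)]
    exact h.cycle _ (by omega) (by omega)
  · refine hF.linked_right (by omega) ?_
    rw [show j + 1 + 2 = j + 2 + 1 by omega]
    exact h.link _ (by omega) (by omega)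
  · rw [Filtration.Fwd, hF.K_right (by omega), hF.K_right (by omega),
      hF.cell_of_ge (by omega) (by omega), e1, e2]
    exact h.death_fwd
  · rw [Filtration.Bwd, hF.K_right (by omega), hF.K_right (by omega),
      hF.cell_of_ge (by omega) (by omega), e1, e2]
    exact h.death_bwd

theorem postBirth_shift (h : F.PostBirth q ζ) (hb : i + 1 < ζ.b) : F'.PostBirth q ζ.shift := by
  have h1 := hF.length
  have h2 := hF.two_le
  have h3 := h.le
  have h4 := h.lt
  have e1 : ζ.b - 2 + 2 = ζ.b := by omega
  have e2 : ζ.b - 2 - 1 + 1 = ζ.b - 2 := by omega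
  have e3 : ζ.b - 2 - 1 + 2 = ζ.b - 1 := by omega
  have e4 : ζ.b - 1 + 1 = ζ.b := by omega
  have hbwd := h.birth_bwd
  have hfwd := h.birth_fwd
  rw [Filtration.Bwd, e4] at hbwd
  rw [Filtration.Fwd, e4] at hfwd
  refine ⟨?_, ?_, ?_, fun j hj hj' => ?_, fun j hj hj' => ?_, ?_, ?_⟩ <;>
    simp only [RepSeq.shift] at *
  · omega
  · omega
  · omega
  · rw [hF.K_right (by omega)]
    exact h.cycle _ (by omega) (by omega)
  · refine hF.linked_right (by omega) ?_
    rw [show j + 1 + 2 = j + 2 + 1 by omega]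
    exact h.link _ (by omega) (by omega)
  · rw [Filtration.Bwd, e2, hF.K_right (j := ζ.b - 2) (by omega),
      hF.K_right (j := ζ.b - 2 - 1) (by omega), hF.cell_of_ge (by omega) (by omega), e1, e3]
    exact hbwd
  · rw [Filtration.Fwd, e2, hF.K_right (j := ζ.b - 2) (by omega),
      hF.K_right (j := ζ.b - 2 - 1) (by omega), hF.cell_of_ge (by omega) (by omega), e1, e3]
    exact hfwd

end IsOutwardContraction

/-! ### Representatives and barcodes of the contracted filtration. -/

variable {V : Type*} [DecidableEq V] {F F' : Filtration V} {i : ℕ} {σ : Finset V} {q : ℕ}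
  {ζ : RepSeq V}

/-- Changing the first cycle of a pre-death representative by a boundary. -/
theorem Filtration.PreDeath.rebase (h : F.PreDeath q ζ) {B : Chain V}
    (hB : B ∈ chains (F.K ζ.b) (q + 1)) :
    F.PreDeath q { ζ with
      z := fun x => if x = ζ.b then ζ.z x + boundary B else ζ.z x
      c := fun x => if x = ζ.b then B + ζ.c x else ζ.c x } := by
  have hle := h.le
  have hlt := h.lt
  refine ⟨h.one_le, h.le, h.lt, fun j hj hj' => ?_, fun j hj hj' => ?_, fun hf => ?_,
    fun hf => ?_⟩
  · dsimp only
    split_ifs with hjb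
    · subst hjb
      exact add_mem (h.cycle _ hj hj') (boundaries_le_cycles _ _ (mem_boundaries.2 ⟨B, hB, rfl⟩))
    · exact h.cycle j hj hj'
  · dsimp only at hj hj' ⊢
    obtain ⟨h1, h2⟩ := h.link j hj hj'
    rw [if_neg (show ¬ j + 1 = ζ.b by omega)]
    split_ifs with hjb
    · subst hjb
      refine ⟨add_mem (Submodule.mem_sup_left hB) h1, ?_⟩
      rw [map_add, ← h2]
      abel
    · exact ⟨h1, h2⟩
  · dsimp only at hf ⊢
    obtain ⟨h1, h2, h3⟩ := h.death_fwd hf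
    split_ifs with hd
    · rw [← hd] at hB
      refine ⟨add_mem (chains_mono hf _ hB) h1, by rw [map_add, h2, add_comm], ?_⟩
      rwa [Finsupp.add_apply, (hf.adds hlt).coeff_zero hB, zero_add]
    · exact ⟨h1, h2, h3⟩
  · dsimp only at hf ⊢
    have h1 := h.death_bwd hf
    split_ifs with hd
    · rw [← hd] at hB
      rwa [Finsupp.add_apply, (hf.adds hlt).boundary_coeff hB, add_zero]
    · exact h1

/-- The carried-over sequence of a representative both of whose ends survive. -/
theorem IsOutwardContraction.isRep_carry (hF : IsOutwardContraction F F' i σ) (h : F.IsRep q ζ)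
    (hb : ζ.b ≠ i) (hb' : ζ.b ≠ i + 1) (hd : ζ.d ≠ i - 1) (hd' : ζ.d ≠ i) :
    F'.IsRep q (ζ.carry i) ∧ (ζ.carry i).b = collapse i ζ.b ∧
      (ζ.carry i).d = collapse i ζ.d := by
  have h2 := hF.two_le
  have hle := h.le
  rw [RepSeq.carry]
  split_ifs with h3 h4
  · refine ⟨Filtration.isRep_of_halves (hF.postBirth_left h.postBirth h3)
      (hF.preDeath_left h.preDeath (by omega)), ?_, ?_⟩
    · rw [collapse, if_pos (by omega)]
    · rw [collapse, if_pos h3]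
  · refine ⟨Filtration.isRep_of_halves (hF.postBirth_shift h.postBirth (by omega))
      (hF.preDeath_shift h.preDeath h4), ?_, ?_⟩
    · rw [collapse, if_neg (by omega), if_neg hb]
      rfl
    · rw [collapse, if_neg h3, if_neg hd']
      rfl
  · refine ⟨?_, by rw [collapse, if_pos (by omega)], by rw [collapse, if_neg h3, if_neg hd']⟩
    have e1 := hF.pred_add_one
    have hl1 := h.link (j := i - 1) (by omega) (by omega)
    have hl2 := h.link (j := i) (by omega) (by omega)
    rw [e1] at hl1
    -- Both chains next to `i` lie in the larger complexes, which are `K'`.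
    have hm1 := hl1.mem_bwd hF.bwd
    have hm2 := hl2.mem_fwd hF.fwd
    have hL := hF.postBirth_left (h.pre (t := i - 1) (by omega) (by omega))
      (by change i - 1 < i; omega)
    have e2 : (RepSeq.suf (i + 1) ζ).shift.b = i - 1 := by
      change i + 1 - 2 = i - 1
      omega
    -- The shifted suffix starts at `K'` with `z_{i+1}`. Rebasing along `c_i` turns this cycle into
    -- `z_i`, and the concatenation along `c_{i-1}` then supplies the other prescribed chain.
    have hR := (hF.preDeath_shift (h.suf (t := i + 1) (by omega) (by omega))
      (by change i < i + 1; omega)).rebase (B := ζ.c i) (by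
        rw [e2, hF.K_left (by omega), hF.K_eq_K]
        exact hm2)
    have hz : ζ.z (i + 1) + boundary (ζ.c i) = ζ.z i := by
      rw [← hl2.eq, add_left_comm, add_self_zero, add_zero]
    have hC := hL.concat hR e2.symm (A := ζ.c (i - 1)) (by
        dsimp only
        rw [e2, hF.K_left (by omega)]
        exact hm1) (by
        dsimp only
        rw [e2, if_pos rfl]
        change ζ.z (i - 1) = ζ.z (i - 1 + 2) + _ + _
        rw [show i - 1 + 2 = i + 1 by omega, hz, ← hl1.eq, add_left_comm, add_self_zero, add_zero])
    convert hC using 1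
    rw [RepSeq.concat, RepSeq.mk.injEq]
    refine ⟨rfl, rfl, funext fun x => ?_, funext fun x => ?_⟩
    · change _ = if x < i + 1 - 2 then ζ.z x else
        if x = i + 1 - 2 then ζ.z (x + 2) + boundary (ζ.c i) else ζ.z (x + 2)
      rcases lt_trichotomy (x + 1) i with hx | hx | hx
      · rw [if_pos hx, if_pos (by omega)]
      · obtain rfl : x = i - 1 := by omega
        rw [if_neg (by omega), if_pos hx, if_neg (by omega), if_pos (by omega),
          show i - 1 + 2 = i + 1 by omega, hz]
      · rw [if_neg (by omega), if_neg (by omega), if_neg (by omega), if_neg (by omega)]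
    · change _ = if x + 1 < i + 1 - 2 then ζ.c x else
        if x + 1 = i + 1 - 2 then ζ.c x + ζ.c (i - 1) else
        if x = i + 1 - 2 then ζ.c i + ζ.c (x + 2) else ζ.c (x + 2)
      rcases lt_trichotomy (x + 2) i with hx | hx | hx
      · rw [if_pos hx, if_pos (by omega)]
      · rw [if_neg (by omega), if_pos hx, if_neg (by omega), if_pos (by omega),
          show x + 1 = i - 1 by omega]
      · simp only [if_neg (show ¬ x + 2 < i by omega), if_neg (show ¬ x + 2 = i by omega),
          if_neg (show ¬ x + 1 < i + 1 - 2 by omega), if_neg (show ¬ x + 1 = i + 1 - 2 by omega)]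
        by_cases hx' : x + 1 = i
        · rw [if_pos hx', if_pos (by omega), hx']
        · rw [if_neg hx', if_neg (by omega)]

/-- Representatives in the contracted filtration whose births and deaths are those of `F`, except
for one birth and one death at the two contracted arrows, give the barcode. -/
theorem IsOutwardContraction.isBarcodeWithReps (hF : IsOutwardContraction F F' i σ) {ι : Type*}
    {dim : ι → ℕ} {ζ : ι → RepSeq V} (hev : F.Events ζ) {s o : ι} (π : ι → ι)
    (hπ : ∀ k, k ≠ o → π k ≠ s)
    (hinj : ∀ k l, k ≠ o → l ≠ o → π k = π l → k = l)
    (hsurj : ∀ l, l ≠ s → ∃ k, k ≠ o ∧ π k = l)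
    (hb : ∀ k, k ≠ o → (ζ k).b ≠ i ∧ (ζ k).b ≠ i + 1) (hbo : (ζ o).b = i ∨ (ζ o).b = i + 1)
    (hd : ∀ k, k ≠ s → (ζ k).d ≠ i - 1 ∧ (ζ k).d ≠ i) (hds : (ζ s).d = i - 1 ∨ (ζ s).d = i)
    (ρ : ι → RepSeq V) (hrep : ∀ k, k ≠ o → F'.IsRep (dim k) (ρ k))
    (hρ : ∀ k, k ≠ o → (ρ k).b = collapse i (ζ k).b ∧ (ρ k).d = collapse i (ζ (π k)).d) :
    F'.IsBarcodeWithReps (fun k : {k // k ≠ o} => dim k.1) (fun k => ρ k.1) := by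
  refine Filtration.isBarcodeWithReps_of_events (fun k => hrep k.1 k.2) fun j hj => ?_
  have h2 := hF.two_le
  -- `g` is the arrow of `F` that has become arrow `j` of `F'`; it is neither `i - 1` nor `i`.
  obtain ⟨g, hg, hgm⟩ : ∃ g, ((j + 1 < i ∧ g = j) ∨ (i ≤ j + 1 ∧ g = j + 2)) ∧ g < F.m := by
    have := hF.length
    rcases lt_or_ge (j + 1) i with h | h
    · exact ⟨j, Or.inl ⟨h, rfl⟩, by omega⟩
    · exact ⟨j + 2, Or.inr ⟨h, rfl⟩, by omega⟩
  have hbirth : ∀ k, k ≠ o → ((ρ k).b = j + 1 ↔ (ζ k).b = g + 1) := fun k hk => by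
    have h3 := hb k hk
    rw [(hρ k hk).1, collapse]
    split_ifs <;> omega
  have hdeath : ∀ k, k ≠ o → ((ρ k).d = j ↔ (ζ (π k)).d = g) := fun k hk => by
    have h3 := hd (π k) (hπ k hk)
    rw [(hρ k hk).2, collapse]
    split_ifs <;> omega
  rcases hev g hgm with ⟨⟨k₀, h3, h4⟩, h5⟩ | ⟨⟨k₁, h3, h4⟩, h5⟩
  · left
    have hk₀ : k₀ ≠ o := fun e => by
      rw [e] at h3
      omega
    exact ⟨⟨⟨k₀, hk₀⟩, (hbirth k₀ hk₀).2 h3, fun k hk =>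
      Subtype.ext (h4 _ ((hbirth k.1 k.2).1 hk))⟩, fun k hk => h5 _ ((hdeath k.1 k.2).1 hk)⟩
  · right
    have hk₁ : k₁ ≠ s := fun e => by
      rw [e] at h3
      omega
    obtain ⟨k, hk, rfl⟩ := hsurj k₁ hk₁
    exact ⟨⟨⟨k, hk⟩, (hdeath k hk).2 h3, fun l hl =>
      Subtype.ext (hinj _ _ l.2 hk (h4 _ ((hdeath l.1 l.2).1 hl)))⟩,
      fun k hk => h5 _ ((hbirth k.1 k.2).1 hk)⟩

/-! ### The pairing -/

section Pairing

variable {V : Type*} {F : Filtration V} {ι : Type*} {ζ : ι → RepSeq V}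

theorem maxDeath_spec (hlt : ∀ k, (ζ k).d < F.m) (k : ι) (t : List ι) :
    maxDeath F ζ k t ∈ k :: t ∧ ∀ x ∈ k :: t,
      F.deathKey (ζ x).d ≤ F.deathKey (ζ (maxDeath F ζ k t)).d := by
  induction t generalizing k with
  | nil => simp [maxDeath]
  | cons l t ih =>
    by_cases h : F.DeathLT (ζ k).d (ζ l).d
    · have e : maxDeath F ζ k (l :: t) = maxDeath F ζ l t := by
        rw [maxDeath, List.foldl_cons, if_pos h, ← maxDeath]
      obtain ⟨h1, h2⟩ := ih l
      rw [e]
      refine ⟨List.mem_cons_of_mem _ h1, fun x hx => ?_⟩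
      rcases List.mem_cons.1 hx with rfl | hx
      · exact ((Filtration.deathLT_iff (hlt _) (hlt _)).1 h).le.trans (h2 l (by simp))
      · exact h2 x hx
    · have e : maxDeath F ζ k (l :: t) = maxDeath F ζ k t := by
        rw [maxDeath, List.foldl_cons, if_neg h, ← maxDeath]
      obtain ⟨h1, h2⟩ := ih k
      rw [Filtration.deathLT_iff (hlt _) (hlt _), not_lt] at h
      rw [e]
      refine ⟨?_, fun x hx => ?_⟩
      · rcases List.mem_cons.1 h1 with h1 | h1
        · rw [h1]
          simp
        · simp [h1]
      · rcases List.mem_cons.1 hx with rfl | hx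
        · exact h2 x (by simp)
        rcases List.mem_cons.1 hx with rfl | hx
        · exact h.trans (h2 k (by simp))
        · exact h2 x (by simp [hx])

theorem maxDeath_eq_of_max (hlt : ∀ k, (ζ k).d < F.m)
    (hinj : ∀ k l, (ζ k).d = (ζ l).d → k = l) {k x : ι} {t : List ι} (hx : x ∈ k :: t)
    (hmax : ∀ y ∈ k :: t, F.deathKey (ζ y).d ≤ F.deathKey (ζ x).d) : maxDeath F ζ k t = x := by
  obtain ⟨h1, h2⟩ := maxDeath_spec hlt k t
  exact hinj _ _ (Filtration.deathKey_inj (hlt _) (hlt _) (le_antisymm (hmax _ h1) (h2 _ hx)))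

-- The right-hand fold is the one that `sumD` performs on death indices, so the chosen partner is
-- where a joined sequence dies.
open Classical in
theorem maxDeath_d (k : ι) (t : List ι) :
    (ζ (maxDeath F ζ k t)).d =
      t.foldl (fun d j => if F.DeathLT d (ζ j).d then (ζ j).d else d) (ζ k).d := by
  induction t generalizing k with
  | nil => rfl
  | cons l t ih =>
    rw [maxDeath, List.foldl_cons, ← maxDeath, ih, List.foldl_cons]
    congr 1
    split_ifs <;> rfl

variable [DecidableEq ι]

/-- If the largest death of the list is the only one that is paired, the greedy phase pairs the
births but the last with the remaining deaths. -/
theorem greedy_spec (hlt : ∀ k, (ζ k).d < F.m) (hinj : ∀ k l, (ζ k).d = (ζ l).d → k = l)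
    (t : List ι) : ∀ (k : ι) (P : Finset ι), (k :: t).Nodup →
    (∀ x ∈ k :: t, x ∈ P ↔ x = maxDeath F ζ k t) →
    (∀ x, x ∉ k :: t → greedy F ζ P (k :: t) x = x) ∧
    (∀ u x y w, k :: t = u ++ x :: y :: w →
      greedy F ζ P (k :: t) x = x ∨ greedy F ζ P (k :: t) x = maxDeath F ζ y w) ∧
    (∀ x ∈ k :: t, greedy F ζ P (k :: t) x ∈ k :: t) ∧
    ∀ l ∈ k :: t, l ≠ maxDeath F ζ k t →
      ∃ x ∈ k :: t, x ≠ (k :: t).getLast (List.cons_ne_nil k t) ∧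
        greedy F ζ P (k :: t) x = l := by
  induction t with
  | nil =>
    intro k P _ _
    refine ⟨fun x _ => rfl, fun u x y w h => ?_, fun x hx => hx, fun l hl hne => ?_⟩
    · have := congrArg List.length h
      simp only [List.length_nil, List.length_append, List.length_cons] at this
      omega
    · exact absurd (List.mem_singleton.1 hl) hne
  | cons k t ih =>
    intro r P hnd hP
    obtain ⟨hr, hnd'⟩ := List.nodup_cons.1 hnd
    set δ := if r ∈ P then maxDeath F ζ k t else r with hδ
    have hg : greedy F ζ P (r :: k :: t) =
        Function.update (greedy F ζ (insert δ P) (k :: t)) r δ := rfl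
    obtain ⟨hm1, hm2⟩ := maxDeath_spec hlt k t
    obtain ⟨hM1, hM2⟩ := maxDeath_spec hlt r (k :: t)
    have hrP := hP r (by simp)
    have htail : r ∉ P → maxDeath F ζ r (k :: t) = maxDeath F ζ k t := fun h => by
      refine (maxDeath_eq_of_max hlt hinj ?_ fun y hy => hM2 y (List.mem_cons_of_mem _ hy)).symm
      exact (List.mem_cons.1 hM1).resolve_left fun e => h (hrP.2 e.symm)
    -- The invariant passes to the tail. If `d_r` was the taken maximum, the largest death of the
    -- tail is now taken in its place; otherwise `b_r` takes `d_r`, and the taken maximum lies in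
    -- the tail.
    have hP' : ∀ x ∈ k :: t, x ∈ insert δ P ↔ x = maxDeath F ζ k t := fun x hx => by
      have hxr : x ≠ r := fun e => hr (e ▸ hx)
      rw [Finset.mem_insert, hP x (List.mem_cons_of_mem _ hx)]
      by_cases h : r ∈ P
      · rw [hδ, if_pos h, ← hrP.1 h]
        exact or_iff_left hxr
      · rw [hδ, if_neg h, htail h]
        exact or_iff_right hxr
    obtain ⟨h1, h2, h3, h4⟩ := ih k (insert δ P) hnd' hP'
    refine ⟨fun x hx => ?_, fun u x y w h => ?_, fun x hx => ?_, fun l hl hne => ?_⟩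
    · rw [List.mem_cons, not_or] at hx
      rw [hg, Function.update_of_ne hx.1]
      exact h1 x hx.2
    · rw [hg]
      cases u with
      | nil =>
        simp only [List.nil_append, List.cons.injEq] at h
        obtain ⟨rfl, rfl, rfl⟩ := h
        rw [Function.update_self, hδ]
        split_ifs
        · exact Or.inr rfl
        · exact Or.inl rfl
      | cons v u =>
        simp only [List.cons_append, List.cons.injEq] at h
        have hxr : x ≠ r := fun e => hr (by rw [h.2, e]; simp)
        rw [Function.update_of_ne hxr]
        exact h2 u x y w h.2
    · rw [hg]
      rcases List.mem_cons.1 hx with rfl | hx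
      · rw [Function.update_self, hδ]
        split_ifs
        · exact List.mem_cons_of_mem _ hm1
        · simp
      · rw [Function.update_of_ne (show x ≠ r from fun e => hr (e ▸ hx))]
        exact List.mem_cons_of_mem _ (h3 x hx)
    · rw [List.getLast_cons (List.cons_ne_nil k t)]
      have key : l ∈ k :: t → l ≠ maxDeath F ζ k t → ∃ x ∈ r :: k :: t,
          x ≠ (k :: t).getLast (List.cons_ne_nil k t) ∧
            greedy F ζ P (r :: k :: t) x = l := fun hl hne => by
        obtain ⟨x, hx, hx', hxl⟩ := h4 l hl hne
        refine ⟨x, List.mem_cons_of_mem _ hx, hx', ?_⟩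
        rw [hg, Function.update_of_ne (show x ≠ r from fun e => hr (e ▸ hx))]
        exact hxl
      have hrlast : r ≠ (k :: t).getLast (List.cons_ne_nil k t) := fun e =>
        hr (e ▸ List.getLast_mem _)
      have hgr : greedy F ζ P (r :: k :: t) r = δ := by rw [hg, Function.update_self]
      by_cases h : r ∈ P
      · have hl' : l ∈ k :: t := (List.mem_cons.1 hl).resolve_left fun e =>
          hne (e.trans (hrP.1 h))
        by_cases hlm : l = maxDeath F ζ k t
        · exact ⟨r, by simp, hrlast, by rw [hgr, hδ, if_pos h, hlm]⟩
        · exact key hl' hlm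
      · rcases List.mem_cons.1 hl with rfl | hl
        · exact ⟨l, by simp, hrlast, by rw [hgr, hδ, if_neg h]⟩
        · exact key hl (htail h ▸ hne)

section Partner

variable {s o : ι} {js : List ι}

/-- Giving `b_*` the largest death sets up the invariant of the greedy phase. That phase reaches
every other listed death without using the last birth, which is thus free for `d_∘`. -/
theorem partner_spec (hlt : ∀ k, (ζ k).d < F.m) (hinj : ∀ k l, (ζ k).d = (ζ l).d → k = l)
    (hnd : js.Nodup) (hs : s ∉ js) :
    (∀ x, x ∉ js → x ≠ s → partner F ζ s o js x = x) ∧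
    (js = [] → partner F ζ s o js s = o) ∧
    (∀ k t, js = k :: t → partner F ζ s o js s = maxDeath F ζ k t) ∧
    (∀ u x, js = u ++ [x] → partner F ζ s o js x = o) ∧
    (∀ u x y w, js = u ++ x :: y :: w →
      partner F ζ s o js x = x ∨ partner F ζ s o js x = maxDeath F ζ y w) ∧
    (∀ x ∈ js, partner F ζ s o js x ∈ js ∨ partner F ζ s o js x = o) ∧
    ∀ l, l ≠ s → l ≠ o → ∃ x, (x = s ∨ x ∈ js ∨ x = l) ∧ partner F ζ s o js x = l := by
  cases js with
  | nil =>
    refine ⟨fun x _ hx => ?_, fun _ => ?_, fun _ _ h => by simp at h, fun _ _ h => by simp at h,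
      fun _ _ _ _ h => by simp at h, fun x hx => by simp at hx, fun l hl _ => ?_⟩
    · rw [partner, Function.update_of_ne hx]
      rfl
    · rw [partner, Function.update_self]
    · exact ⟨l, Or.inr (Or.inr rfl), by rw [partner, Function.update_of_ne hl]; rfl⟩
  | cons k t =>
    set δ := maxDeath F ζ k t with hδ
    set e := (k :: t).getLast (List.cons_ne_nil k t) with he
    have hp : partner F ζ s o (k :: t) =
        Function.update (Function.update (greedy F ζ {δ} (k :: t)) e o) s δ := rfl
    have hemem : e ∈ k :: t := List.getLast_mem _
    obtain ⟨hm1, hm2⟩ := maxDeath_spec hlt k t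
    obtain ⟨h1, h2, h3, h4⟩ := greedy_spec hlt hinj t k {δ} hnd fun x _ => Finset.mem_singleton
    have hns : ∀ x ∈ k :: t, x ≠ s := fun x hx e => hs (e ▸ hx)
    have hpx : ∀ x, x ≠ s → x ≠ e → partner F ζ s o (k :: t) x = greedy F ζ {δ} (k :: t) x :=
      fun x hx hx' => by rw [hp, Function.update_of_ne hx, Function.update_of_ne hx']
    have hpe : partner F ζ s o (k :: t) e = o := by
      rw [hp, Function.update_of_ne (hns e hemem), Function.update_self]
    have hps : partner F ζ s o (k :: t) s = δ := by rw [hp, Function.update_self]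
    refine ⟨fun x hx hx' => ?_, fun h => by simp at h, fun k' t' h => ?_, fun u x h => ?_,
      fun u x y w h => ?_, fun x hx => ?_, fun l hl hl' => ?_⟩
    · rw [hpx x hx' fun e => hx (e ▸ hemem)]
      exact h1 x hx
    · obtain ⟨rfl, rfl⟩ := List.cons.inj h
      exact hps
    · have hxe : e = x := by
        simp only [he, h, List.getLast_append, List.getLast_singleton]
        simp
      rw [← hxe, hpe]
    · have hx : x ∈ k :: t := by simp [h]
      have hxe : x ≠ e := fun heq => by
        have hlast : e = (y :: w).getLast (List.cons_ne_nil y w) := by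
          simp only [he, h]
          rw [List.getLast_append_of_ne_nil (by simp) (by simp), List.getLast_cons (by simp)]
        have hmem : x ∈ y :: w := by
          rw [heq, hlast]
          exact List.getLast_mem _
        rw [h, List.nodup_append] at hnd
        exact (List.nodup_cons.1 hnd.2.1).1 hmem
      rw [hpx x (hns x hx) hxe]
      exact h2 u x y w h
    · by_cases hxe : x = e
      · exact Or.inr (by rw [hxe, hpe])
      · exact Or.inl (by rw [hpx x (hns x hx) hxe]; exact h3 x hx)
    · by_cases hmem : l ∈ k :: t
      · by_cases hlδ : l = δ
        · exact ⟨s, Or.inl rfl, by rw [hps, hlδ]⟩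
        · obtain ⟨x, hx, hxe, hxl⟩ := h4 l hmem hlδ
          exact ⟨x, Or.inr (Or.inl hx), by rw [hpx x (hns x hx) hxe, hxl]⟩
      · exact ⟨l, Or.inr (Or.inr rfl), by
          rw [hpx l hl fun e => hmem (e ▸ hemem)]
          exact h1 l hmem⟩

end Partner

/-- A finite set can be listed by increasing values of an injective function. -/
theorem exists_list_pairwise_lt {κ : Type*} [DecidableEq κ] (f : κ → ℤ) (a : Finset κ)
    (hf : Set.InjOn f a) :
    ∃ l : List κ, l.Nodup ∧ l.toFinset = a ∧ l.Pairwise fun x y => f x < f y := by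
  induction a using Finset.induction_on_max_value f with
  | empty => exact ⟨[], by simp⟩
  | insert x a hx hmax ih =>
    obtain ⟨l, h1, h2, h3⟩ := ih (hf.mono (by simp))
    have hmem : ∀ y, y ∈ l ↔ y ∈ a := fun y => by rw [← h2, List.mem_toFinset]
    refine ⟨l ++ [x], ?_, ?_, ?_⟩
    · rw [List.nodup_append]
      refine ⟨h1, by simp, fun y hy z hz => ?_⟩
      rw [List.mem_singleton.1 hz]
      rintro rfl
      exact hx ((hmem y).1 hy)
    · ext y
      simp [hmem]
    · rw [List.pairwise_append]
      refine ⟨h3, by simp, fun y hy z hz => ?_⟩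
      rw [List.mem_singleton.1 hz]
      have hya := (hmem y).1 hy
      refine lt_of_le_of_ne (hmax y hya) fun e => hx ?_
      rw [← hf (by simp [hya]) (by simp) e]
      exact hya

end Pairing

/-! ### Iterated sums and joined sequences -/

section Folds

variable {V : Type*} [DecidableEq V] {F : Filtration V} {q t : ℕ} {ι : Type*} {ζ : ι → RepSeq V}

/-- Births increase along the list, so each new summand imposes its own birth and the last one
remains. -/
theorem Filtration.PostBirth.foldl_sumB (l : List ι) : ∀ {acc : RepSeq V}, F.PostBirth q acc →
    acc.d = t → (∀ j ∈ l, F.PostBirth q ((ζ j).pre t)) →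
    (∀ j ∈ l, F.BirthLT acc.b (ζ j).b) →
    (l.Pairwise fun j k => F.BirthLT (ζ j).b (ζ k).b) →
    F.PostBirth q ((l.map fun j => (ζ j).pre t).foldl (RepSeq.sumB F) acc) ∧
      ((l.map fun j => (ζ j).pre t).foldl (RepSeq.sumB F) acc).d = t ∧
      ((l.map fun j => (ζ j).pre t).foldl (RepSeq.sumB F) acc).b =
        l.foldl (fun _ j => (ζ j).b) acc.b ∧
      ((l.map fun j => (ζ j).pre t).foldl (RepSeq.sumB F) acc).z t =
        acc.z t + (l.map fun j => (ζ j).z t).sum := by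
  induction l with
  | nil =>
    intro acc h hd _ _ _
    exact ⟨h, hd, rfl, by simp⟩
  | cons j l ih =>
    intro acc h hd hl hlt hp
    obtain ⟨hp1, hp2⟩ := List.pairwise_cons.1 hp
    have hj := hlt j (by simp)
    have hlj := hl j (by simp)
    have hb : (acc.sumB F ((ζ j).pre t)).b = (ζ j).b := if_pos hj
    have hne : ((ζ j).pre t).b ≠ acc.b := by
      change (ζ j).b ≠ acc.b
      rcases hj with h' | h' <;> omega
    have hz : (acc.sumB F ((ζ j).pre t)).z t = acc.z t + (ζ j).z t := by
      have h1 : acc.b ≤ t := hd ▸ h.le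
      have h2 : (ζ j).b ≤ t := hlj.le
      change (if acc.b ≤ t then acc.z t else 0) + (if (ζ j).b ≤ t then (ζ j).z t else 0) = _
      rw [if_pos h1, if_pos h2]
    obtain ⟨h1, h2, h3, h4⟩ := ih (acc := acc.sumB F ((ζ j).pre t))
      (h.sumB hlj hd.symm hne) hd (fun k hk => hl k (by simp [hk]))
      (fun k hk => by rw [hb]; exact hp1 k hk) hp2
    refine ⟨h1, h2, ?_, ?_⟩
    · rw [List.map_cons, List.foldl_cons, h3, hb, List.foldl_cons]
    · rw [List.map_cons, List.foldl_cons, h4, hz, List.map_cons, List.sum_cons, add_assoc]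

-- Deaths are not sorted along the list, so the running maximum is kept. Distinctness prevents two
-- summands with the same death from cancelling its condition.
open Classical in
theorem Filtration.PreDeath.foldl_sumD (l : List ι) : ∀ {acc : RepSeq V}, F.PreDeath q acc →
    acc.b = t → (∀ j ∈ l, F.PreDeath q ((ζ j).suf t)) →
    (∀ j ∈ l, acc.d ≠ (ζ j).d) → (l.Pairwise fun j k => (ζ j).d ≠ (ζ k).d) →
    F.PreDeath q ((l.map fun j => (ζ j).suf t).foldl (RepSeq.sumD F) acc) ∧
      ((l.map fun j => (ζ j).suf t).foldl (RepSeq.sumD F) acc).b = t ∧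
      ((l.map fun j => (ζ j).suf t).foldl (RepSeq.sumD F) acc).d =
        l.foldl (fun d j => if F.DeathLT d (ζ j).d then (ζ j).d else d) acc.d ∧
      ((l.map fun j => (ζ j).suf t).foldl (RepSeq.sumD F) acc).z t =
        acc.z t + (l.map fun j => (ζ j).z t).sum := by
  induction l with
  | nil =>
    intro acc h hb _ _ _
    exact ⟨h, hb, rfl, by simp⟩
  | cons j l ih =>
    intro acc h hb hl hne hp
    obtain ⟨hp1, hp2⟩ := List.pairwise_cons.1 hp
    have hlj := hl j (by simp)
    have hd : (acc.sumD F ((ζ j).suf t)).d =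
      if F.DeathLT acc.d (ζ j).d then (ζ j).d else acc.d := rfl
    have hz : (acc.sumD F ((ζ j).suf t)).z t = acc.z t + (ζ j).z t := by
      have h1 : t ≤ acc.d := hb ▸ h.le
      have h2 : t ≤ (ζ j).d := hlj.le
      change (if t ≤ acc.d then acc.z t else 0) + (if t ≤ (ζ j).d then (ζ j).z t else 0) = _
      rw [if_pos h1, if_pos h2]
    obtain ⟨h1, h2, h3, h4⟩ := ih (acc := acc.sumD F ((ζ j).suf t))
      (h.sumD hlj hb.symm (hne j (by simp)).symm) hb (fun k hk => hl k (by simp [hk]))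
      (fun k hk => by
        rw [hd]
        split_ifs
        · exact hp1 k hk
        · exact hne k (by simp [hk])) hp2
    refine ⟨h1, h2, ?_, ?_⟩
    · rw [List.map_cons, List.foldl_cons, h3, hd, List.foldl_cons]
    · rw [List.map_cons, List.foldl_cons, h4, hz, List.map_cons, List.sum_cons, add_assoc]

end Folds

/-! ### The reduction phase -/

section Reduction

variable {V : Type*} [DecidableEq V] {ι : Type*}

/-- The data of the injective case: the intervals `s` and `o` are the ones that end at `i - 1` and
begin at `i + 1`, births and deaths are distinct, and nothing happens at `i` itself. -/
structure InjectiveData (F F' : Filtration V) (i p : ℕ) (σ : Finset V) (dim : ι → ℕ)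
    (ζ : ι → RepSeq V) (s o : ι) : Prop where
  contraction : IsOutwardContraction F F' i σ
  rep : ∀ k, F.IsRep (dim k) (ζ k)
  events : F.Events ζ
  death_s : (ζ s).d = i - 1
  dim_s : dim s = p
  birth_o : (ζ o).b = i + 1
  dim_o : dim o = p
  birth_ne : ∀ k, (ζ k).b ≠ i
  death_ne : ∀ k, (ζ k).d ≠ i

theorem Filtration.Events.birth_injective {F : Filtration V} {dim : ι → ℕ} {ζ : ι → RepSeq V}
    (h : F.Events ζ) (hrep : ∀ k, F.IsRep (dim k) (ζ k)) {k l : ι} (hkl : (ζ k).b = (ζ l).b) :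
    k = l := by
  have h1 := (hrep k).one_le
  have h2 := (hrep k).le
  have h3 := (hrep k).lt
  have e : (ζ k).b = (ζ k).b - 1 + 1 := by omega
  rcases h ((ζ k).b - 1) (by omega) with ⟨⟨k₀, -, h4⟩, -⟩ | ⟨-, h4⟩
  · rw [h4 k e, h4 l (hkl ▸ e)]
  · exact absurd e (h4 k)

theorem Filtration.Events.death_injective {F : Filtration V} {dim : ι → ℕ} {ζ : ι → RepSeq V}
    (h : F.Events ζ) (hrep : ∀ k, F.IsRep (dim k) (ζ k)) {k l : ι} (hkl : (ζ k).d = (ζ l).d) :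
    k = l := by
  rcases h (ζ k).d (hrep k).lt with ⟨-, h4⟩ | ⟨⟨k₁, -, h4⟩, -⟩
  · exact absurd rfl (h4 k)
  · rw [h4 k rfl, h4 l hkl.symm]

/-- The intervals that may occur in the decomposition: those of dimension `p` that contain
`i + 1`, other than the one that begins there. -/
def Crossing (i p : ℕ) (dim : ι → ℕ) (ζ : ι → RepSeq V) (o j : ι) : Prop :=
  j ≠ o ∧ dim j = p ∧ (ζ j).b ≤ i + 1 ∧ i + 1 ≤ (ζ j).d

namespace InjectiveData

variable {F F' : Filtration V} {i p : ℕ} {σ : Finset V} {dim : ι → ℕ} {ζ : ι → RepSeq V} {s o : ι}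
  (D : InjectiveData F F' i p σ dim ζ s o)

include D

theorem birth_inj {k l : ι} (h : (ζ k).b = (ζ l).b) : k = l := D.events.birth_injective D.rep h

theorem death_inj {k l : ι} (h : (ζ k).d = (ζ l).d) : k = l := D.events.death_injective D.rep h

theorem ne : s ≠ o := fun h => by
  have h1 := (D.rep s).le
  have h2 := D.death_s
  have h3 := D.birth_o
  rw [← h] at h3
  omega

theorem rep_s : F.IsRep p (ζ s) := D.dim_s ▸ D.rep s

theorem rep_o : F.IsRep p (ζ o) := D.dim_o ▸ D.rep o

/-- Nothing begins at `i`, and only `o` begins at `i + 1`; a crossing interval therefore contains `i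
- 1`, `i` and `i + 1`. -/
theorem crossing_birth {j : ι} (h : Crossing i p dim ζ o j) : (ζ j).b ≤ i - 1 := by
  have h1 := D.birth_ne j
  have h2 : (ζ j).b ≠ i + 1 := fun e => h.1 (D.birth_inj (e.trans D.birth_o.symm))
  have h3 := h.2.2.1
  omega

theorem crossing_ne {j : ι} (h : Crossing i p dim ζ o j) : j ≠ s := by
  rintro rfl
  have h1 := D.death_s
  have h2 := h.2.2.2
  omega

omit D in
theorem _root_.Zigzag.Crossing.rep {j : ι} (h : Crossing i p dim ζ o j)
    (hrep : ∀ k, F.IsRep (dim k) (ζ k)) : F.IsRep p (ζ j) := h.2.1 ▸ hrep j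

/-- The chains of a crossing interval next to `i`, and the cycles that they connect. -/
theorem crossing_link {j : ι} (h : Crossing i p dim ζ o j) :
    (ζ j).c (i - 1) + (ζ j).c i ∈ chains (F.K (i + 1)) (p + 1) ∧
    (ζ j).z (i - 1) + (ζ j).z (i + 1) = boundary ((ζ j).c (i - 1) + (ζ j).c i) := by
  have h1 := D.crossing_birth h
  have h2 := h.2.2.2
  have h3 := D.contraction.two_le
  have hr := h.rep D.rep
  have hl1 := hr.link (j := i - 1) (by omega) (by omega)
  have hl2 := hr.link (j := i) (by omega) (by omega)
  rw [D.contraction.pred_add_one] at hl1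
  refine ⟨add_mem ?_ (hl2.mem_fwd D.contraction.fwd), ?_⟩
  · rw [← D.contraction.K_eq_K]
    exact hl1.mem_bwd D.contraction.bwd
  · rw [map_add, ← hl1.eq, ← hl2.eq, add_assoc, ← add_assoc ((ζ j).z i), add_self_zero, zero_add]

theorem birthLT_iff (k l : ι) :
    F.BirthLT (ζ k).b (ζ l).b ↔ F.birthKey (ζ k).b < F.birthKey (ζ l).b :=
  Filtration.birthLT_iff (D.rep k).one_le (D.rep k).postBirth.birth_le_m (D.rep l).one_le
    (D.rep l).postBirth.birth_le_m

theorem deathLT_iff (k l : ι) :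
    F.DeathLT (ζ k).d (ζ l).d ↔ F.deathKey (ζ k).d < F.deathKey (ζ l).d :=
  Filtration.deathLT_iff (D.rep k).lt (D.rep l).lt

theorem birthLT_of_not {k l : ι} (hkl : k ≠ l) (h : ¬ F.BirthLT (ζ k).b (ζ l).b) :
    F.BirthLT (ζ l).b (ζ k).b := by
  rw [D.birthLT_iff] at h ⊢
  exact lt_of_le_of_ne (not_lt.1 h) fun e => hkl
    (D.birth_inj (Filtration.birthKey_inj (D.rep l).one_le (D.rep k).one_le e).symm)

theorem deathLT_of_not {k l : ι} (hkl : k ≠ l) (h : ¬ F.DeathLT (ζ k).d (ζ l).d) :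
    F.DeathLT (ζ l).d (ζ k).d := by
  rw [D.deathLT_iff] at h ⊢
  exact lt_of_le_of_ne (not_lt.1 h) fun e => hkl
    (D.death_inj (Filtration.deathKey_inj (D.rep l).lt (D.rep k).lt e).symm)

theorem birthLT_asymm {k l : ι} (h : F.BirthLT (ζ k).b (ζ l).b) :
    ¬ F.BirthLT (ζ l).b (ζ k).b := by
  rw [D.birthLT_iff] at h ⊢
  omega

theorem deathLT_asymm {k l : ι} (h : F.DeathLT (ζ k).d (ζ l).d) :
    ¬ F.DeathLT (ζ l).d (ζ k).d := by
  rw [D.deathLT_iff] at h ⊢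
  omega

end InjectiveData

/-- The properties of a state that the reduction phase preserves. -/
structure State.Valid (F : Filtration V) (i p : ℕ) (dim : ι → ℕ) (ζ : ι → RepSeq V) (s o : ι)
    (S : State V ι) : Prop where
  birth_s : S.ζs.b = (ζ s).b
  death_s : S.ζs.d = i - 1
  rep_s : F.IsRep p S.ζs
  birth_o : S.ζo.b = i + 1
  death_o : S.ζo.d = (ζ o).d
  rep_o : F.IsRep p S.ζo
  crossing : ∀ j ∈ S.Λ, Crossing i p dim ζ o j
  relation : S.Relation F i p ζ

/-! ### The reduction invariant, termination, and the joined sequences. -/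

namespace InjectiveData

variable {F F' : Filtration V} {i p : ℕ} {σ : Finset V} {dim : ι → ℕ} {ζ : ι → RepSeq V} {s o : ι}
  (D : InjectiveData F F' i p σ dim ζ s o)

include D

theorem valid_of_isInitial {S : State V ι} (h : S.IsInitial F i p dim ζ s o) :
    S.Valid F i p dim ζ s o := by
  obtain ⟨h1, h2, h3, h4⟩ := h
  exact ⟨by rw [h1], by rw [h1, D.death_s], h1 ▸ D.rep_s, by rw [h2, D.birth_o], by rw [h2],
    h2 ▸ D.rep_o, h3, h4⟩

/-- The chosen order comparison protects one end of the modified sequence, and the end next to `i`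
is protected by the direction of its arrow. A left step trades `z_{i+1}` for `z_{i-1}` at the cost
of `∂(c_{i-1} + c_i)`; a right step only moves `z_{i+1}` from the sum into `z^∘`. -/
theorem valid_step [DecidableEq ι] {S S' : State V ι} (h : S.Valid F i p dim ζ s o)
    (hstep : State.Step F i ζ s o S S') : S'.Valid F i p dim ζ s o := by
  classical
  have hi := D.contraction.two_le
  cases hstep with
  | left j hj hlt =>
    have hc := h.crossing j hj
    have h1 := D.crossing_birth hc
    have h2 := hc.2.2.2
    have hrep := hc.rep D.rep
    have hbs := h.rep_s.le
    have hds := h.death_s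
    have hnb : ¬ F.BirthLT (ζ s).b (ζ j).b := D.birthLT_asymm hlt
    -- A later death could exceed `i - 1` only if arrow `i - 1` were forward.
    have hnd : ¬ F.DeathLT (i - 1) (ζ j).d := by
      rintro (⟨h3, -⟩ | ⟨-, h3⟩)
      · omega
      · exact D.contraction.bwd.not_fwd (by have := D.contraction.lt; omega) h3
    obtain ⟨hl1, hl2⟩ := D.crossing_link hc
    refine ⟨?_, ?_, ?_, h.birth_o, h.death_o, h.rep_o,
      fun k hk => h.crossing k (Finset.mem_of_mem_erase hk), add_mem h.relation.1 hl1, ?_⟩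
    · change (if F.BirthLT S.ζs.b (ζ j).b then (ζ j).b else S.ζs.b) = _
      rw [h.birth_s, if_neg hnb]
    · change (if F.DeathLT S.ζs.d (ζ j).d then (ζ j).d else S.ζs.d) = _
      rw [hds, if_neg hnd]
    · refine h.rep_s.sum hrep (by omega) (by omega) h1 (by omega) ?_ (by omega)
      rw [h.birth_s]
      exact fun e => D.crossing_ne hc (D.birth_inj e)
    · have hz : (S.ζs.sum F (i - 1) (ζ j)).z (i - 1) = S.ζs.z (i - 1) + (ζ j).z (i - 1) := by
        change (if i - 1 < i - 1 then _ else
          (if i - 1 ≤ S.ζs.d then S.ζs.z (i - 1) else 0) +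
          (if i - 1 ≤ (ζ j).d then (ζ j).z (i - 1) else 0)) = _
        rw [if_neg (lt_irrefl _), if_pos (by omega), if_pos (by omega)]
      dsimp only
      rw [hz, map_add, ← hl2, h.relation.2, ← Finset.sum_erase_add _ _ hj]
      rw [show ∀ a b c d e : Chain V, a + (b + c) + d + e = a + b + (d + (e + c)) from
        fun _ _ _ _ _ => by abel]
  | right j hj hlt =>
    have hc := h.crossing j hj
    have h1 := D.crossing_birth hc
    have h2 := hc.2.2.2
    have hrep := hc.rep D.rep
    have hdo := h.rep_o.le
    have hbo := h.birth_o
    have hnd : ¬ F.DeathLT (ζ o).d (ζ j).d := D.deathLT_asymm hlt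
    -- An earlier birth could exceed `i + 1` only if arrow `i` were backward.
    have hnb : ¬ F.BirthLT (i + 1) (ζ j).b := by
      rintro (⟨h3, -⟩ | ⟨-, h3⟩)
      · omega
      · exact D.contraction.fwd.not_bwd D.contraction.lt h3
    refine ⟨h.birth_s, h.death_s, h.rep_s, ?_, ?_, ?_,
      fun k hk => h.crossing k (Finset.mem_of_mem_erase hk), h.relation.1, ?_⟩
    · change (if F.BirthLT S.ζo.b (ζ j).b then (ζ j).b else S.ζo.b) = _
      rw [hbo, if_neg hnb]
    · change (if F.DeathLT S.ζo.d (ζ j).d then (ζ j).d else S.ζo.d) = _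
      rw [h.death_o, if_neg hnd]
    · refine h.rep_o.sum hrep (by omega) (by omega) (by omega) h2 (by omega) ?_
      rw [h.death_o]
      exact fun e => hc.1 (D.death_inj e)
    · have hz : (S.ζo.sum F (i + 1) (ζ j)).z (i + 1) = S.ζo.z (i + 1) + (ζ j).z (i + 1) := by
        change (if i + 1 < i + 1 then _ else
          (if i + 1 ≤ S.ζo.d then S.ζo.z (i + 1) else 0) +
          (if i + 1 ≤ (ζ j).d then (ζ j).z (i + 1) else 0)) = _
        rw [if_neg (lt_irrefl _), if_pos (by omega), if_pos (by omega)]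
      dsimp only
      rw [hz, h.relation.2, ← Finset.sum_erase_add _ _ hj]
      abel

theorem valid_of_reflTransGen [DecidableEq ι] {S S' : State V ι} (h : S.Valid F i p dim ζ s o)
    (hr : Relation.ReflTransGen (State.Step F i ζ s o) S S') : S'.Valid F i p dim ζ s o := by
  induction hr with
  | refl => exact h
  | tail _ hstep ih => exact D.valid_step ih hstep

-- Every step removes an element of the finite set `Λ`.
omit D [DecidableEq V] in
theorem _root_.Zigzag.State.exists_terminal [DecidableEq ι] (S : State V ι) :
    ∃ S', Relation.ReflTransGen (State.Step F i ζ s o) S S' ∧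
      ∀ S'', ¬ State.Step F i ζ s o S' S'' := by
  induction hn : S.Λ.card using Nat.strong_induction_on generalizing S with
  | _ n ih =>
    by_cases hS : ∃ S', State.Step F i ζ s o S S'
    · obtain ⟨S', hS'⟩ := hS
      have hcard : S'.Λ.card < n := by
        subst hn
        cases hS' with
        | left j hj _ => exact Finset.card_erase_lt_of_mem hj
        | right j hj _ => exact Finset.card_erase_lt_of_mem hj
      obtain ⟨T, hT, hT'⟩ := ih _ hcard S' rfl
      exact ⟨T, Relation.ReflTransGen.head hS' hT, hT'⟩
    · exact ⟨S, Relation.ReflTransGen.refl, fun S' h => hS ⟨S', h⟩⟩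

theorem exists_run [DecidableEq ι] {S : State V ι} :
    ∃ S' js, State.Run F i ζ s o S S' js := by
  obtain ⟨S', h1, h2⟩ := State.exists_terminal (F := F) (i := i) (ζ := ζ) (s := s) (o := o) S
  obtain ⟨js, h3, h4, h5⟩ := exists_list_pairwise_lt (fun k => F.birthKey (ζ k).b) S'.Λ
    fun k _ l _ hkl => D.birth_inj
      (Filtration.birthKey_inj (D.rep k).one_le (D.rep l).one_le hkl)
  exact ⟨S', js, h1, h2, h3, h4, h5.imp fun h => (D.birthLT_iff _ _).2 h⟩

theorem orders_of_terminal [DecidableEq ι] {S : State V ι} (h : S.Valid F i p dim ζ s o)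
    (hS : ∀ S', ¬ State.Step F i ζ s o S S') {j : ι} (hj : j ∈ S.Λ) :
    F.BirthLT (ζ s).b (ζ j).b ∧ F.DeathLT (ζ o).d (ζ j).d :=
  ⟨D.birthLT_of_not (D.crossing_ne (h.crossing j hj)) fun hlt => hS _ (.left S j hj hlt),
    D.deathLT_of_not (h.crossing j hj).1 fun hlt => hS _ (.right S j hj hlt)⟩

open Classical in
/-- The joined sequences are representatives for the contracted filtration. -/
theorem isRep_joined {S : State V ι} (h : S.Valid F i p dim ζ s o)
    {js : List ι} (hnd : js.Nodup) (hjs : ∀ j, j ∈ js ↔ j ∈ S.Λ)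
    (hsorted : js.Pairwise fun j k => F.BirthLT (ζ j).b (ζ k).b)
    (hbirth : ∀ j ∈ js, F.BirthLT (ζ s).b (ζ j).b) (hdeath : ∀ j ∈ js, F.DeathLT (ζ o).d (ζ j).d)
    (r : ℕ) :
    F'.IsRep p (joined F i ζ S js r) ∧
      (joined F i ζ S js r).b = (js.take r).foldl (fun _ j => (ζ j).b) (ζ s).b ∧
      (joined F i ζ S js r).d =
        (js.drop r).foldl (fun d j => if F.DeathLT d (ζ j).d then (ζ j).d else d) (ζ o).d - 2 := by
  have hi := D.contraction.two_le
  have hcr : ∀ j ∈ js, Crossing i p dim ζ o j := fun j hj => h.crossing j ((hjs j).1 hj)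
  have htake : ∀ j ∈ js.take r, j ∈ js := fun j hj => List.mem_of_mem_take hj
  have hdrop : ∀ j ∈ js.drop r, j ∈ js := fun j hj => List.mem_of_mem_drop hj
  obtain ⟨a1, a2, a3, a4⟩ := Filtration.PostBirth.foldl_sumB (ζ := ζ) (t := i - 1) (js.take r)
    h.rep_s.postBirth h.death_s
    (fun j hj => by
      have hc := hcr j (htake j hj)
      exact (hc.rep D.rep).pre (D.crossing_birth hc) (by have := hc.2.2.2; omega))
    (fun j hj => by rw [h.birth_s]; exact hbirth j (htake j hj))
    (hsorted.sublist (List.take_sublist _ _))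
  obtain ⟨b1, b2, b3, b4⟩ := Filtration.PreDeath.foldl_sumD (ζ := ζ) (t := i + 1) (js.drop r)
    h.rep_o.preDeath h.birth_o
    (fun j hj => by
      have hc := hcr j (hdrop j hj)
      exact (hc.rep D.rep).suf hc.2.2.1 hc.2.2.2)
    (fun j hj => by
      rw [h.death_o]
      rcases hdeath j (hdrop j hj) with h' | h' <;> omega)
    ((hnd.sublist (List.drop_sublist _ _)).imp fun hne e => hne (D.death_inj e))
  rw [h.birth_s] at a3
  rw [h.death_o] at b3
  have hKK : F'.K (i - 1) = F.K (i + 1) := by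
    rw [D.contraction.K_left (by omega), D.contraction.K_eq_K]
  have hsum : ∀ l : List ι, (∀ j ∈ l, j ∈ js) →
      (l.map fun j => (ζ j).c (i - 1) + (ζ j).c i).sum ∈ chains (F.K (i + 1)) (p + 1) ∧
      (l.map fun j => (ζ j).z (i - 1)).sum + (l.map fun j => (ζ j).z (i + 1)).sum =
        boundary (l.map fun j => (ζ j).c (i - 1) + (ζ j).c i).sum := fun l hl => by
    induction l with
    | nil => simp
    | cons j l ih =>
      obtain ⟨c1, c2⟩ := ih fun k hk => hl k (by simp [hk])
      obtain ⟨c3, c4⟩ := D.crossing_link (hcr j (hl j (by simp)))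
      simp only [List.map_cons, List.sum_cons]
      refine ⟨add_mem c3 c1, ?_⟩
      rw [map_add, ← c2, ← c4]
      abel
  obtain ⟨c1, c2⟩ := hsum _ htake
  have hΛ : ∑ j ∈ S.Λ, (ζ j).z (i + 1) = ((js.take r).map fun j => (ζ j).z (i + 1)).sum +
      ((js.drop r).map fun j => (ζ j).z (i + 1)).sum := by
    have e : S.Λ = js.toFinset := by
      ext j
      rw [List.mem_toFinset, hjs]
    rw [e, List.sum_toFinset _ hnd, ← List.sum_append, ← List.map_append, List.take_append_drop]
  refine ⟨?_, a3, congrArg (· - 2) b3⟩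
  have hL := D.contraction.postBirth_left a1 (by rw [a2]; omega)
  have hR := D.contraction.preDeath_shift b1 (by rw [b2]; omega)
  have hRb : (((js.drop r).map fun j => (ζ j).suf (i + 1)).foldl (RepSeq.sumD F) S.ζo).shift.b =
      i - 1 := by
    change (((js.drop r).map fun j => (ζ j).suf (i + 1)).foldl (RepSeq.sumD F) S.ζo).b - 2 = _
    rw [b2]
    omega
  have hRz : (((js.drop r).map fun j => (ζ j).suf (i + 1)).foldl (RepSeq.sumD F) S.ζo).shift.z
      (i - 1) = S.ζo.z (i + 1) + ((js.drop r).map fun j => (ζ j).z (i + 1)).sum := by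
    rw [← b4]
    change RepSeq.z _ (i - 1 + 2) = _
    rw [show i - 1 + 2 = i + 1 by omega]
  refine hL.concat hR (by rw [hRb, a2]) ?_ ?_
  · rw [hRb, hKK]
    exact add_mem h.relation.1 c1
  -- Replacing `z_{i+1}` by `z_{i-1}` for the first `r` intervals adds exactly the boundaries of
  -- their `c_{i-1} + c_i` to `∂A`.
  · rw [hRb, hRz, a4, h.relation.2, hΛ, map_add, ← c2]
    abel

end InjectiveData

end Reduction

section Main

variable {V : Type*} [DecidableEq V] {ι : Type*} {F F' : Filtration V} {i p : ℕ} {σ : Finset V}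
  {dim : ι → ℕ} {ζ : ι → RepSeq V}

/-! ### The two cases -/

/-- The arrows next to `i` when `σ` lies in a cycle of `K_{i-1}`. -/
theorem IsOutwardContraction.arrows_of_inCycle (hF : IsOutwardContraction F F' i σ)
    (hζ : F.IsBarcodeWithReps dim ζ) (hc : InCycle (F.K (i - 1)) σ) :
    ((∃ s, (ζ s).d = i - 1 ∧ ∀ k, (ζ k).d = i - 1 → k = s) ∧ ∀ k, (ζ k).b ≠ i) ∧
    ((∃ o, (ζ o).b = i + 1 ∧ ∀ k, (ζ k).b = i + 1 → k = o) ∧ ∀ k, (ζ k).d ≠ i) := by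
  have h1 := hF.lt
  obtain ⟨-, -, h2, -⟩ := hζ.arrow (j := i - 1) (by omega)
  obtain ⟨h3, -, -, -⟩ := hζ.arrow (j := i) h1
  rw [hF.cell_left, hF.pred_add_one] at h2
  rw [hF.cell_right, ← hF.K_eq_K] at h3
  exact ⟨h2 hF.bwd hc, h3 hF.fwd hc⟩

/-- The arrows next to `i` when `σ` does not lie in a cycle of `K_{i-1}`. -/
theorem IsOutwardContraction.arrows_of_not_inCycle (hF : IsOutwardContraction F F' i σ)
    (hζ : F.IsBarcodeWithReps dim ζ) (hc : ¬ InCycle (F.K (i - 1)) σ) :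
    ((∃ k₀, (ζ k₀).b = i ∧ ∀ k, (ζ k).b = i → k = k₀) ∧ ∀ k, (ζ k).d ≠ i - 1) ∧
    ((∃ k₁, (ζ k₁).d = i ∧ ∀ k, (ζ k).d = i → k = k₁) ∧ ∀ k, (ζ k).b ≠ i + 1) := by
  have h1 := hF.lt
  obtain ⟨-, -, -, h2⟩ := hζ.arrow (j := i - 1) (by omega)
  obtain ⟨-, h3, -, -⟩ := hζ.arrow (j := i) h1
  rw [hF.cell_left, hF.pred_add_one] at h2
  rw [hF.cell_right, ← hF.K_eq_K] at h3
  exact ⟨h2 hF.bwd hc, h3 hF.fwd hc⟩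

/-- In the surjective case the interval born at `i` also dies at `i`. -/
theorem IsOutwardContraction.birth_eq_death (hF : IsOutwardContraction F F' i σ)
    (hζ : F.IsBarcodeWithReps dim ζ) {k l : ι} (hk : (ζ k).b = i) (hl : (ζ l).d = i) : k = l := by
  classical
  by_contra hne
  have hrep := hζ.1
  have hB := Filtration.isHBasis_of_events hrep hζ.events i
  obtain ⟨h1, h2, h3⟩ := (hrep k).birth_bwd (by rw [hk]; exact hF.bwd)
  obtain ⟨h4, h5, h6⟩ := (hrep l).death_fwd (by rw [hl]; exact hF.fwd)
  rw [hk, hF.cell_left] at h3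
  rw [hk] at h1 h2
  rw [hl, hF.cell_right] at h6
  rw [hl] at h4 h5
  rw [← hF.K_eq_K] at h4
  have hdim : dim k = dim l := by
    have := coeff_dim_eq h1 h4 h3 h6
    omega
  have hkl := (hrep k).le
  have hll := (hrep l).le
  -- Both cycles at `i` are boundaries of chains through `σ`. The sum of these chains lies in `K_i`,
  -- so two distinct basis elements would be dependent.
  have := hB.indep (dim k) {k, l} (fun x hx => ?_) ?_
  · simp at this
  · rcases Finset.mem_insert.1 hx with rfl | hx
    · exact ⟨⟨hk.le, by omega⟩, rfl⟩
    · rw [Finset.mem_singleton.1 hx]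
      exact ⟨⟨by omega, hl.ge⟩, hdim.symm⟩
  · rw [Finset.sum_pair hne, h2, h5, ← map_add]
    exact mem_boundaries.2 ⟨_, hF.adds_left.add_mem_chains h1 (hdim ▸ h4) h3 h6, rfl⟩

/-- The interval `[i, i]` accounts for the events on both removed arrows, so it plays the role of
`s` and of `o`, and the pairing is the identity. -/
theorem IsOutwardContraction.surjective_case (hF : IsOutwardContraction F F' i σ)
    (hζ : F.IsBarcodeWithReps dim ζ) (hc : ¬ InCycle (F.K (i - 1)) σ) :
    ∃ k₀, ((ζ k₀).b = i ∧ (ζ k₀).d = i) ∧ (∀ k, (ζ k).b = i ∧ (ζ k).d = i → k = k₀) ∧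
      F'.IsBarcodeWithReps (fun k : {k // k ≠ k₀} => dim k.1) (fun k => (ζ k.1).carry i) ∧
      ∀ k, k ≠ k₀ → ((ζ k).carry i).b = collapse i (ζ k).b ∧
        ((ζ k).carry i).d = collapse i (ζ k).d := by
  obtain ⟨⟨⟨k₀, h1, h2⟩, h3⟩, ⟨⟨k₁, h4, h5⟩, h6⟩⟩ := hF.arrows_of_not_inCycle hζ hc
  obtain rfl := hF.birth_eq_death hζ h1 h4
  have key : ∀ k, k ≠ k₀ → F'.IsRep (dim k) ((ζ k).carry i) ∧
      ((ζ k).carry i).b = collapse i (ζ k).b ∧ ((ζ k).carry i).d = collapse i (ζ k).d :=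
    fun k hk => hF.isRep_carry (hζ.1 k) (fun e => hk (h2 k e)) (h6 k) (h3 k) fun e => hk (h5 k e)
  refine ⟨k₀, ⟨h1, h4⟩, fun k hk => h2 k hk.1, ?_, fun k hk => (key k hk).2⟩
  exact hF.isBarcodeWithReps hζ.events (s := k₀) (o := k₀) id (fun k hk => hk)
    (fun k l _ _ h => h) (fun l hl => ⟨l, hl, rfl⟩)
    (fun k hk => ⟨fun e => hk (h2 k e), h6 k⟩) (Or.inl h1)
    (fun k hk => ⟨h3 k, fun e => hk (h5 k e)⟩) (Or.inr h4)
    (fun k => (ζ k).carry i) (fun k hk => (key k hk).1) fun k hk => (key k hk).2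

namespace InjectiveData

variable {s o : ι} (D : InjectiveData F F' i p σ dim ζ s o)

include D

/-- The death condition puts `σ` into `z^*_{i-1}`. A cycle at `i + 1` that continues from `K_i`
avoids `σ`, so the basis expansion of `z^*_{i-1}` must involve `o`. -/
theorem exists_initial [DecidableEq ι] :
    ∃ S₀ : State V ι, S₀.IsInitial F i p dim ζ s o := by
  have hi := D.contraction.two_le
  have hB := Filtration.isHBasis_of_events D.rep D.events (i + 1)
  have hs := D.rep_s
  have ho := D.rep_o
  have hds := D.death_s
  have hbo := D.birth_o
  have hcyc : (ζ s).z (i - 1) ∈ cycles (F.K (i + 1)) p := by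
    rw [← D.contraction.K_eq_K]
    exact hs.cycle _ (by have := hs.le; omega) hds.ge
  have hsσ : (ζ s).z (i - 1) σ ≠ 0 := by
    have := hs.death_bwd (by rw [hds]; exact D.contraction.bwd)
    rwa [hds, D.contraction.cell_left] at this
  obtain ⟨a, ha, hza⟩ := hB.span p _ hcyc
  have hoa : o ∈ a := by
    by_contra hoa
    rw [D.contraction.adds_right.coeff_eq_of_add_mem hza] at hsσ
    refine hsσ (coeff_sum_zero fun k hk => ?_)
    obtain ⟨⟨h1, h2⟩, h3⟩ := ha k hk
    have hc : Crossing i p dim ζ o k := ⟨fun e => hoa (e ▸ hk), h3, h1, h2⟩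
    have hb := D.crossing_birth hc
    have hr := hc.rep D.rep
    have := (hr.link (j := i) (by omega) (by omega)).coeff_fwd D.contraction.lt D.contraction.fwd
      (hr.cycle i (by omega) (by omega))
    rwa [D.contraction.cell_right] at this
  obtain ⟨A, hA, hAz⟩ := mem_boundaries.1 hza
  refine ⟨⟨a.erase o, ζ s, ζ o, A⟩, rfl, rfl, fun j hj => ?_, hA, ?_⟩
  · obtain ⟨h1, h2⟩ := Finset.mem_erase.1 hj
    exact ⟨h1, (ha j h2).2, (ha j h2).1⟩
  · dsimp only
    rw [hAz, ← Finset.sum_erase_add _ _ hoa]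
    rw [show ∀ x y z : Chain V, x + y + (z + (y + x)) = (x + x) + (y + y) + z from
      fun _ _ _ => by abel, add_self_zero, add_self_zero, zero_add, zero_add]

/-- Adding two such relations makes the sum over the symmetric difference a boundary, so
independence at `i + 1` forces it to be empty. -/
theorem initial_unique [DecidableEq ι] {S₀ S₁ : State V ι} (h₀ : S₀.IsInitial F i p dim ζ s o)
    (h₁ : S₁.IsInitial F i p dim ζ s o) : S₀.Λ = S₁.Λ := by
  have hB := Filtration.isHBasis_of_events D.rep D.events (i + 1)
  obtain ⟨a1, a2, a3, a4, a5⟩ := h₀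
  obtain ⟨b1, b2, b3, b4, b5⟩ := h₁
  refine symmDiff_eq_bot.1 (hB.indep p (symmDiff S₀.Λ S₁.Λ) (fun k hk => ?_) ?_)
  · rcases Finset.mem_symmDiff.1 hk with ⟨hk, -⟩ | ⟨hk, -⟩
    · exact ⟨(a3 k hk).2.2, (a3 k hk).2.1⟩
    · exact ⟨(b3 k hk).2.2, (b3 k hk).2.1⟩
  · rw [sum_symmDiff]
    refine mem_boundaries.2 ⟨S₀.A + S₁.A, add_mem a4 b4, ?_⟩
    rw [a1, a2] at a5
    rw [b1, b2] at b5
    have h := a5.symm.trans b5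
    rw [add_assoc, add_assoc] at h
    have h2 := eq_add_of_add_eq ((add_comm _ _).trans (add_left_cancel h))
    rw [map_add]
    rw [h2, add_assoc, add_assoc, add_self_zero, add_zero]

/-- The end of the reduction phase: the new sequences have the claimed ends and give the barcode of
the contracted filtration. -/
theorem newRep_spec [DecidableEq ι] {S : State V ι} (h : S.Valid F i p dim ζ s o) {js : List ι}
    (hnd : js.Nodup) (hjs : ∀ j, j ∈ js ↔ j ∈ S.Λ)
    (hsorted : js.Pairwise fun j k => F.BirthLT (ζ j).b (ζ k).b)
    (hbirth : ∀ j ∈ js, F.BirthLT (ζ s).b (ζ j).b) (hdeath : ∀ j ∈ js, F.DeathLT (ζ o).d (ζ j).d)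
    {k : ι} (hk : k ≠ o) :
    F'.IsRep (dim k) (newRep F i ζ s o S js k) ∧
      (newRep F i ζ s o S js k).b = collapse i (ζ k).b ∧
      (newRep F i ζ s o S js k).d = collapse i (ζ (partner F ζ s o js k)).d := by
  classical
  have hi := D.contraction.two_le
  have hlt : ∀ k, (ζ k).d < F.m := fun k => (D.rep k).lt
  have hcr : ∀ j ∈ js, Crossing i p dim ζ o j := fun j hj => h.crossing j ((hjs j).1 hj)
  have hs : s ∉ js := fun hmem => D.crossing_ne (hcr s hmem) rfl
  obtain ⟨p1, p2, p3, p4, p5, p6, p7⟩ := partner_spec (s := s) (o := o) hlt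
    (fun k l e => D.death_inj e) hnd hs
  have hjoin := D.isRep_joined h hnd hjs hsorted hbirth hdeath
  have hso := D.rep_o.le
  have hbo := D.birth_o
  have hcol : ∀ d, i + 1 ≤ d → d - 2 = collapse i d := fun d hd => by
    rw [collapse, if_neg (by omega), if_neg (by omega)]
  have hcolb : ∀ b, b ≤ i - 1 → b = collapse i b := fun b hb => by
    rw [collapse, if_pos (by omega)]
  have hdo : (ζ o).d - 2 = collapse i (ζ o).d := hcol _ (by omega)
  -- `d_∘` precedes every listed death, so the first summand already displaces it from the maximum.
  have hend : ∀ y w, (∀ x ∈ y :: w, x ∈ js) →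
      (y :: w).foldl (fun d j => if F.DeathLT d (ζ j).d then (ζ j).d else d) (ζ o).d - 2 =
        collapse i (ζ (maxDeath F ζ y w)).d := fun y w hyw => by
    rw [List.foldl_cons, if_pos (hdeath y (hyw y (by simp))), ← maxDeath_d]
    exact hcol _ (hcr _ (hyw _ (maxDeath_spec hlt y w).1)).2.2.2
  rw [newRep]
  split_ifs with hks hkj
  · subst hks
    obtain ⟨h1, h2, h3⟩ := hjoin 0
    rw [h2, h3, D.dim_s]
    refine ⟨h1, hcolb (ζ k).b ?_, ?_⟩
    · have := (D.rep k).le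
      have := D.death_s
      omega
    · rcases js with _ | ⟨y, w⟩
      · rw [p2 rfl]
        exact hdo
      · rw [p3 y w rfl]
        exact hend y w fun x hx => hx
  · obtain ⟨hmem, hne⟩ := hkj
    obtain ⟨u, v, rfl⟩ := List.append_of_mem hmem
    have hku : k ∉ u := fun hku => by
      have := (List.nodup_append.1 hnd).2.2 k hku k (by simp)
      exact this rfl
    -- `idxOf` counts from zero: with `r = idxOf k + 1` the left half ends with `k` itself, and the
    -- right half contains its successors.
    have hidx : (u ++ k :: v).idxOf k = u.length := by
      rw [List.idxOf_append_of_notMem hku, List.idxOf_cons_self, add_zero]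
    have htake : (u ++ k :: v).take (u.length + 1) = u ++ [k] := by
      rw [List.take_append]
      simp
    have hdrop : (u ++ k :: v).drop (u.length + 1) = v := by
      rw [List.drop_append]
      simp
    have hc := hcr k hmem
    obtain ⟨h1, h2, h3⟩ := hjoin (u.length + 1)
    rw [htake, List.foldl_append] at h2
    rw [hdrop] at h3
    rw [hidx, h2, h3, hc.2.1]
    refine ⟨h1, hcolb _ (D.crossing_birth hc), ?_⟩
    rcases v with _ | ⟨y, w⟩
    · rw [p4 u k rfl]
      exact hdo
    · rw [(p5 u k y w rfl).resolve_left hne]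
      exact hend y w fun x hx => by
        simp only [List.mem_append, List.mem_cons] at hx ⊢
        exact Or.inr (Or.inr hx)
  · have hpk : partner F ζ s o js k = k := by
      by_cases hmem : k ∈ js
      · by_contra hne
        exact hkj ⟨hmem, hne⟩
      · exact p1 k hmem hks
    rw [hpk]
    exact D.contraction.isRep_carry (D.rep k) (D.birth_ne k)
      (fun e => hk (D.birth_inj (e.trans hbo.symm)))
      (fun e => hks (D.death_inj (e.trans D.death_s.symm))) (D.death_ne k)

theorem isBarcodeWithReps_newRep [Fintype ι] [DecidableEq ι] {S : State V ι}
    (h : S.Valid F i p dim ζ s o) {js : List ι} (hnd : js.Nodup) (hjs : ∀ j, j ∈ js ↔ j ∈ S.Λ)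
    (hsorted : js.Pairwise fun j k => F.BirthLT (ζ j).b (ζ k).b)
    (hbirth : ∀ j ∈ js, F.BirthLT (ζ s).b (ζ j).b)
    (hdeath : ∀ j ∈ js, F.DeathLT (ζ o).d (ζ j).d) :
    F'.IsBarcodeWithReps (fun k : {k // k ≠ o} => dim k.1)
      (fun k => newRep F i ζ s o S js k.1) := by
  have hlt : ∀ k, (ζ k).d < F.m := fun k => (D.rep k).lt
  have hcr : ∀ j ∈ js, Crossing i p dim ζ o j := fun j hj => h.crossing j ((hjs j).1 hj)
  have hs : s ∉ js := fun hmem => D.crossing_ne (hcr s hmem) rfl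
  have ho : o ∉ js := fun hmem => (hcr o hmem).1 rfl
  obtain ⟨p1, p2, p3, p4, p5, p6, p7⟩ := partner_spec (s := s) (o := o) hlt
    (fun k l e => D.death_inj e) hnd hs
  have hπ : ∀ k, k ≠ o → partner F ζ s o js k ≠ s := fun k hk => by
    by_cases hks : k = s
    · subst hks
      rcases js with _ | ⟨y, w⟩
      · rw [p2 rfl]
        exact D.ne.symm
      · rw [p3 y w rfl]
        exact fun e => hs (e ▸ (maxDeath_spec hlt y w).1)
    by_cases hmem : k ∈ js
    · rcases p6 k hmem with h1 | h1
      · exact fun e => hs (e ▸ h1)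
      · rw [h1]
        exact D.ne.symm
    · rw [p1 k hmem hks]
      exact hks
  have hsurj : ∀ l, l ≠ s → ∃ k, k ≠ o ∧ partner F ζ s o js k = l := fun l hl => by
    by_cases hlo : l = o
    · subst hlo
      rcases List.eq_nil_or_concat js with rfl | ⟨u, x, rfl⟩
      · exact ⟨s, D.ne, p2 rfl⟩
      · rw [List.concat_eq_append] at *
        exact ⟨x, fun e => ho (by rw [e]; simp), p4 u x rfl⟩
    · obtain ⟨x, hx, hxl⟩ := p7 l hl hlo
      refine ⟨x, ?_, hxl⟩
      rintro rfl
      rcases hx with hx | hx | hx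
      · exact D.ne hx.symm
      · exact ho hx
      · exact hlo hx.symm
  -- A surjection between finite types of equal size is injective; each side is `ι` with one element
  -- removed.
  have hinj : Function.Injective
      fun k : {k // k ≠ o} => (⟨partner F ζ s o js k.1, hπ k.1 k.2⟩ : {k // k ≠ s}) := by
    refine ((Fintype.bijective_iff_surjective_and_card _).2 ⟨?_, ?_⟩).1
    · rintro ⟨l, hl⟩
      obtain ⟨k, hk, hkl⟩ := hsurj l hl
      exact ⟨⟨k, hk⟩, Subtype.ext hkl⟩
    · rw [Fintype.card_subtype_compl, Fintype.card_subtype_compl, Fintype.card_subtype_eq,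
        Fintype.card_subtype_eq]
  have key := fun k (hk : k ≠ o) => D.newRep_spec h hnd hjs hsorted hbirth hdeath hk
  refine D.contraction.isBarcodeWithReps D.events (partner F ζ s o js) hπ (fun k l hk hl e => ?_)
    hsurj (fun k hk => ⟨D.birth_ne k, fun e => hk (D.birth_inj (e.trans D.birth_o.symm))⟩)
    (Or.inr D.birth_o)
    (fun k hk => ⟨fun e => hk (D.death_inj (e.trans D.death_s.symm)), D.death_ne k⟩)
    (Or.inl D.death_s) (newRep F i ζ s o S js) (fun k hk => (key k hk).1)
    fun k hk => (key k hk).2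
  exact congrArg Subtype.val (@hinj ⟨k, hk⟩ ⟨l, hl⟩ (Subtype.ext e))

end InjectiveData

end Main

end Zigzag

theorem mainTheorem3 {V : Type*} [DecidableEq V] {ι : Type*} [Fintype ι] [DecidableEq ι]
    (F F' : Zigzag.Filtration V) (i p : ℕ) (σ : Finset V) (hσ : σ.card = p + 1)
    (hF : Zigzag.IsOutwardContraction F F' i σ)
    (dim : ι → ℕ) (ζ : ι → Zigzag.RepSeq V) (hζ : F.IsBarcodeWithReps dim ζ) :
    -- the backward map in homology is surjective or injective, which the barcode decides
    ((∀ q, Function.Surjective (Zigzag.homologyMap hF.left q)) ∨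
      (∀ q, Function.Injective (Zigzag.homologyMap hF.left q))) ∧
    ((∀ q, Function.Surjective (Zigzag.homologyMap hF.left q)) ↔ ∃ k, (ζ k).b = i) ∧
    ((∀ q, Function.Injective (Zigzag.homologyMap hF.left q)) ↔ ∃ k, (ζ k).d = i - 1) ∧
    -- the surjective case
    ((∀ q, Function.Surjective (Zigzag.homologyMap hF.left q)) →
      ∃ k₀, ((ζ k₀).b = i ∧ (ζ k₀).d = i) ∧ (∀ k, (ζ k).b = i ∧ (ζ k).d = i → k = k₀) ∧
        F'.IsBarcodeWithReps (fun k : {k // k ≠ k₀} => dim k.1) (fun k => (ζ k.1).carry i) ∧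
        ∀ k, k ≠ k₀ → ((ζ k).carry i).b = Zigzag.collapse i (ζ k).b ∧
          ((ζ k).carry i).d = Zigzag.collapse i (ζ k).d) ∧
    -- the injective case
    ((∀ q, Function.Injective (Zigzag.homologyMap hF.left q)) →
      ∃ s o, s ≠ o ∧
        ((ζ s).d = i - 1 ∧ dim s = p ∧ ∀ k, (ζ k).d = i - 1 → k = s) ∧
        ((ζ o).b = i + 1 ∧ dim o = p ∧ ∀ k, (ζ k).b = i + 1 → k = o) ∧
        -- the decomposition exists, and its index set is unique
        (∃ S₀ : Zigzag.State V ι, S₀.IsInitial F i p dim ζ s o) ∧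
        (∀ S₀ S₁ : Zigzag.State V ι, S₀.IsInitial F i p dim ζ s o →
          S₁.IsInitial F i p dim ζ s o → S₀.Λ = S₁.Λ) ∧
        ∀ S₀ : Zigzag.State V ι, S₀.IsInitial F i p dim ζ s o →
          -- the reduction phase can be completed
          (∃ S js, Zigzag.State.Run F i ζ s o S₀ S js) ∧
          -- however it is carried out, the following hold
          ∀ S js, Zigzag.State.Run F i ζ s o S₀ S js →
            (S.ζs.b = (ζ s).b ∧ S.ζs.d = i - 1 ∧ F.IsRep p S.ζs) ∧
            (S.ζo.b = i + 1 ∧ S.ζo.d = (ζ o).d ∧ F.IsRep p S.ζo) ∧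
            S.Relation F i p ζ ∧
            (∀ j ∈ S.Λ, F.BirthLT (ζ s).b (ζ j).b ∧ F.DeathLT (ζ o).d (ζ j).d) ∧
            -- the new barcode and its representatives, one for each birth index but `i + 1`
            (∀ k, k ≠ o →
              (Zigzag.newRep F i ζ s o S js k).b = Zigzag.collapse i (ζ k).b ∧
              (Zigzag.newRep F i ζ s o S js k).d =
                Zigzag.collapse i (ζ (Zigzag.partner F ζ s o js k)).d) ∧
            F'.IsBarcodeWithReps (fun k : {k // k ≠ o} => dim k.1)
              (fun k => Zigzag.newRep F i ζ s o S js k.1)) := by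
  have hleft := hF.adds_left
  -- Both properties of the homology map are decided by whether `σ` lies in a cycle of `K_{i-1}`.
  have hsurj : ¬ Zigzag.InCycle (F.K (i - 1)) σ ↔
      ∀ q, Function.Surjective (Zigzag.homologyMap hF.left q) :=
    ⟨hleft.surjective_of_not_inCycle, fun h hc =>
      let ⟨q, hq⟩ := hleft.not_surjective_of_inCycle hc
      hq (h q)⟩
  have hinj : Zigzag.InCycle (F.K (i - 1)) σ ↔
      ∀ q, Function.Injective (Zigzag.homologyMap hF.left q) :=
    ⟨hleft.injective_of_inCycle, fun h => by
      by_contra hc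
      obtain ⟨q, hq⟩ := hleft.not_injective_of_not_inCycle hc
      exact hq (h q)⟩
  rw [← hsurj, ← hinj]
  refine ⟨(em _).symm, ⟨fun hc => ?_, fun ⟨k, hk⟩ hc => ?_⟩, ⟨fun hc => ?_, fun ⟨k, hk⟩ => ?_⟩,
    hF.surjective_case hζ, fun hc => ?_⟩
  · obtain ⟨⟨⟨k, hk, -⟩, -⟩, -⟩ := hF.arrows_of_not_inCycle hζ hc
    exact ⟨k, hk⟩
  · exact (hF.arrows_of_inCycle hζ hc).1.2 k hk
  · obtain ⟨⟨⟨k, hk, -⟩, -⟩, -⟩ := hF.arrows_of_inCycle hζ hc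
    exact ⟨k, hk⟩
  · by_contra hc
    exact (hF.arrows_of_not_inCycle hζ hc).1.2 k hk
  obtain ⟨⟨⟨s, hs, hs'⟩, hb⟩, ⟨⟨o, ho, ho'⟩, hd⟩⟩ := hF.arrows_of_inCycle hζ hc
  -- The end conditions next to `i` put the `p`-simplex `σ` into a cycle of each of the two
  -- intervals, which fixes their dimension.
  have hdim_s : dim s = p := by
    have h1 := (hζ.1 s).death_bwd (by rw [hs]; exact hF.bwd)
    rw [hs, hF.cell_left] at h1
    have h2 := (hζ.1 s).cycle (i - 1) (hs ▸ (hζ.1 s).le) hs.ge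
    have h3 := (Zigzag.mem_chains.1 h2.1 σ h1).2
    omega
  have hdim_o : dim o = p := by
    have h1 := (hζ.1 o).birth_fwd (by rw [ho]; exact hF.fwd)
    simp only [ho, Nat.add_sub_cancel, hF.cell_right] at h1
    have h2 := (hζ.1 o).cycle (i + 1) ho.le (ho ▸ (hζ.1 o).le)
    have h3 := (Zigzag.mem_chains.1 h2.1 σ h1).2
    omega
  have D : Zigzag.InjectiveData F F' i p σ dim ζ s o :=
    ⟨hF, hζ.1, hζ.events, hs, hdim_s, ho, hdim_o, hb, hd⟩
  refine ⟨s, o, D.ne, ⟨hs, hdim_s, hs'⟩, ⟨ho, hdim_o, ho'⟩, D.exists_initial,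
    fun S₀ S₁ h₀ h₁ => D.initial_unique h₀ h₁, fun S₀ h₀ => ⟨D.exists_run, ?_⟩⟩
  rintro S js ⟨hrun, hterm, hnd, hjs, hsorted⟩
  have hS := D.valid_of_reflTransGen (D.valid_of_isInitial h₀) hrun
  have hmem : ∀ j, j ∈ js ↔ j ∈ S.Λ := fun j => by rw [← hjs, List.mem_toFinset]
  have hord : ∀ j ∈ S.Λ, F.BirthLT (ζ s).b (ζ j).b ∧ F.DeathLT (ζ o).d (ζ j).d :=
    fun j hj => D.orders_of_terminal hS hterm hj
  have hbirth := fun j hj => (hord j ((hmem j).1 hj)).1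
  have hdeath := fun j hj => (hord j ((hmem j).1 hj)).2
  exact ⟨⟨hS.birth_s, hS.death_s, hS.rep_s⟩, ⟨hS.birth_o, hS.death_o, hS.rep_o⟩, hS.relation, hord,
    fun k hk => (D.newRep_spec hS hnd hmem hsorted hbirth hdeath hk).2,
    D.isBarcodeWithReps_newRep hS hnd hmem hsorted hbirth hdeath⟩
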